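/- Let $k$ be a field, let $X$ be a smooth curve over $k$ (a separated $k$-scheme of finite type, smooth of relative dimension $1$; neither properness nor connectedness is needed), let $S\subset X(k)$ be a finite set of rational points with complement $U=X\setminus S$, and let $n\ge 0$. Let $q\colon X^n\to X^{(n)}=X^n/S_n$ be the $n$-th symmetric power of $X$ over $k$ (that is, $q$ is the affine morphism invariant under permutation of the coordinates with $\mathcal O_{X^{(n)}}=(q_*\mathcal O_{X^n})^{S_n}$), and let $S^{(n)}=X^{(n)}\setminus U^{(n)}$ be the locus of divisors meeting $S$, with its reduced structure, where $U^{(n)}=q(U^n)$. 1. $X^{(n)}$ is locally Noetherian and regular, and $S^{(n)}$ is a (strict) normal crossings divisor in it: $S^{(n)}$ is closed, and for every $y\in X^{(n)}$ there are members $f_1,\dots,f_r$ ($r\ge 0$) of a regular system of parameters of $\mathcal O_{X^{(n)},y}$ such that $S^{(n)}$ is the zero locus of $f_1\cdots f_r$ in $\operatorname{Spec}\mathcal O_{X^{(n)},y}$. 2. Locally, $S^{(n)}$ is a union of hyperplanes: every $y\in X^{(n)}$ has an open neighbourhood $W$ with an étale $k$-morphism $c\colon W\to\mathbb A^n_k$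 such that $S^{(n)}\cap W$ is the inverse image under $c$ of a union of coordinate hyperplanes (possibly the empty union). 3. For $X=\mathbb A^1_k$, the morphism $\mathbb A^n_k\to\mathbb A^n_k$ given by the elementary symmetric polynomials $(\sigma_1,\dots,\sigma_n)$ in the coordinates is the $n$-th symmetric power, so that $(\mathbb A^1)^{(n)}\cong\mathbb A^n$, and for a finite set $S\subset k$, $S^{(n)}$ is the union over $s\in S$ of the affine hyperplanes $$(-s)^n+(-s)^{n-1}\sigma_1+\cdots+(-s)\sigma_{n-1}+\sigma_n=0$$ (for $n=0$ this equation is $1=0$, and $S^{(0)}=\emptyset$). -/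

import Mathlib

open CategoryTheory AlgebraicGeometry

universe u

namespace SymCurve

section FibrePower

variable {B X P Y : Scheme.{u}} {n : ℕ}

/-- `p : P ⟶ B` together with the projections `π i : P ⟶ X` is the `n`-fold fibre power
`X ×_B ⋯ ×_B X` of `f : X ⟶ B`. For `n = 0` this says that `P` is `B`. -/
structure IsFibrePower (f : X ⟶ B) (p : P ⟶ B) (π : Fin n → (P ⟶ X)) : Prop where
  w : ∀ i, π i ≫ f = p
  existsUnique_lift : ∀ (T : Scheme.{u}) (t : T ⟶ B) (φ : Fin n → (T ⟶ X)),
    (∀ i, φ i ≫ f = t) → ∃! h : T ⟶ P, h ≫ p = t ∧ ∀ i, h ≫ π i = φ i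

/-- `h : P ⟶ P` is the morphism of the fibre power over the base that permutes the coordinates
by `σ`. -/
def PermutesBy (p : P ⟶ B) (π : Fin n → (P ⟶ X)) (σ : Equiv.Perm (Fin n)) (h : P ⟶ P) : Prop :=
  h ≫ p = p ∧ ∀ i, h ≫ π i = π (σ i)

theorem le_preimage_of_comp_eq {q : P ⟶ Y} {h : P ⟶ P} (e : h ≫ q = q) (U : Y.Opens) :
    q ⁻¹ᵁ U ≤ h ⁻¹ᵁ (q ⁻¹ᵁ U) := by
  rw [← Scheme.Hom.comp_preimage, e]

/-- `q : P ⟶ Y` is the quotient of the fibre power `P` by the symmetric group permuting the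
coordinates: `q` is affine and invariant, and `𝒪_Y` is the sheaf of invariants `(q_* 𝒪_P)^{S_n}`. -/
structure IsSymmetricQuotient (p : P ⟶ B) (π : Fin n → (P ⟶ X)) (q : P ⟶ Y) : Prop where
  isAffineHom : IsAffineHom q
  invariant : ∀ (σ : Equiv.Perm (Fin n)) (h : P ⟶ P), PermutesBy p π σ h → h ≫ q = q
  injective_app : ∀ U : Y.Opens, Function.Injective (q.app U).hom
  exists_of_invariant : ∀ (U : Y.Opens) (a : Γ(P, q ⁻¹ᵁ U)),
    (∀ (σ : Equiv.Perm (Fin n)) (h : P ⟶ P) (H : PermutesBy p π σ h),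
      (h.appLE (q ⁻¹ᵁ U) (q ⁻¹ᵁ U) (le_preimage_of_comp_eq (invariant σ h H) U)).hom a = a) →
    ∃ b : Γ(Y, U), (q.app U).hom b = a

/-- `g : Y ⟶ B` is the `n`-th symmetric power `X^{(n)} = X^n / S_n` of `f : X ⟶ B`, where
`P = X^n` has the projections `π i` and `q : X^n ⟶ X^{(n)}` is the quotient morphism. -/
structure IsSymmetricPower (f : X ⟶ B) (p : P ⟶ B) (π : Fin n → (P ⟶ X))
    (q : P ⟶ Y) (g : Y ⟶ B) : Prop where
  isFibrePower : IsFibrePower f p π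
  isSymmetricQuotient : IsSymmetricQuotient p π q
  w : q ≫ g = p

/-- The locus `S^{(n)}` in `X^{(n)}`: the complement of `U^{(n)}`, the image of `U^n`, where
`U = X ∖ S`. -/
def symmetricLocus (π : Fin n → (P ⟶ X)) (q : P ⟶ Y) (S : Set X) : Set Y :=
  (q '' ⋂ i, π i ⁻¹' Sᶜ)ᶜ

/-- `x` is a rational point of `f : X ⟶ B`, where `B` is the spectrum of a field: it is the image
of a section. -/
def IsRationalPoint (f : X ⟶ B) (x : X) : Prop :=
  ∃ s : B ⟶ X, s ≫ f = 𝟙 B ∧ Set.range s = {x}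

end FibrePower

/-- The family `f` is part of a regular system of parameters of the local ring `R`: it can be
completed to a family of `dim R` generators of the maximal ideal. -/
def IsPartOfRegularSystem {R : Type*} [CommRing R] [IsLocalRing R] {r : ℕ} (f : Fin r → R) :
    Prop :=
  ∃ (m : ℕ) (f' : Fin m → R),
    Ideal.span (Set.range f ∪ Set.range f') = IsLocalRing.maximalIdeal R ∧
      ((r + m : ℕ) : WithBot ℕ∞) = ringKrullDim R

/-- The closed subset `Z` (with its reduced structure) is a normal crossings divisor of the regular
locally Noetherian scheme `Y`: at every `y`, it is the divisor of a product `f₁ ⋯ f_r` of members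
of a regular system of parameters of `𝒪_{Y,y}` (with `r = 0` if `y ∉ Z`). Such a product generates
a radical ideal, so that the reduced structure is the one given by `f₁ ⋯ f_r`. No étale
localization is allowed: this is the strict form of the notion. -/
structure IsNormalCrossingsDivisor (Y : Scheme.{u}) (Z : Set Y) : Prop where
  isLocallyNoetherian : IsLocallyNoetherian Y
  isRegular : ∀ y : Y, IsRegularLocalRing (Y.presheaf.stalk y)
  isClosed : IsClosed Z
  exists_equation : ∀ y : Y, ∃ (r : ℕ) (f : Fin r → Y.presheaf.stalk y),
    IsPartOfRegularSystem f ∧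
      Y.fromSpecStalk y ⁻¹' Z = PrimeSpectrum.zeroLocus {∏ i, f i}

section AffineSpace

variable (k : Type u) [Field k] (n : ℕ)

/-- Affine space `𝔸ⁿ` over `k`. -/
noncomputable abbrev affineSpace : Scheme.{u} := Spec (.of (MvPolynomial (Fin n) k))

/-- The structure morphism of `𝔸ⁿ`. -/
noncomputable def affineSpaceHom : affineSpace k n ⟶ Spec (.of k) :=
  Spec.map (CommRingCat.ofHom (algebraMap k (MvPolynomial (Fin n) k)))

/-- The affine line. -/
noncomputable abbrev affineLine : Scheme.{u} := Spec (.of (Polynomial k))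

/-- The structure morphism of the affine line. -/
noncomputable def affineLineHom : affineLine k ⟶ Spec (.of k) :=
  Spec.map (CommRingCat.ofHom (algebraMap k (Polynomial k)))

/-- The point `t = s` of the affine line. -/
noncomputable def linePoint (s : k) : affineLine k :=
  Spec.map (CommRingCat.ofHom (Polynomial.evalRingHom s)) (⊥ : PrimeSpectrum k)

/-- The projection `𝔸ⁿ ⟶ 𝔸¹` to the `i`-th coordinate. -/
noncomputable def coordinate (i : Fin n) : affineSpace k n ⟶ affineLine k :=
  Spec.map (CommRingCat.ofHom (Polynomial.aeval (R := k) (MvPolynomial.X (R := k) i)).toRingHom)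

/-- The morphism `𝔸ⁿ ⟶ 𝔸ⁿ` given by the elementary symmetric polynomials `(σ₁, …, σ_n)`; the
variable with index `i : Fin n` of the target is `σ_{i+1}`. -/
noncomputable def elementarySymmetric : affineSpace k n ⟶ affineSpace k n :=
  Spec.map (CommRingCat.ofHom
    (MvPolynomial.aeval (R := k) fun i : Fin n ↦ MvPolynomial.esymm (Fin n) k (i + 1)).toRingHom)

/-- The affine hyperplane `(-s)ⁿ + (-s)ⁿ⁻¹ σ₁ + ⋯ + (-s) σ_{n-1} + σ_n = 0` in `𝔸ⁿ` (empty for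
`n = 0`). -/
noncomputable def symmetricHyperplane (s : k) : Set (affineSpace k n) :=
  PrimeSpectrum.zeroLocus {MvPolynomial.C ((-s) ^ n) +
    ∑ i : Fin n, MvPolynomial.C ((-s) ^ (n - 1 - (i : ℕ))) * MvPolynomial.X i}

/-- The coordinate hyperplane `T_j = 0` in `𝔸ⁿ`. -/
noncomputable def coordinateHyperplane (j : Fin n) : Set (affineSpace k n) :=
  PrimeSpectrum.zeroLocus {(MvPolynomial.X j : MvPolynomial (Fin n) k)}

end AffineSpace

end SymCurve

/-! The normal crossings statement follows from the étale charts: étale over affine space, local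
rings are regular, and the coordinates vanishing at a point are part of a regular system of
parameters (`isRegular_of_etale_mvPolynomial`). So near every point of the symmetric power one needs
`n` functions that are étale coordinates and include equations of the loci "the divisor contains
`s`" for those `s` in `S` that occur in the divisor.

The problem is first made affine. Every point of `X^n` specializes to an algebraic one, so it
suffices to treat an `n`-tuple of algebraic points of `X`. These lie in one affine open subset `U =
Spec A` (`exists_isAffineOpen_forall_mem`): a function transcendental on every component involved is
quasi-finite at the points, and Zariski's main theorem applies. After shrinking `U`, the points of
`S` in it are members of the tuple and have principal ideals `(e_j)`. The image of `U^n` is then the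
spectrum of the ring `R` of symmetric tensors in `C`, the `n`-fold tensor power of `A`, and the
locus of divisors through the `j`-th point is cut out by the norm `e_j ⊗ ⋯ ⊗ e_j`.

The heart is the cotangent space of `R` at a geometric point `ψ = (x_1, …, x_n)`. Choose `t` in `A`
separating the distinct `x_i` and a local coordinate at each. Let a derivation `D` of `R` at `ψ`
kill the coefficients of `∏ (T - t_i)`. By Cayley–Hamilton to first order, adding to `a` a multiple
of `∏ (t - t(x_i))` does not change `D` of its norm; up to a factor that is invertible at the
points, every `a` is congruent to a polynomial in `t`, whose norm `D` kills. Norms span the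
symmetric tensors over an infinite field, so `D = 0` (`eq_zero_of_charpoly`). By interpolation the
coefficients may be replaced by the norms of `c - t` for `n` distinct constants `c`, and for `c =
t(x)` with `x` the zero of `e_j` that norm is a multiple of the norm of `e_j`. Hence the norms of
the `e_j` together with `n - r` other functions detect all derivations (`exists_detecting`); a
dimension count brings the other functions down from the algebraic closure to `R`.

So `R` is unramified over affine `n`-space at the point. Its local dimension is at least `n`,
because `C` is integral over `R` and smooth of dimension `n`. Locally an unramified algebra is a
quotient of an étale one, here a regular local domain of dimension at most `n`, so nothing is
divided out and the map is étale.

For the affine line everything is the fundamental theorem of symmetric polynomials together with the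
expansion of `∏ (X_i - s)`. -/

namespace SymCurve

set_option linter.unusedSectionVars false

/-! ### Symmetric tensors: norms, Cayley–Hamilton and point derivations. -/

section SymmetricTensors

open Polynomial

variable {K C R : Type*} {A : Type u} [Field K] [CommRing A] [CommRing C] [CommRing R]
  [Algebra K A] [Algebra K C] [Algebra R C] {n : ℕ}
  [MulSemiringAction (Equiv.Perm (Fin n)) C]

/-- The `K`-algebra `C`, with the homomorphisms `ι i : A → C` and the action of the symmetric group,
is the `n`-fold tensor power of `A`, and `R ⊆ C` is the subring of symmetric tensors. -/
structure IsSymmetricTensorPower (R : Type*) [CommRing R] [Algebra R C]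
    (ι : Fin n → (A →ₐ[K] C)) : Prop where
  smul_apply : ∀ (σ : Equiv.Perm (Fin n)) (i : Fin n) (a : A), σ • ι i a = ι (σ i) a
  smul_algebraMap : ∀ (σ : Equiv.Perm (Fin n)) (r : R), σ • algebraMap R C r = algebraMap R C r
  injective : Function.Injective (algebraMap R C)
  exists_of_invariant : ∀ c : C, (∀ σ : Equiv.Perm (Fin n), σ • c = c) → ∃ r, algebraMap R C r = c
  exists_basis : ∃ (B : Type u) (b : Module.Basis B K A) (bC : Module.Basis (Fin n → B) K C),
    ∀ w, bC w = ∏ i, ι i (b (w i))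

namespace IsSymmetricTensorPower

variable {ι : Fin n → (A →ₐ[K] C)}

/-- A tuple of elements of `C` permuted by the symmetric group in the same way as the
coordinates. -/
def Equivariant (z : Fin n → C) : Prop :=
  ∀ (σ : Equiv.Perm (Fin n)) (i : Fin n), σ • z i = z (σ i)

theorem equivariant (h : IsSymmetricTensorPower R ι) (a : A) : Equivariant fun i ↦ ι i a :=
  fun σ i ↦ h.smul_apply σ i a

theorem Equivariant.smul_prod {z : Fin n → C} (hz : Equivariant z) (σ : Equiv.Perm (Fin n)) :
    σ • ∏ i, z i = ∏ i, z i := by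
  rw [Finset.smul_prod']
  simp only [hz σ]
  exact Equiv.prod_comp σ z

theorem Equivariant.mul {z w : Fin n → C} (hz : Equivariant z) (hw : Equivariant w) :
    Equivariant fun i ↦ z i * w i := fun σ i ↦ by rw [smul_mul', hz, hw]

theorem Equivariant.add {z w : Fin n → C} (hz : Equivariant z) (hw : Equivariant w) :
    Equivariant fun i ↦ z i + w i := fun σ i ↦ by rw [smul_add, hz, hw]

theorem Equivariant.pow {z : Fin n → C} (hz : Equivariant z) (m : ℕ) :
    Equivariant fun i ↦ z i ^ m := fun σ i ↦ by rw [smul_pow', hz]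

theorem equivariant_const (h : IsSymmetricTensorPower R ι) (r : R) :
    Equivariant (n := n) fun _ ↦ algebraMap R C r := fun σ _ ↦ h.smul_algebraMap σ r

theorem exists_algebraMap_eq_prod (h : IsSymmetricTensorPower R ι) {z : Fin n → C}
    (hz : Equivariant z) : ∃ r, algebraMap R C r = ∏ i, z i :=
  h.exists_of_invariant _ hz.smul_prod

/-- The symmetric tensor `a ⊗ ⋯ ⊗ a`. -/
noncomputable def norm (h : IsSymmetricTensorPower R ι) (a : A) : R :=
  (h.exists_algebraMap_eq_prod (h.equivariant a)).choose

theorem algebraMap_norm (h : IsSymmetricTensorPower R ι) (a : A) :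
    algebraMap R C (h.norm a) = ∏ i, ι i a :=
  (h.exists_algebraMap_eq_prod (h.equivariant a)).choose_spec

theorem norm_mul (h : IsSymmetricTensorPower R ι) (a b : A) :
    h.norm (a * b) = h.norm a * h.norm b := by
  apply h.injective
  simp [algebraMap_norm, Finset.prod_mul_distrib]

theorem exists_map_eq_prod (h : IsSymmetricTensorPower R ι) {z a : Fin n → C}
    (hz : Equivariant z) (ha : Equivariant a) :
    ∃ Q : R[X], Q.map (algebraMap R C) = ∏ i, (Polynomial.C (z i) + X * Polynomial.C (a i)) := by
  rw [← Polynomial.mem_lifts, Polynomial.lifts_iff_coeff_lifts]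
  intro m
  obtain ⟨r, hr⟩ := h.exists_of_invariant
    ((∏ i, (Polynomial.C (z i) + X * Polynomial.C (a i))).coeff m) fun σ ↦ by
      have : (∏ i, (Polynomial.C (z i) + X * Polynomial.C (a i))).map
          (MulSemiringAction.toRingHom _ C σ) =
          ∏ i, (Polynomial.C (z i) + X * Polynomial.C (a i)) := by
        rw [Polynomial.map_prod]
        simp only [Polynomial.map_add, Polynomial.map_mul, Polynomial.map_C, Polynomial.map_X,
          MulSemiringAction.toRingHom_apply, hz σ, ha σ]
        exact Equiv.prod_comp σ fun i ↦ Polynomial.C (z i) + X * Polynomial.C (a i)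
      conv_rhs => rw [← this]
      rw [Polynomial.coeff_map, MulSemiringAction.toRingHom_apply]
  exact ⟨r, hr⟩

/-- The coefficients of `∏ (z_i + X a_i)` are invariant, so there is a polynomial `Q` over `R` with
values `x` at `ρ` and `y` at `0`; and `ρ` divides `Q(ρ) - Q(0)`. The point is that divisibility
holds in `R`, not only in `C`. -/
theorem sub_mem_of_prod_add (h : IsSymmetricTensorPower R ι) {z a : Fin n → C}
    (hz : Equivariant z) (ha : Equivariant a) (I : Ideal R) {ρ x y : R} (hρ : ρ ∈ I)
    (hx : algebraMap R C x = ∏ i, (z i + algebraMap R C ρ * a i))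
    (hy : algebraMap R C y = ∏ i, z i) : x - y ∈ I := by
  obtain ⟨Q, hQ⟩ := h.exists_map_eq_prod hz ha
  have e1 : x = Q.eval ρ := h.injective (by
    rw [hx, ← Polynomial.eval₂_at_apply, ← Polynomial.eval_map, hQ, Polynomial.eval_prod]
    exact Finset.prod_congr rfl fun i _ ↦ by
      simp only [Polynomial.eval_add, Polynomial.eval_mul, Polynomial.eval_X, Polynomial.eval_C])
  have e0 : y = Q.eval 0 := h.injective (by
    rw [hy, ← Polynomial.eval₂_at_apply, ← Polynomial.eval_map, hQ, Polynomial.eval_prod]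
    simp)
  rw [e1, e0]
  exact I.mem_of_dvd (by simpa using Polynomial.sub_dvd_eval_sub ρ 0 Q) hρ

theorem sub_mem_of_prod_add_sum (h : IsSymmetricTensorPower R ι) {α : Type*} (s : Finset α)
    {z : Fin n → C} (a : α → Fin n → C) (ρ : α → R)
    (hz : Equivariant z) (ha : ∀ l ∈ s, Equivariant (a l)) (I : Ideal R) (hρ : ∀ l ∈ s, ρ l ∈ I)
    {x y : R} (hx : algebraMap R C x = ∏ i, (z i + ∑ l ∈ s, algebraMap R C (ρ l) * a l i))
    (hy : algebraMap R C y = ∏ i, z i) : x - y ∈ I := by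
  classical
  induction s using Finset.induction_on generalizing z y with
  | empty =>
    have : x = y := h.injective (by rw [hx, hy]; simp)
    simp [this]
  | insert l s hl ih =>
    have hz' : Equivariant fun i ↦ z i + algebraMap R C (ρ l) * a l i :=
      hz.add ((h.equivariant_const (ρ l)).mul (ha l (Finset.mem_insert_self _ _)))
    obtain ⟨w, hw⟩ := h.exists_algebraMap_eq_prod hz'
    have h1 : x - w ∈ I := ih hz' (fun m hm ↦ ha m (Finset.mem_insert_of_mem hm))
      (fun m hm ↦ hρ m (Finset.mem_insert_of_mem hm)) (by
        rw [hx]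
        refine Finset.prod_congr rfl fun i _ ↦ ?_
        rw [Finset.sum_insert hl, add_assoc]) hw
    have h2 : w - y ∈ I := h.sub_mem_of_prod_add hz (ha l (Finset.mem_insert_self _ _)) I
      (hρ l (Finset.mem_insert_self _ _)) hw hy
    simpa using I.add_mem h1 h2

theorem exists_charpoly [Nontrivial C] (h : IsSymmetricTensorPower R ι) (t : A) :
    ∃ Q : R[X], Q.map (algebraMap R C) = ∏ i, (X - Polynomial.C (ι i t)) ∧ Q.natDegree = n ∧
      Q.Monic := by
  have hl : ∏ i, (X - Polynomial.C (ι i t)) ∈ Polynomial.lifts (algebraMap R C) := by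
    rw [Polynomial.mem_lifts]
    obtain ⟨Q, hQ⟩ := h.exists_map_eq_prod (h.equivariant (-t)) (h.equivariant 1)
    refine ⟨Q, hQ.trans (Finset.prod_congr rfl fun i _ ↦ ?_)⟩
    simp; ring
  have hm : (∏ i, (X - Polynomial.C (ι i t))).Monic :=
    Polynomial.monic_prod_of_monic _ _ fun i _ ↦ Polynomial.monic_X_sub_C _
  obtain ⟨Q, h1, h2, h3⟩ := Polynomial.lifts_and_natDegree_eq_and_monic hl hm
  refine ⟨Q, h1, ?_, h3⟩
  rw [h2]
  rw [Polynomial.natDegree_prod_of_monic _ _ fun i _ ↦ Polynomial.monic_X_sub_C _]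
  simp


variable [Algebra K R] [IsScalarTower K R C]

/-- The group permutes the monomial basis of the tensor power. Consequently the coordinates of a
symmetric tensor are constant on orbits of index words. -/
theorem repr_comp_perm (h : IsSymmetricTensorPower R ι) {B : Type*} (b : Module.Basis B K A)
    (bC : Module.Basis (Fin n → B) K C) (hb : ∀ w, bC w = ∏ i, ι i (b (w i)))
    (σ : Equiv.Perm (Fin n)) (x : C) (w : Fin n → B) :
    bC.repr x (w ∘ σ) = bC.repr (σ • x) w := by
  classical
  have hσ (c : K) (y : C) : σ • c • y = c • σ • y := by
    rw [Algebra.smul_def, Algebra.smul_def, smul_mul', IsScalarTower.algebraMap_apply K R C,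
      h.smul_algebraMap]
  let S : C →ₗ[K] C := { toFun := fun y ↦ σ • y, map_add' := smul_add σ, map_smul' := hσ }
  have key : (bC.coord (w ∘ σ)) = (bC.coord w).comp S := by
    refine bC.ext fun v ↦ ?_
    have : S (bC v) = bC (v ∘ σ.symm) := by
      change σ • bC v = _
      rw [hb, hb, Finset.smul_prod']
      simp only [h.smul_apply]
      rw [← Equiv.prod_comp σ fun i ↦ ι i (b ((v ∘ σ.symm) i))]
      simp
    rw [LinearMap.comp_apply, this]
    simp only [Module.Basis.coord_apply, Module.Basis.repr_self]
    rw [Finsupp.single_apply, Finsupp.single_apply]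
    congr 1
    rw [eq_iff_iff]
    constructor
    · rintro rfl; ext i; simp
    · rintro rfl; ext i; simp
  exact LinearMap.congr_fun key x

theorem exists_perm_of_sum_single_eq {B : Type*} {v w : Fin n → B}
    (e : ∑ i, Finsupp.single (v i) 1 = ∑ i, Finsupp.single (w i) (1 : ℕ)) :
    ∃ σ : Equiv.Perm (Fin n), w ∘ σ = v := by
  classical
  have hc (u : Fin n → B) (c : B) :
      (∑ i, Finsupp.single (u i) (1 : ℕ)) c = Fintype.card {i // u i = c} := by
    rw [Finsupp.finsetSum_apply, Fintype.card_subtype, Finset.card_eq_sum_ones, Finset.sum_filter]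
    simp [Finsupp.single_apply]
  let E (c : B) : {i // v i = c} ≃ {i // w i = c} :=
    Fintype.equivOfCardEq (by rw [← hc, ← hc, e])
  exact ⟨Equiv.ofFiberEquiv E, funext fun i ↦ Equiv.ofFiberEquiv_map E i⟩

/-- Over an infinite field the symmetric tensors are spanned by the tensors `a ⊗ ⋯ ⊗ a`. -/
theorem eq_zero_of_norm [Infinite K] (h : IsSymmetricTensorPower R ι) (l : R →ₗ[K] K)
    (hl : ∀ a, l (h.norm a) = 0) : l = 0 := by
  classical
  obtain ⟨g, hg⟩ := LinearMap.exists_leftInverse_of_injective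
    (IsScalarTower.toAlgHom K R C).toLinearMap (LinearMap.ker_eq_bot.mpr h.injective)
  obtain ⟨B, b, bC, hb⟩ := h.exists_basis
  have hg' (r : R) : g (algebraMap R C r) = r := LinearMap.congr_fun hg r
  let L : C →ₗ[K] K := l.comp g
  let ty (w : Fin n → B) : B →₀ ℕ := ∑ i, Finsupp.single (w i) 1
  ext r
  set x := algebraMap R C r with hx
  have hsym (σ : Equiv.Perm (Fin n)) (w) : bC.repr x (w ∘ σ) = bC.repr x w := by
    rw [h.repr_comp_perm b bC hb, hx, h.smul_algebraMap]
  let B₀ : Finset B := (bC.repr x).support.biUnion fun w ↦ Finset.univ.image w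
  let F : Finset (Fin n → B) := Fintype.piFinset fun _ ↦ B₀
  have hF : (bC.repr x).support ⊆ F := fun w hw ↦ by
    rw [Fintype.mem_piFinset]
    exact fun i ↦ Finset.mem_biUnion.mpr ⟨w, hw, Finset.mem_image_of_mem _ (Finset.mem_univ i)⟩
  -- The value of `p` at `c` is `l` of the norm of the generic combination `∑ c_β b_β`, extended to
  -- `C` by the retraction `g`. It vanishes for all `c`, so `p = 0` over an infinite field, and its
  -- coefficient at a monomial is the sum of `L` over one orbit of basis tensors.
  let p : MvPolynomial B K := ∑ w ∈ F, MvPolynomial.monomial (ty w) (L (bC w))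
  have hp : p = 0 := by
    refine MvPolynomial.funext fun c ↦ ?_
    have : L (∏ i, ι i (∑ β ∈ B₀, c β • b β)) = 0 := by
      rw [← h.algebraMap_norm]
      change l (g _) = 0
      rw [hg', hl]
    rw [map_zero, ← this]
    simp only [map_sum, map_smul]
    rw [Finset.prod_univ_sum, map_sum, map_sum]
    refine Finset.sum_congr rfl fun w _ ↦ ?_
    have : ∏ i, c (w i) • (ι i) (b (w i)) = (∏ i, c (w i)) • bC w := by
      rw [hb, Finset.prod_smul]
    rw [this, map_smul, smul_eq_mul, MvPolynomial.eval_monomial, mul_comm]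
    congr 1
    change ((∑ i, Finsupp.single (w i) 1 : B →₀ ℕ)).prod _ = _
    rw [← Finsupp.prod_finsetSum_index (by simp) (by intros; rw [pow_add])]
    refine Finset.prod_congr rfl fun i _ ↦ ?_
    simp
  have hcoeff (m : B →₀ ℕ) : ∑ w ∈ F with ty w = m, L (bC w) = 0 := by
    have := congrArg (MvPolynomial.coeff m) hp
    rw [MvPolynomial.coeff_sum, MvPolynomial.coeff_zero] at this
    rw [Finset.sum_filter]
    refine Eq.trans ?_ this
    exact Finset.sum_congr rfl fun w _ ↦ (MvPolynomial.coeff_monomial _ _ _).symm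
  have hxsum : x = ∑ w ∈ F, bC.repr x w • bC w := by
    conv_lhs => rw [← bC.linearCombination_repr x, Finsupp.linearCombination_apply]
    exact Finsupp.sum_of_support_subset _ hF _ (by simp)
  have : l r = L x := by change _ = l (g _); rw [hx, hg']
  rw [this, LinearMap.zero_apply, hxsum, map_sum,
    ← Finset.sum_fiberwise_of_maps_to (fun w hw ↦ Finset.mem_image_of_mem ty hw)]
  refine Finset.sum_eq_zero fun m hm ↦ ?_
  obtain ⟨w₀, -, rfl⟩ := Finset.mem_image.mp hm
  -- Words of the same type form one orbit, on which the coordinates of `x` are constant, so each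
  -- orbit contributes a multiple of a vanishing orbit sum. No division by the order of a group
  -- occurs, so the characteristic is irrelevant.
  have : ∀ w ∈ F.filter (fun w ↦ ty w = ty w₀),
      L (bC.repr x w • bC w) = bC.repr x w₀ * L (bC w) := by
    intro w hw
    obtain ⟨σ, rfl⟩ := exists_perm_of_sum_single_eq (Finset.mem_filter.mp hw).2
    rw [hsym, map_smul, smul_eq_mul]
  rw [Finset.sum_congr rfl this, ← Finset.mul_sum, hcoeff, mul_zero]


section Derivation

variable (ψ : C →ₐ[K] K) (D : R →ₗ[K] K)

/-- `D` is a derivation of `R` at the point `ψ`. -/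
def IsPointDerivation : Prop :=
  ∀ x y, D (x * y) = ψ (algebraMap R C x) * D y + ψ (algebraMap R C y) * D x

variable {ψ D}

theorem IsPointDerivation.map_algebraMap (hD : IsPointDerivation ψ D) (c : K) :
    D (algebraMap K R c) = 0 := by
  have h1 : D 1 = 0 := by simpa using hD 1 1
  rw [Algebra.algebraMap_eq_smul_one, map_smul, h1, smul_zero]

/-- The ideal of elements vanishing to second order along a derivation. -/
def IsPointDerivation.ideal (hD : IsPointDerivation ψ D) : Ideal R where
  carrier := {r | ψ (algebraMap R C r) = 0 ∧ D r = 0}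
  zero_mem' := by simp
  add_mem' := fun {a b} ha hb ↦ ⟨by rw [map_add, map_add, ha.1, hb.1, add_zero],
    by rw [map_add, ha.2, hb.2, add_zero]⟩
  smul_mem' := fun c r hr ↦ ⟨by rw [smul_eq_mul, map_mul, map_mul, hr.1, mul_zero],
    by rw [smul_eq_mul, hD, hr.1, hr.2]; simp⟩

theorem psi_norm (h : IsSymmetricTensorPower R ι) (a : A) :
    ψ (algebraMap R C (h.norm a)) = ∏ i, ψ (ι i a) := by
  rw [h.algebraMap_norm, map_prod]

theorem map_charpoly {Q : R[X]} {t : A}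
    (hQ : Q.map (algebraMap R C) = ∏ i, (X - Polynomial.C (ι i t))) (l : ℕ) :
    ψ (algebraMap R C (Q.coeff l)) = (∏ i, (X - Polynomial.C (ψ (ι i t)))).coeff l := by
  have : (Q.map (algebraMap R C)).map (ψ : C →+* K) = ∏ i, (X - Polynomial.C (ψ (ι i t))) := by
    rw [hQ, Polynomial.map_prod]; simp
  rw [← this, Polynomial.coeff_map, Polynomial.coeff_map]; rfl

/-- The Cayley–Hamilton theorem for the multiplicative law `norm`, to first order along a
derivation that kills the characteristic polynomial of `t`. -/
theorem norm_add_mem_ideal (h : IsSymmetricTensorPower R ι) (hD : IsPointDerivation ψ D) {t : A}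
    {Q : R[X]} (hQ : Q.map (algebraMap R C) = ∏ i, (X - Polynomial.C (ι i t)))
    (hn : Q.natDegree = n) (hDQ : ∀ l, D (Q.coeff l) = 0) (x c : A) :
    h.norm (x + aeval t (∏ i, (X - Polynomial.C (ψ (ι i t)))) * c) - h.norm x ∈ hD.ideal := by
  set P : K[X] := ∏ i, (X - Polynomial.C (ψ (ι i t))) with hP
  have hPn : P.natDegree = n := by
    rw [hP, Polynomial.natDegree_prod_of_monic _ _ fun i _ ↦ Polynomial.monic_X_sub_C _]
    simp
  -- Since `Q` annihilates `ι i t`, the element `P(ι i t)` equals `∑ (P_l - Q_l) (ι i t)^l`. The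
  -- differences `P_l - Q_l` vanish at `ψ` and are killed by `D`, so they lie in the ideal.
  refine h.sub_mem_of_prod_add_sum (Finset.range (n + 1))
    (fun l i ↦ ι i t ^ l * ι i c) (fun l ↦ algebraMap K R (P.coeff l) - Q.coeff l)
    (h.equivariant x) (fun l _ ↦ ((h.equivariant t).pow l).mul (h.equivariant c)) _ ?_ ?_
    (h.algebraMap_norm x)
  · intro l _
    refine ⟨?_, ?_⟩
    · rw [map_sub, map_sub, map_charpoly hQ, ← IsScalarTower.algebraMap_apply]
      simp [hP]
    · rw [map_sub, hD.map_algebraMap, hDQ, sub_zero]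
  · rw [h.algebraMap_norm]
    refine Finset.prod_congr rfl fun i _ ↦ ?_
    have h1 : ∑ l ∈ Finset.range (n + 1), algebraMap R C (Q.coeff l) * ι i t ^ l = 0 := by
      rw [← Polynomial.eval₂_eq_sum_range' _ (by lia), ← Polynomial.eval_map, hQ,
        Polynomial.eval_prod]
      exact Finset.prod_eq_zero (Finset.mem_univ i) (by simp)
    have h2 : ι i (aeval t P) =
        ∑ l ∈ Finset.range (n + 1), algebraMap K C (P.coeff l) * ι i t ^ l := by
      rw [← Polynomial.aeval_algHom_apply, Polynomial.aeval_def,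
        Polynomial.eval₂_eq_sum_range' (n := n + 1) _ (by lia)]
    rw [map_add, map_mul, h2]
    simp only [map_sub, ← IsScalarTower.algebraMap_apply, sub_mul, ← mul_assoc,
      Finset.sum_sub_distrib, ← Finset.sum_mul, h1, zero_mul, sub_zero]

theorem norm_algebraMap_sub (h : IsSymmetricTensorPower R ι) {t : A}
    {Q : R[X]} (hQ : Q.map (algebraMap R C) = ∏ i, (X - Polynomial.C (ι i t))) (c : K) :
    h.norm (algebraMap K A c - t) = Q.eval (algebraMap K R c) := by
  apply h.injective
  rw [h.algebraMap_norm, ← Polynomial.eval₂_at_apply, ← Polynomial.eval_map, hQ,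
    Polynomial.eval_prod, ← IsScalarTower.algebraMap_apply]
  simp

theorem map_eval_algebraMap (Q : R[X]) (c : K) :
    D (Q.eval (algebraMap K R c)) = ∑ l ∈ Finset.range (Q.natDegree + 1), c ^ l * D (Q.coeff l) := by
  rw [Polynomial.eval_eq_sum_range, map_sum]
  refine Finset.sum_congr rfl fun l _ ↦ ?_
  rw [← map_pow, mul_comm, ← Algebra.smul_def, map_smul, smul_eq_mul]

/-- By Leibniz, the elements whose norm is killed by `D` are closed under products. Split `b` into
linear factors; the norm of `c - t` is `Q(c)`, a combination of the coefficients of `Q` with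
constant coefficients. -/
theorem norm_aeval_eq_zero [IsAlgClosed K] (h : IsSymmetricTensorPower R ι)
    (hD : IsPointDerivation ψ D) {t : A}
    {Q : R[X]} (hQ : Q.map (algebraMap R C) = ∏ i, (X - Polynomial.C (ι i t)))
    (hDQ : ∀ l, D (Q.coeff l) = 0) (b : K[X]) : D (h.norm (aeval t b)) = 0 := by
  have hmul {x y : A} (hx : D (h.norm x) = 0) (hy : D (h.norm y) = 0) :
      D (h.norm (x * y)) = 0 := by rw [h.norm_mul, hD, hx, hy]; simp
  have hconst (c : K) : D (h.norm (algebraMap K A c)) = 0 := by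
    have : h.norm (algebraMap K A c) = algebraMap K R (c ^ n) := by
      apply h.injective
      rw [h.algebraMap_norm, ← IsScalarTower.algebraMap_apply]
      simp
    rw [this, hD.map_algebraMap]
  have hlin (c : K) : D (h.norm (aeval t (X - Polynomial.C c))) = 0 := by
    have : aeval t (X - Polynomial.C c) = algebraMap K A (-1) * (algebraMap K A c - t) := by
      simp
    rw [this]
    refine hmul (hconst _) ?_
    rw [h.norm_algebraMap_sub hQ, map_eval_algebraMap]
    simp [hDQ]
  have hprod (s : Multiset K) :
      D (h.norm (aeval t (s.map fun c ↦ X - Polynomial.C c).prod)) = 0 := by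
    induction s using Multiset.induction_on with
    | empty => simpa using hconst 1
    | cons c s ih =>
      rw [Multiset.map_cons, Multiset.prod_cons, map_mul]
      exact hmul (hlin c) ih
  rw [(IsAlgClosed.splits b).eq_prod_roots, map_mul, Polynomial.aeval_C]
  exact hmul (hconst _) (hprod _)

/-- A derivation at a point is determined by its values on the characteristic polynomial of an
element `t` that is locally a coordinate. -/
theorem eq_zero_of_charpoly [IsAlgClosed K] (h : IsSymmetricTensorPower R ι)
    (hD : IsPointDerivation ψ D) {t : A}
    (ht : ∀ i a, ψ (ι i a) = 0 →
      ∃ g c, (∀ j, ψ (ι j g) ≠ 0) ∧ g * a = (t - algebraMap K A (ψ (ι i t))) * c)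
    {Q : R[X]} (hQ : Q.map (algebraMap R C) = ∏ i, (X - Polynomial.C (ι i t)))
    (hn : Q.natDegree = n) (hDQ : ∀ l, D (Q.coeff l) = 0) : D = 0 := by
  classical
  have := IsAlgClosed.instInfinite (K := K)
  refine h.eq_zero_of_norm _ fun a ↦ ?_
  -- Newton interpolation of `a` by polynomials in `t`, one point at a time. The factor `g` is a
  -- unit at all points; `γ` is chosen so that `c - γ g` vanishes at the next point, where `t -
  -- t(x_i)` can then be split off. Repeated points require no separate treatment.
  have key (s : Finset (Fin n)) : ∃ (b : K[X]) (g c : A), (∀ j, ψ (ι j g) ≠ 0) ∧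
      g * (a - aeval t b) = aeval t (∏ i ∈ s, (X - Polynomial.C (ψ (ι i t)))) * c := by
    induction s using Finset.induction_on with
    | empty => exact ⟨0, 1, a, by simp, by simp⟩
    | insert i s his ih =>
      obtain ⟨b, g, c, hg, e⟩ := ih
      set γ : K := ψ (ι i c) / ψ (ι i g) with hγ
      obtain ⟨g', c', hg', e'⟩ := ht i (c - algebraMap K A γ * g) (by
        simp [hγ, hg i])
      refine ⟨b + Polynomial.C γ * ∏ i ∈ s, (X - Polynomial.C (ψ (ι i t))), g' * g, c',
        fun j ↦ by simp [hg, hg'], ?_⟩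
      rw [Finset.prod_insert his]
      simp only [map_add, map_mul, map_sub, Polynomial.aeval_C, Polynomial.aeval_X]
      linear_combination g' * e +
        aeval t (∏ i ∈ s, (X - Polynomial.C (ψ (ι i t)))) * e'
  obtain ⟨b, g, c, hg, e⟩ := key Finset.univ
  -- To first order the norms of `g a` and `g b(t)` agree. Comparing values gives equal values of
  -- the norms of `a` and `b(t)` at `ψ`; comparing derivatives, the terms with `D (norm g)` cancel.
  have hmem := h.norm_add_mem_ideal hD hQ hn hDQ (g * aeval t b) c
  rw [← e, mul_sub, add_sub_cancel, h.norm_mul, h.norm_mul] at hmem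
  obtain ⟨h1, h2⟩ := hmem
  have hb := h.norm_aeval_eq_zero hD hQ hDQ b
  have hg0 : ψ (algebraMap R C (h.norm g)) ≠ 0 := by
    rw [psi_norm]; exact Finset.prod_ne_zero_iff.mpr fun j _ ↦ hg j
  rw [map_sub, map_sub, map_mul, map_mul, map_mul, map_mul, ← mul_sub, mul_eq_zero,
    or_iff_right hg0] at h1
  rw [map_sub, hD, hD, hb] at h2
  have : ψ (algebraMap R C (h.norm g)) * D (h.norm a) = 0 := by
    linear_combination h2 - D (h.norm g) * h1
  exact (mul_eq_zero.mp this).resolve_left hg0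

/-- As a function of `c`, `D (norm (c - t))` is a polynomial with coefficients `D (Q_l)`. Since `Q`
is monic its degree is less than `n`, so `n` distinct zeros force all the coefficients to vanish. -/
theorem eq_zero_of_norm_sub [IsAlgClosed K] (h : IsSymmetricTensorPower R ι)
    (hD : IsPointDerivation ψ D) {t : A}
    (ht : ∀ i a, ψ (ι i a) = 0 →
      ∃ g c, (∀ j, ψ (ι j g) ≠ 0) ∧ g * a = (t - algebraMap K A (ψ (ι i t))) * c)
    (c : Fin n → K) (hc : Function.Injective c)
    (hDc : ∀ i, D (h.norm (algebraMap K A (c i) - t)) = 0) : D = 0 := by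
  have : Nontrivial C := ⟨0, 1, fun e ↦ zero_ne_one (α := K) (by simpa using congrArg ψ e)⟩
  obtain ⟨Q, hQ, hn, hm⟩ := h.exists_charpoly t
  refine h.eq_zero_of_charpoly hD ht hQ hn fun l ↦ ?_
  let q : K[X] := ∑ l ∈ Finset.range n, Polynomial.monomial l (D (Q.coeff l))
  have hlead : D (Q.coeff n) = 0 := by
    rw [← hn, hm.coeff_natDegree]
    simpa using hD.map_algebraMap (1 : K)
  have hq : q = 0 := by
    refine Polynomial.eq_zero_of_degree_lt_of_eval_index_eq_zero Finset.univ
      (v := c) hc.injOn ?_ fun i _ ↦ ?_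
    · rw [Finset.card_univ, Fintype.card_fin]
      refine (Polynomial.degree_sum_le _ _).trans_lt ?_
      rw [Finset.sup_lt_iff (by simp)]
      intro l hl
      exact (Polynomial.degree_monomial_le _ _).trans_lt (by simpa using hl)
    · have := hDc i
      rw [h.norm_algebraMap_sub hQ, map_eval_algebraMap, hn, Finset.sum_range_succ, hlead,
        mul_zero, add_zero] at this
      rw [Polynomial.eval_finsetSum, ← this]
      exact Finset.sum_congr rfl fun l _ ↦ by rw [Polynomial.eval_monomial, mul_comm]
  rcases lt_trichotomy l n with hl | hl | hl
  · have := congrArg (fun p ↦ Polynomial.coeff p l) hq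
    simpa [q, Polynomial.finsetSum_coeff, Polynomial.coeff_monomial, hl] using this
  · rw [hl, hlead]
  · rw [Polynomial.coeff_eq_zero_of_natDegree_lt (by lia), map_zero]

end Derivation

end IsSymmetricTensorPower

theorem exists_mem_forall_notMem {R α : Type*} [CommRing R] [Finite α] (p : α → Ideal R)
    (hp : ∀ i, (p i).IsPrime) {J : Ideal R} (h : ∀ i, ∃ g ∈ J, g ∉ p i) :
    ∃ g ∈ J, ∀ i, g ∉ p i := by
  classical
  cases nonempty_fintype α
  by_contra! H
  cases isEmpty_or_nonempty α
  · obtain ⟨i, -⟩ := H 0 J.zero_mem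
    exact isEmptyElim i
  · obtain ⟨a⟩ := ‹Nonempty α›
    have : (J : Set R) ⊆ ⋃ i ∈ ((Finset.univ : Finset α) : Set α), (p i : Set R) := fun g hg ↦ by
      obtain ⟨i, hi⟩ := H g hg
      simpa using ⟨i, hi⟩
    rw [Ideal.subset_union_prime a a fun i _ _ _ ↦ hp i] at this
    obtain ⟨i, -, hi⟩ := this
    obtain ⟨g, hg, hgi⟩ := h i
    exact hgi (hi hg)

/-- If the finitely many points `z i` are locally principal, there is a function `t` which
separates them and is a local coordinate at each of them. -/
theorem exists_separating {K A : Type*} [Field K] [Infinite K] [CommRing A] [Algebra K A] {n : ℕ}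
    (z : Fin n → (A →ₐ[K] K))
    (hz : ∀ i, ∃ τ, z i τ = 0 ∧ ∀ a, z i a = 0 → ∃ g c, z i g ≠ 0 ∧ g * a = τ * c) :
    ∃ t, (∀ i j, z i t = z j t → z i = z j) ∧ ∀ i a, z i a = 0 →
      ∃ g c, (∀ j, z j g ≠ 0) ∧ g * a = (t - algebraMap K A (z i t)) * c := by
  have hz' : ∀ ζ : Set.range z, ∃ τ, ζ.1 τ = 0 ∧
      ∀ a, ζ.1 a = 0 → ∃ g c, ζ.1 g ≠ 0 ∧ g * a = τ * c := by
    rintro ⟨-, i, rfl⟩; exact hz i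
  choose τ hτ hloc using hz'
  let e : Set.range z ↪ K :=
    (Finite.equivFin (Set.range z)).toEmbedding.trans
      (Fin.valEmbedding.trans (Infinite.natEmbedding K))
  let m (ζ : Set.range z) : Ideal A := RingHom.ker ζ.1
  have hm (ζ : Set.range z) : (m ζ).IsMaximal :=
    RingHom.ker_isMaximal_of_surjective ζ.1 fun c ↦ ⟨algebraMap K A c, by simp⟩
  have hne : Pairwise (Function.onFun IsCoprime fun ζ ↦ m ζ ^ 2) := by
    intro ζ ζ' hne
    refine IsCoprime.pow (Ideal.isCoprime_of_isMaximal fun he ↦ hne (Subtype.ext ?_))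
    ext a
    have : a - algebraMap K A (ζ.1 a) ∈ m ζ' := by
      rw [← he]; simp [m, RingHom.mem_ker]
    simpa [m, RingHom.mem_ker, sub_eq_zero, eq_comm (a := ζ.1 a)] using this
  -- Chinese remainder theorem modulo the squares of the distinct points: the distinct constants `e
  -- ζ` make `t` separate them, and the term `τ ζ` makes `t - t(ζ)` a local equation.
  obtain ⟨t, ht⟩ := Ideal.exists_forall_sub_mem_ideal hne
    fun ζ ↦ algebraMap K A (e ζ) + τ ζ
  have hval (ζ : Set.range z) : ζ.1 t = e ζ := by
    have := Ideal.pow_le_self two_ne_zero (ht ζ)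
    simpa [m, RingHom.mem_ker, hτ, sub_eq_zero] using this
  have hsep (ζ ζ' : Set.range z) (h : ζ.1 t = ζ'.1 t) : ζ = ζ' :=
    e.injective (by rw [← hval, ← hval, h])
  have hsq (ζ : Set.range z) (w : A) (hw : w ∈ m ζ ^ 2) :
      ∃ g v, ζ.1 g ≠ 0 ∧ ζ.1 v = 0 ∧ g * w = τ ζ * v := by
    rw [sq] at hw
    induction hw using Submodule.mul_induction_on' with
    | mem_mul_mem a ha b hb =>
      obtain ⟨g, c, hg, hgc⟩ := hloc ζ a ha
      refine ⟨g, c * b, hg, ?_, by rw [← mul_assoc, hgc, mul_assoc]⟩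
      rw [map_mul, (RingHom.mem_ker).mp hb, mul_zero]
    | add x _ y _ hx hy =>
      obtain ⟨g, v, hg, hv, e⟩ := hx
      obtain ⟨g', v', hg', hv', e'⟩ := hy
      refine ⟨g * g', g' * v + g * v', ?_, ?_, ?_⟩
      · rw [map_mul]; exact mul_ne_zero hg hg'
      · simp [hv, hv']
      · linear_combination g' * e + g * e'
  refine ⟨t, fun i j h ↦ congrArg Subtype.val (hsep ⟨z i, i, rfl⟩ ⟨z j, j, rfl⟩ h), fun i a ha ↦ ?_⟩
  set ζ : Set.range z := ⟨z i, i, rfl⟩ with hζ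
  set u : A := t - algebraMap K A (z i t) with hu
  let J : Ideal A := Submodule.comap (LinearMap.toSpanSingleton A A a) (Ideal.span {u})
  have hJ (g : A) : g ∈ J ↔ u ∣ g * a := by
    simp [J, Submodule.mem_comap, Ideal.mem_span_singleton]
  obtain ⟨g, hgJ, hg⟩ := exists_mem_forall_notMem (fun j ↦ RingHom.ker (z j))
    (fun j ↦ RingHom.ker_isPrime _) (J := J) fun j ↦ by
      -- Prime avoidance reduces to one point at a time. At the point itself `g' u = (g' + v) τ`
      -- with `g' + v` a unit there, so `u` may replace `τ`; at a different point `u` itself does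
      -- not vanish and serves as the multiplier.
      by_cases hij : z j = z i
      · have h1 := ht ζ
        obtain ⟨g', v, hg', hv, e'⟩ := hsq ζ _ h1
        obtain ⟨g, c, hg, hgc⟩ := hloc ζ a ha
        refine ⟨(g' + v) * g, ?_, ?_⟩
        · rw [hJ]
          refine ⟨g' * c, ?_⟩
          have : u = t - (algebraMap K A (e ζ) + τ ζ) + τ ζ := by
            rw [hu, ← hval ζ, hζ]; ring
          rw [this]
          linear_combination (g' + v) * hgc - c * e'
        · rw [RingHom.mem_ker, hij]
          change ¬ ζ.1 _ = 0
          rw [map_mul, map_add, hv, add_zero]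
          exact mul_ne_zero hg' hg
      · refine ⟨u, (hJ u).mpr (dvd_mul_right _ _), ?_⟩
        rw [RingHom.mem_ker, hu, map_sub, sub_eq_zero, AlgHom.commutes]
        intro h
        exact hij (congrArg Subtype.val (hsep ⟨z j, j, rfl⟩ ⟨z i, i, rfl⟩ h))
  obtain ⟨c, hc⟩ := (hJ g).mp hgJ
  exact ⟨g, c, hg, hc⟩

namespace IsSymmetricTensorPower

variable {ι : Fin n → (A →ₐ[K] C)} [Algebra K R] [IsScalarTower K R C]

/-- The cotangent space of the symmetric power of a curve at a point: if `f j` are equations of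
distinct points in the support of `ψ`, then `n - r` functions together with the norms of the `f j`
detect all derivations at `ψ`. -/
theorem exists_detecting [IsAlgClosed K] (h : IsSymmetricTensorPower R ι) (ψ : C →ₐ[K] K)
    (hz : ∀ i, ∃ τ, ψ (ι i τ) = 0 ∧ ∀ a, ψ (ι i a) = 0 → ∃ g c, ψ (ι i g) ≠ 0 ∧ g * a = τ * c)
    {r : ℕ} (f : Fin r → A) (s : Fin r → Fin n)
    (hs : Function.Injective fun j ↦ ψ.comp (ι (s j)))
    (hf : ∀ j a, ψ (ι (s j) a) = 0 ↔ f j ∣ a) :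
    ∃ G : Fin (n - r) → R, ∀ D : R →ₗ[K] K, IsPointDerivation ψ D →
      (∀ j, D (h.norm (f j)) = 0) → (∀ l, D (G l) = 0) → D = 0 := by
  classical
  have := IsAlgClosed.instInfinite (K := K)
  obtain ⟨t, ht, hloc⟩ := exists_separating (fun i ↦ ψ.comp (ι i)) hz
  have hr : r ≤ n := by
    simpa using Fintype.card_le_of_injective s fun a b e ↦ hs (by simp [e])
  have hinj : Function.Injective fun j ↦ ψ (ι (s j) t) := fun a b e ↦ hs (ht _ _ e)
  -- The `n` constants for interpolation are chosen to include the values of `t` at the `r` marked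
  -- points; the remaining `n - r` constants give the functions `G`.
  obtain ⟨T, hT, hTn⟩ := Infinite.exists_superset_card_eq
    (Finset.univ.image fun j ↦ ψ (ι (s j) t)) n (by
      rw [Finset.card_image_of_injective _ hinj]; simpa using hr)
  have hcard : (T \ Finset.univ.image fun j ↦ ψ (ι (s j) t)).card = n - r := by
    rw [Finset.card_sdiff_of_subset hT, hTn, Finset.card_image_of_injective _ hinj]; simp
  let e := (T \ Finset.univ.image fun j ↦ ψ (ι (s j) t)).equivFinOfCardEq hcard
  let eT := T.equivFinOfCardEq hTn
  refine ⟨fun l ↦ h.norm (algebraMap K A (e.symm l) - t), fun D hD h1 h2 ↦ ?_⟩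
  refine h.eq_zero_of_norm_sub hD hloc (fun i ↦ (eT.symm i : K))
    (Subtype.val_injective.comp eT.symm.injective) fun i ↦ ?_
  by_cases hi : (eT.symm i : K) ∈ Finset.univ.image fun j ↦ ψ (ι (s j) t)
  · obtain ⟨j, -, hj⟩ := Finset.mem_image.mp hi
    rw [← hj]
    obtain ⟨u, hu⟩ := (hf j (algebraMap K A (ψ (ι (s j) t)) - t)).mp (by simp)
    have hfj : ψ (ι (s j) (f j)) = 0 := (hf j _).mpr dvd_rfl
    -- The norm of `f j` vanishes at `ψ` and under `D`, so both terms of the Leibniz rule for the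
    -- product of norms vanish.
    rw [hu, h.norm_mul, hD, h1 j, psi_norm, Finset.prod_eq_zero (Finset.mem_univ (s j)) hfj]
    simp
  · have := h2 (e ⟨_, Finset.mem_sdiff.mpr ⟨(eT.symm i).2, hi⟩⟩)
    simpa using this

end IsSymmetricTensorPower

end SymmetricTensors

/-! ### Regular local rings. -/

section RegularLocal

open IsLocalRing

/-- Elements of the maximal ideal with independent classes in the cotangent space extend to a
minimal system of generators. -/
theorem exists_span_union_eq_maximalIdeal {R : Type*} [CommRing R] [IsLocalRing R]
    [IsNoetherianRing R] {r : ℕ} (f : Fin r → maximalIdeal R)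
    (hf : LinearIndependent (ResidueField R) fun i ↦ (maximalIdeal R).toCotangent (f i)) :
    ∃ (m : ℕ) (f' : Fin m → R),
      Ideal.span (Set.range (fun i ↦ (f i : R)) ∪ Set.range f') = maximalIdeal R ∧
        r + m = Module.finrank (ResidueField R) (CotangentSpace R) := by
  set v : Fin r → CotangentSpace R := fun i ↦ (maximalIdeal R).toCotangent (f i) with hv
  set W := Submodule.span (ResidueField R) (Set.range v) with hW
  let b := Module.finBasis (ResidueField R) (CotangentSpace R ⧸ W)
  have hlift (i) : ∃ g : maximalIdeal R, W.mkQ ((maximalIdeal R).toCotangent g) = b i := by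
    obtain ⟨w, hw⟩ := W.mkQ_surjective (b i)
    obtain ⟨g, hg⟩ := (maximalIdeal R).toCotangent_surjective w
    exact ⟨g, by rw [hg, hw]⟩
  choose g hg using hlift
  refine ⟨_, fun i ↦ (g i : R), ?_, ?_⟩
  · have h1 : Submodule.span R (Set.range f ∪ Set.range g) = ⊤ := by
      rw [← CotangentSpace.span_image_eq_top_iff, Set.image_union, Submodule.span_union,
        ← Set.range_comp, ← Set.range_comp]
      change W ⊔ _ = ⊤
      have : Submodule.map W.mkQ (Submodule.span (ResidueField R)
          (Set.range ((maximalIdeal R).toCotangent ∘ g))) = ⊤ := by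
        rw [Submodule.map_span, ← Set.range_comp, ← b.span_eq]
        congr 2
        ext i
        exact hg i
      rw [eq_top_iff]
      intro x _
      obtain ⟨y, hy, hyx⟩ : W.mkQ x ∈ Submodule.map W.mkQ (Submodule.span (ResidueField R)
          (Set.range ((maximalIdeal R).toCotangent ∘ g))) := by rw [this]; trivial
      have : x - y ∈ W := by rw [← Submodule.ker_mkQ W, LinearMap.mem_ker, map_sub, hyx, sub_self]
      simpa using Submodule.add_mem_sup this hy
    have h2 := congrArg (Submodule.map (maximalIdeal R).subtype) h1
    rw [Submodule.map_span, Set.image_union, ← Set.range_comp, ← Set.range_comp,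
      Submodule.map_top, Submodule.range_subtype] at h2
    exact h2
  · have := W.finrank_quotient_add_finrank
    rw [finrank_span_eq_card hf, Fintype.card_fin] at this
    lia

/-- Induction on the dimension. Take `x` in the maximal ideal but neither in its square nor in a
minimal prime. The quotient by `x` is regular of smaller dimension, hence a domain, so `(x)` is
prime; a minimal prime `P` inside `(x)` does not contain `x`, whence `P = x P` and `P = 0` by
Nakayama. -/
theorem isDomain_of_isRegularLocalRing_aux (d : ℕ) : ∀ (R : Type u) [CommRing R]
    [IsRegularLocalRing R], ringKrullDim R = d → IsDomain R := by
  induction d with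
  | zero =>
    intro R _ _ hd
    have h := IsRegularLocalRing.spanFinrank_maximalIdeal (R := R)
    rw [hd, Nat.cast_inj,
      Submodule.spanFinrank_eq_zero_iff_eq_bot (IsNoetherian.noetherian _)] at h
    exact (isField_iff_maximalIdeal_eq.mpr h).isDomain
  | succ d ih =>
    intro R _ _ hd
    classical
    have hfin : (minimalPrimes R).Finite := minimalPrimes.finite_of_isNoetherianRing R
    -- The square of the maximal ideal need not be prime, but prime avoidance exempts two members of
    -- the family.
    have hnot : ¬ (maximalIdeal R : Set R) ⊆ ⋃ P ∈ ((insert (maximalIdeal R ^ 2)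
        hfin.toFinset : Finset (Ideal R)) : Set (Ideal R)), (P : Set R) := by
      rw [Ideal.subset_union_prime (f := fun P ↦ P) (maximalIdeal R ^ 2) (maximalIdeal R ^ 2)]
      · rintro ⟨P, hP, hle⟩
        rcases Finset.mem_insert.mp hP with rfl | hP
        · have hb : maximalIdeal R = ⊥ := by
            refine Submodule.eq_bot_of_le_smul_of_le_jacobson_bot (maximalIdeal R) _
              (IsNoetherian.noetherian _) ?_ (IsLocalRing.maximalIdeal_le_jacobson _)
            rwa [smul_eq_mul, ← sq]
          have h := IsRegularLocalRing.spanFinrank_maximalIdeal (R := R)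
          rw [hd, Nat.cast_inj, hb] at h
          simp at h
        · rw [Set.Finite.mem_toFinset] at hP
          have hPp : P.IsPrime := Ideal.IsMinimalPrime.isPrime hP
          have he : P = maximalIdeal R := le_antisymm (IsLocalRing.le_maximalIdeal hPp.ne_top) hle
          have h0 := Ideal.height_eq_zero_iff.mpr hP
          have h1 := maximalIdeal_height_eq_ringKrullDim (R := R)
          rw [← he, h0, hd] at h1
          norm_cast at h1
      · intro P hP h1 h2
        rcases Finset.mem_insert.mp hP with rfl | hP
        · exact absurd rfl h1
        · exact Ideal.IsMinimalPrime.isPrime (hfin.mem_toFinset.mp hP)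
    obtain ⟨x, hx, hxn⟩ := Set.not_subset.mp hnot
    simp only [Finset.coe_insert, Set.Finite.coe_toFinset, Set.mem_insert_iff, Set.iUnion_iUnion_eq_or_left,
      Set.mem_union, SetLike.mem_coe, Set.mem_iUnion, exists_prop, not_or, not_exists, not_and] at hxn
    obtain ⟨hx2, hxP⟩ := hxn
    obtain ⟨m, f', hspan, hm⟩ := exists_span_union_eq_maximalIdeal (r := 1)
      (fun _ ↦ (⟨x, hx⟩ : maximalIdeal R)) (by
        refine LinearIndependent.of_subsingleton 0 ?_
        rw [Ne, Ideal.toCotangent_eq_zero]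
        exact hx2)
    have hmd : m = d := by
      have := (IsRegularLocalRing.iff_finrank_cotangentSpace (R := R)).mp inferInstance
      rw [hd, ← hm] at this
      norm_cast at this
      lia
    subst hmd
    have hle : Ideal.span {x} ≤ maximalIdeal R := by
      rwa [Ideal.span_singleton_le_iff_mem]
    have hne : Ideal.span {x} ≠ ⊤ := ne_top_of_le_ne_top (maximalIdeal.isMaximal R).ne_top hle
    have : Nontrivial (R ⧸ Ideal.span {x}) := Ideal.Quotient.nontrivial_iff.mpr hne
    have hloc : IsLocalRing (R ⧸ Ideal.span {x}) :=
      IsLocalRing.of_surjective' (Ideal.Quotient.mk (Ideal.span {x})) Ideal.Quotient.mk_surjective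
    have hmap : maximalIdeal (R ⧸ Ideal.span {x}) =
        Ideal.span (Set.range (Ideal.Quotient.mk (Ideal.span {x}) ∘ f')) := by
      have h1 : (maximalIdeal R).map (Ideal.Quotient.mk (Ideal.span {x})) =
          maximalIdeal (R ⧸ Ideal.span {x}) :=
        IsLocalRing.map_maximalIdeal_of_surjective _ Ideal.Quotient.mk_surjective
      rw [← h1, ← hspan, Ideal.map_span, Set.image_union, Ideal.span_union, ← Set.range_comp,
        ← Set.range_comp]
      refine sup_eq_right.mpr (Ideal.span_le.mpr ?_)
      rintro _ ⟨i, rfl⟩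
      have : Ideal.Quotient.mk (Ideal.span {x}) x = 0 :=
        Ideal.Quotient.eq_zero_iff_mem.mpr (Ideal.mem_span_singleton_self x)
      simp [this]
    have hdim : (m : WithBot ℕ∞) ≤ ringKrullDim (R ⧸ Ideal.span {x}) := by
      have h1 := Ideal.height_le_ringKrullDim_quotient_add_one (r := x) (p := maximalIdeal R) hx
      rw [maximalIdeal_height_eq_ringKrullDim, hd, Nat.cast_add, Nat.cast_one] at h1
      exact ENat.WithBot.add_le_add_one_right_iff.mp h1
    have hsp : ((maximalIdeal (R ⧸ Ideal.span {x})).spanFinrank : WithBot ℕ∞) ≤ m := by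
      rw [hmap]
      norm_cast
      refine (Submodule.spanFinrank_span_le_ncard_of_finite (Set.finite_range _)).trans ?_
      rw [← Set.image_univ]
      refine (Set.ncard_image_le Set.finite_univ).trans ?_
      simp
    have hreg : IsRegularLocalRing (R ⧸ Ideal.span {x}) :=
      IsRegularLocalRing.of_spanFinrank_maximalIdeal_le _ (hsp.trans hdim)
    have hdom := ih (R ⧸ Ideal.span {x}) (le_antisymm
      ((ringKrullDim_le_spanFinrank_maximalIdeal _).trans hsp) hdim)
    have hprime : (Ideal.span {x}).IsPrime := (Ideal.Quotient.isDomain_iff_prime _).mp hdom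
    obtain ⟨P, hP, hPx⟩ := Ideal.exists_minimalPrimes_le (bot_le : ⊥ ≤ Ideal.span {x})
    have hPp : P.IsPrime := Ideal.IsMinimalPrime.isPrime hP
    have hPbot : P = ⊥ := by
      refine Submodule.eq_bot_of_le_smul_of_le_jacobson_bot (Ideal.span {x}) _
        (IsNoetherian.noetherian _) ?_ (hle.trans (IsLocalRing.maximalIdeal_le_jacobson _))
      intro p hp
      obtain ⟨q, rfl⟩ := Ideal.mem_span_singleton.mp (hPx hp)
      rw [smul_eq_mul]
      exact Ideal.mul_mem_mul (Ideal.mem_span_singleton_self x)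
        ((hPp.mem_or_mem hp).resolve_left (hxP P hP))
    exact (IsDomain.of_bot_isPrime R (hbp := hPbot ▸ hPp))

theorem isDomain_of_isRegularLocalRing (R : Type u) [CommRing R] [IsRegularLocalRing R] :
    IsDomain R := by
  obtain ⟨d, hd⟩ : ∃ d : ℕ, ringKrullDim R = d :=
    ⟨_, (IsRegularLocalRing.spanFinrank_maximalIdeal (R := R)).symm⟩
  exact isDomain_of_isRegularLocalRing_aux d R hd

variable {O O' : Type*} [CommRing O] [CommRing O'] [Algebra O O'] [IsLocalRing O']
  [IsNoetherianRing O'] [Module.Flat O O']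

/-- A flat extension satisfies going down, so the height of the upper maximal ideal is that of the
lower one plus the dimension of the closed fibre, which is a field here. -/
theorem ringKrullDim_eq_of_map_maximalIdeal [IsLocalRing O] [IsNoetherianRing O]
    [IsLocalHom (algebraMap O O')]
    (h : (maximalIdeal O).map (algebraMap O O') = maximalIdeal O') :
    ringKrullDim O' = ringKrullDim O := by
  have : (maximalIdeal O').LiesOver (maximalIdeal O) :=
    ⟨(IsLocalRing.maximalIdeal_comap (algebraMap O O')).symm⟩
  have e := Ideal.height_eq_height_add_of_liesOver_of_hasGoingDown (maximalIdeal O)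
    (maximalIdeal O')
  rw [h, Ideal.map_quotient_self] at e
  have : Nontrivial (O' ⧸ maximalIdeal O') :=
    Ideal.Quotient.nontrivial_iff.mpr Ideal.IsPrime.ne_top'
  rw [Ideal.height_bot, add_zero] at e
  rw [← maximalIdeal_height_eq_ringKrullDim, ← maximalIdeal_height_eq_ringKrullDim, e]

theorem isRegularLocalRing_of_map_maximalIdeal [IsRegularLocalRing O]
    [IsLocalHom (algebraMap O O')]
    (h : (maximalIdeal O).map (algebraMap O O') = maximalIdeal O') : IsRegularLocalRing O' := by
  refine IsRegularLocalRing.of_spanFinrank_maximalIdeal_le _ ?_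
  rw [ringKrullDim_eq_of_map_maximalIdeal h, ← IsRegularLocalRing.spanFinrank_maximalIdeal, ← h]
  norm_cast
  have hfg : (maximalIdeal O).FG := IsNoetherian.noetherian _
  have hfin := Submodule.FG.finite_generators hfg
  conv_lhs => rw [← (maximalIdeal O).span_generators]
  erw [Ideal.map_span]
  refine (Submodule.spanFinrank_span_le_ncard_of_finite (hfin.image _)).trans ?_
  rw [← Submodule.FG.generators_ncard hfg]
  exact Set.ncard_image_le hfin

end RegularLocal

/-! ### Étale and unramified algebras over affine space. -/

section Etale

open IsLocalRing

theorem pderiv_mem_of_mem_sq {σ k : Type*} [CommRing k] (p : Ideal (MvPolynomial σ k)) (j : σ)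
    {x : MvPolynomial σ k} (hx : x ∈ p ^ 2) : MvPolynomial.pderiv j x ∈ p := by
  rw [sq] at hx
  induction hx using Submodule.mul_induction_on' with
  | mem_mul_mem a ha b hb =>
    rw [Derivation.leibniz]
    exact p.add_mem (p.mul_mem_right _ ha) (p.mul_mem_right _ hb)
  | add x _ y _ hx hy => rw [map_add]; exact p.add_mem hx hy

/-- The coordinates that vanish at a point of affine space are independent in the cotangent
space. -/
theorem linearIndependent_toCotangent_X {k : Type*} [Field k] {n r : ℕ}
    (p : Ideal (MvPolynomial (Fin n) k)) [p.IsPrime] (J : Fin r → Fin n)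
    (hJ : Function.Injective J)
    (f : Fin r → maximalIdeal (Localization.AtPrime p))
    (hf : ∀ i, (f i : Localization.AtPrime p) =
      algebraMap (MvPolynomial (Fin n) k) _ (MvPolynomial.X (J i))) :
    LinearIndependent (ResidueField (Localization.AtPrime p))
      fun i ↦ (maximalIdeal (Localization.AtPrime p)).toCotangent (f i) := by
  classical
  have hX (i) : MvPolynomial.X (J i) ∈ p := by
    have := (f i).2
    rwa [hf, IsLocalization.AtPrime.to_map_mem_maximal_iff _ p] at this
  rw [Fintype.linearIndependent_iff]
  intro g hg j
  choose a ha using fun i ↦ Ideal.Quotient.mk_surjective (g i)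
  obtain ⟨b, hb⟩ := IsLocalization.exist_integer_multiples_of_finite p.primeCompl a
  choose c hc using hb
  have h1 : ∑ i, a i • (maximalIdeal (Localization.AtPrime p)).toCotangent (f i) = 0 := by
    rw [← hg]
    refine Finset.sum_congr rfl fun i _ ↦ ?_
    rw [← ha i]; rfl
  have h2 : ∑ i, a i * (f i : Localization.AtPrime p) ∈
      maximalIdeal (Localization.AtPrime p) ^ 2 := by
    simp only [← map_smul, ← map_sum] at h1
    rw [Ideal.toCotangent_eq_zero] at h1
    simpa using h1
  have h3 : algebraMap _ (Localization.AtPrime p) (∑ i, c i * MvPolynomial.X (J i)) ∈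
      (p ^ 2).map (algebraMap _ (Localization.AtPrime p)) := by
    rw [Ideal.map_pow, Localization.AtPrime.map_eq_maximalIdeal]
    have : algebraMap _ (Localization.AtPrime p) (∑ i, c i * MvPolynomial.X (J i)) =
        algebraMap _ _ (b : MvPolynomial (Fin n) k) * ∑ i, a i * (f i : Localization.AtPrime p) := by
      rw [map_sum, Finset.mul_sum]
      refine Finset.sum_congr rfl fun i _ ↦ ?_
      rw [map_mul, hc, hf, Algebra.smul_def, mul_assoc]
    rw [this]
    exact Ideal.mul_mem_left _ _ h2
  rw [IsLocalization.algebraMap_mem_map_algebraMap_iff p.primeCompl] at h3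
  obtain ⟨s, hs, h4⟩ := h3
  -- After clearing denominators a relation modulo the square reads `s ∑ c_i X_{J i} ∈ p²`. The
  -- partial derivative along `X_{J j}` lies in `p`, and modulo `p` it is `s c_j`.
  have h5 := pderiv_mem_of_mem_sq p (J j) h4
  have h6 : s * c j ∈ p := by
    rw [Finset.mul_sum, map_sum, ← Finset.add_sum_erase _ _ (Finset.mem_univ j)] at h5
    have h7 : ∑ i ∈ Finset.univ.erase j,
        MvPolynomial.pderiv (J j) (s * (c i * MvPolynomial.X (J i))) ∈ p := by
      refine p.sum_mem fun i hi ↦ ?_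
      have : J i ≠ J j := fun e ↦ (Finset.ne_of_mem_erase hi) (hJ e)
      rw [← mul_assoc, Derivation.leibniz, MvPolynomial.pderiv_X_of_ne this, smul_zero,
        zero_add]
      exact p.mul_mem_right _ (hX i)
    rw [p.add_mem_iff_left h7, ← mul_assoc, Derivation.leibniz, MvPolynomial.pderiv_X_self,
      smul_eq_mul, mul_one, smul_eq_mul, p.add_mem_iff_left (p.mul_mem_right _ (hX j))] at h5
    exact h5
  have h7 : c j ∈ p := (‹p.IsPrime›.mem_or_mem h6).resolve_left hs
  have h8 : a j ∈ maximalIdeal (Localization.AtPrime p) := by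
    have : algebraMap _ (Localization.AtPrime p) (b : MvPolynomial (Fin n) k) * a j ∈
        maximalIdeal (Localization.AtPrime p) := by
      have hb : (b : MvPolynomial (Fin n) k) • a j = algebraMap _ (Localization.AtPrime p) (b : MvPolynomial (Fin n) k) * a j :=
        Algebra.smul_def (b : MvPolynomial (Fin n) k) (a j)
      rw [← hb, ← hc, IsLocalization.AtPrime.to_map_mem_maximal_iff _ p]
      exact h7
    refine (Ideal.IsPrime.mem_or_mem inferInstance this).resolve_left fun h ↦ ?_
    rw [IsLocalization.AtPrime.to_map_mem_maximal_iff _ p] at h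
    exact b.2 h
  rw [← ha j]
  exact Ideal.Quotient.eq_zero_iff_mem.mpr h8

theorem map_maximalIdeal_of_etale {T B : Type*} [CommRing T] [CommRing B] [Algebra T B]
    [Algebra.Etale T B] (p : Ideal T) [p.IsPrime] (q : Ideal B) [q.IsPrime] [q.LiesOver p]
    [Algebra (Localization.AtPrime p) (Localization.AtPrime q)]
    [Localization.AtPrime.IsLiesOverAlgebra p q] :
    (maximalIdeal (Localization.AtPrime p)).map
      (algebraMap (Localization.AtPrime p) (Localization.AtPrime q)) =
      maximalIdeal (Localization.AtPrime q) := by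
  have : Algebra.EssFiniteType (Localization.AtPrime p) (Localization.AtPrime q) :=
    .of_comp T _ _
  have : Algebra.FormallyUnramified (Localization.AtPrime p) (Localization.AtPrime q) :=
    .of_restrictScalars T _ _
  exact Algebra.FormallyUnramified.map_maximalIdeal

theorem IsPartOfRegularSystem.map_ringEquiv {R R' : Type*} [CommRing R] [CommRing R']
    [IsLocalRing R] [IsLocalRing R'] (e : R ≃+* R') {r : ℕ} {f : Fin r → R}
    (h : IsPartOfRegularSystem f) : IsPartOfRegularSystem fun i ↦ e (f i) := by
  obtain ⟨m, f', h1, h2⟩ := h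
  refine ⟨m, fun i ↦ e (f' i), ?_, by rw [h2, ringKrullDim_eq_of_ringEquiv e]⟩
  have := congrArg (Ideal.map (e : R →+* R')) h1
  rw [Ideal.map_span, Set.image_union, ← Set.range_comp, ← Set.range_comp] at this
  exact this.trans (map_ringEquiv_maximalIdeal e)

/-- The maximal ideal upstairs is generated by the one downstairs and the dimensions agree, so
regular systems of parameters pull back. An arbitrary localization `Bq` is allowed so that the
result applies to stalks. -/
theorem isRegular_of_etale_mvPolynomial {k B : Type*} [Field k] [CommRing B] {n : ℕ}
    [Algebra (MvPolynomial (Fin n) k) B] [Algebra.Etale (MvPolynomial (Fin n) k) B]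
    (q : Ideal B) [q.IsPrime] (Bq : Type*) [CommRing Bq] [Algebra B Bq]
    [IsLocalization.AtPrime Bq q] [IsLocalRing Bq] :
    IsRegularLocalRing Bq ∧ ∀ {r : ℕ} (J : Fin r → Fin n), Function.Injective J →
      (∀ i, algebraMap (MvPolynomial (Fin n) k) B (MvPolynomial.X (J i)) ∈ q) →
      IsPartOfRegularSystem fun i ↦
        algebraMap B Bq (algebraMap (MvPolynomial (Fin n) k) B (MvPolynomial.X (J i))) := by
  have hB : IsNoetherianRing B := Algebra.FiniteType.isNoetherianRing (MvPolynomial (Fin n) k) B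
  set p := q.under (MvPolynomial (Fin n) k) with hp
  let := Localization.AtPrime.algebraOfLiesOver p q
  have hm := map_maximalIdeal_of_etale p q
  have hreg : IsRegularLocalRing (Localization.AtPrime q) :=
    isRegularLocalRing_of_map_maximalIdeal hm
  let e : Localization.AtPrime q ≃ₐ[B] Bq := IsLocalization.algEquiv q.primeCompl _ _
  refine ⟨IsRegularLocalRing.of_ringEquiv e.toRingEquiv, fun {r} J hJ hJq ↦ ?_⟩
  have key : IsPartOfRegularSystem fun i ↦ algebraMap B (Localization.AtPrime q)
      (algebraMap (MvPolynomial (Fin n) k) B (MvPolynomial.X (J i))) := by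
    let f (i : Fin r) : maximalIdeal (Localization.AtPrime p) :=
      ⟨algebraMap (MvPolynomial (Fin n) k) _ (MvPolynomial.X (J i)), by
        rw [IsLocalization.AtPrime.to_map_mem_maximal_iff _ p]; exact hJq i⟩
    obtain ⟨m, f', h1, h2⟩ := exists_span_union_eq_maximalIdeal f
      (linearIndependent_toCotangent_X p J hJ f fun i ↦ rfl)
    refine ⟨m, fun i ↦ algebraMap _ _ (f' i), ?_, ?_⟩
    · rw [← hm, ← h1, Ideal.map_span, Set.image_union, ← Set.range_comp, ← Set.range_comp]
      congr 3
      ext i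
      simp only [f, Function.comp_apply, ← IsScalarTower.algebraMap_apply]
    · rw [ringKrullDim_eq_of_map_maximalIdeal hm,
        ← (IsRegularLocalRing.iff_finrank_cotangentSpace (R := Localization.AtPrime p)).mp
          inferInstance, h2]
  simpa using key.map_ringEquiv e.toRingEquiv

theorem ringKrullDim_le_of_etale_mvPolynomial {k B : Type*} [Field k] [CommRing B] {n : ℕ}
    [Algebra (MvPolynomial (Fin n) k) B] [Algebra.Etale (MvPolynomial (Fin n) k) B]
    (q : Ideal B) [q.IsPrime] : ringKrullDim (Localization.AtPrime q) ≤ (n : ℕ∞) := by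
  have hB : IsNoetherianRing B := Algebra.FiniteType.isNoetherianRing (MvPolynomial (Fin n) k) B
  set p := q.under (MvPolynomial (Fin n) k) with hp
  let := Localization.AtPrime.algebraOfLiesOver p q
  rw [ringKrullDim_eq_of_map_maximalIdeal (map_maximalIdeal_of_etale p q),
    IsLocalization.AtPrime.ringKrullDim_eq_height p]
  refine (Ideal.height_le_ringKrullDim_of_ne_top Ideal.IsPrime.ne_top').trans ?_
  rw [MvPolynomial.ringKrullDim_of_isNoetherianRing]
  simp

/-- Split off one variable. The contraction of a maximal ideal is maximal because the rings are
Jacobson, and the height grows by one from the contraction. -/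
theorem height_eq_of_isMaximal_mvPolynomial {k : Type*} [Field k] (n : ℕ) :
    ∀ (M : Ideal (MvPolynomial (Fin n) k)) [M.IsMaximal], M.height = n := by
  induction n with
  | zero =>
    intro M hM
    have : Ring.KrullDimLE 0 (MvPolynomial (Fin 0) k) := by
      rw [Ring.krullDimLE_iff, MvPolynomial.ringKrullDim_of_isNoetherianRing]
      simp
    have : M.height ≤ 0 := by
      have := Ideal.height_le_ringKrullDim_of_ne_top hM.ne_top
      rw [MvPolynomial.ringKrullDim_of_isNoetherianRing] at this
      simpa using this
    simpa using this
  | succ n ih =>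
    intro M hM
    let e := (MvPolynomial.finSuccEquiv k n).toRingEquiv
    let M' : Ideal (Polynomial (MvPolynomial (Fin n) k)) := M.map e
    have hM' : M'.IsMaximal := Ideal.map_isMaximal_of_equiv e
    have : (M'.under (MvPolynomial (Fin n) k)).IsMaximal :=
      Polynomial.isMaximal_comap_C_of_isJacobsonRing M'
    have : M'.LiesOver (M'.under (MvPolynomial (Fin n) k)) := ⟨rfl⟩
    have h1 := Polynomial.height_eq_height_add_one (M'.under (MvPolynomial (Fin n) k)) M'
    rw [ih, e.height_map] at h1
    rw [h1]; simp

/-- A ring of dimension at least `n` which is unramified over affine `n`-space is étale over it. -/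
theorem exists_etale_of_isUnramifiedAt {k R : Type u} [Field k] [CommRing R] {n : ℕ}
    [Algebra (MvPolynomial (Fin n) k) R] [Algebra.FiniteType (MvPolynomial (Fin n) k) R]
    (y : Ideal R) [y.IsPrime] [Algebra.IsUnramifiedAt (MvPolynomial (Fin n) k) y]
    (hy : n ≤ y.height) :
    ∃ ρ ∉ y, Algebra.Etale (MvPolynomial (Fin n) k) (Localization.Away ρ) := by
  set T := MvPolynomial (Fin n) k
  have hR : IsNoetherianRing R := Algebra.FiniteType.isNoetherianRing T R
  -- Near `y` an unramified algebra is a quotient of a standard étale algebra `P.Ring`; the aim is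
  -- to show that the local homomorphism `Φ` is bijective.
  obtain ⟨f, hf, P, φ, hφ⟩ :=
    Algebra.IsUnramifiedAt.exists_hasStandardEtaleSurjectionOn (R := T) y
  have hu : IsUnit (algebraMap R (Localization.AtPrime y) f) :=
    IsLocalization.map_units (M := y.primeCompl) _ ⟨f, hf⟩
  let g₀ : Localization.Away f →ₐ[R] Localization.AtPrime y :=
    IsLocalization.liftAlgHom (M := Submonoid.powers f) (f := Algebra.ofId R _) (by
      rintro ⟨-, m, rfl⟩
      simpa using hu.pow m)
  have hg₀ (r : R) : g₀ (algebraMap R _ r) = algebraMap R _ r := g₀.commutes r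
  let g : P.Ring →ₐ[T] Localization.AtPrime y := (g₀.restrictScalars T).comp φ
  let q : Ideal P.Ring := (maximalIdeal (Localization.AtPrime y)).comap g
  have hq : q.IsPrime := Ideal.IsPrime.comap _
  have hunit (b : q.primeCompl) : IsUnit (g b) := by
    by_contra h
    exact b.2 h
  let Φ₀ : Localization.AtPrime q →+* Localization.AtPrime y :=
    IsLocalization.lift (M := q.primeCompl) (g := g.toRingHom) hunit
  have hΦ₀ (b : P.Ring) : Φ₀ (algebraMap _ _ b) = g b := IsLocalization.lift_eq _ b
  let Φ : Localization.AtPrime q →ₐ[T] Localization.AtPrime y :=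
    { Φ₀ with
      commutes' := fun t ↦ by
        rw [IsScalarTower.algebraMap_apply T P.Ring (Localization.AtPrime q)]
        exact (hΦ₀ _).trans (g.commutes t) }
  have hsurj₀ (r : R) : ∃ b, g b = algebraMap R _ r := by
    obtain ⟨b, hb⟩ := hφ (algebraMap R _ r)
    exact ⟨b, by rw [← hg₀, ← hb]; rfl⟩
  have hsurj : Function.Surjective Φ := by
    intro z
    obtain ⟨r, s, rfl⟩ := IsLocalization.exists_mk'_eq y.primeCompl z
    obtain ⟨b, hb⟩ := hsurj₀ r
    obtain ⟨c, hc⟩ := hsurj₀ s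
    have hcq : c ∈ q.primeCompl := fun h ↦ by
      have : g c ∈ maximalIdeal (Localization.AtPrime y) := h
      rw [hc, IsLocalization.AtPrime.to_map_mem_maximal_iff _ y] at this
      exact s.2 this
    refine ⟨IsLocalization.mk' _ b (⟨c, hcq⟩ : q.primeCompl), ?_⟩
    rw [IsLocalization.eq_mk'_iff_mul_eq, ← hc, ← hb, ← hΦ₀, ← hΦ₀]
    refine (map_mul Φ₀ _ _).symm.trans (congrArg Φ₀ ?_)
    exact IsLocalization.mk'_spec _ b (⟨c, hcq⟩ : q.primeCompl)
  have : Algebra.Etale (MvPolynomial (Fin n) k) P.Ring :=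
    inferInstanceAs (Algebra.Etale T P.Ring)
  have hregq : IsRegularLocalRing (Localization.AtPrime q) :=
    (isRegular_of_etale_mvPolynomial (k := k) (n := n) q (Localization.AtPrime q)).1
  have hdom := isDomain_of_isRegularLocalRing (Localization.AtPrime q)
  have hdim := ringKrullDim_le_of_etale_mvPolynomial (k := k) (n := n) q
  -- The source is a regular local domain of dimension at most `n`. Dividing by a nonzero `b` in the
  -- kernel would lower the dimension, yet the quotient still surjects onto a ring of dimension at
  -- least `n`.
  have hinj : Function.Injective Φ := by
    rw [injective_iff_map_eq_zero]
    intro b hb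
    by_contra hb0
    let Ψ : Localization.AtPrime q ⧸ Ideal.span {b} →+* Localization.AtPrime y :=
      Ideal.Quotient.lift _ Φ.toRingHom (by
        intro a ha
        obtain ⟨c, rfl⟩ := Ideal.mem_span_singleton.mp ha
        exact (map_mul Φ _ _).trans (by rw [hb, zero_mul]))
    have hΨ : Function.Surjective Ψ := Ideal.Quotient.lift_surjective_of_surjective _ _ hsurj
    have h1 := ringKrullDim_le_of_surjective Ψ hΨ
    have h2 := ringKrullDim_quotient_succ_le_of_nonZeroDivisor
      (mem_nonZeroDivisors_of_ne_zero hb0)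
    rw [IsLocalization.AtPrime.ringKrullDim_eq_height y] at h1
    have h3 : ((n : ℕ∞) : WithBot ℕ∞) + 1 ≤ (n : ℕ∞) :=
      (add_le_add_left ((WithBot.coe_le_coe.mpr hy).trans h1) 1).trans (h2.trans hdim)
    norm_cast at h3
    lia
  have : Algebra.FormallyEtale P.Ring (Localization.AtPrime q) :=
    .of_isLocalization q.primeCompl
  have : Algebra.FormallyEtale T (Localization.AtPrime q) :=
    .comp T P.Ring _
  have : Algebra.IsEtaleAt T y :=
    Algebra.FormallyEtale.of_equiv (AlgEquiv.ofBijective Φ ⟨hinj, hsurj⟩)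
  have : Algebra.FinitePresentation T R := Algebra.FinitePresentation.of_finiteType.mp inferInstance
  exact Algebra.exists_etale_of_isEtaleAt y

end Etale

/-! ### Linear algebra and extension of scalars. -/

section Basis

/-- A subspace of dimension at most `m` which is separated by a family of linear forms is separated
by `m` of them. -/
theorem exists_separating_subfamily {K W ι : Type*} [Field K] [AddCommGroup W] [Module K W]
    [Nonempty ι] (e : ι → W →ₗ[K] K) (m : ℕ) : ∀ (V : Submodule K W) [FiniteDimensional K V],
    Module.finrank K V ≤ m → (∀ v ∈ V, (∀ i, e i v = 0) → v = 0) →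
    ∃ g : Fin m → ι, ∀ v ∈ V, (∀ l, e (g l) v = 0) → v = 0 := by
  induction m with
  | zero =>
    intro V _ hV _
    refine ⟨Fin.elim0, fun v hv _ ↦ ?_⟩
    have := Submodule.finrank_eq_zero.mp (Nat.le_zero.mp hV)
    rw [this] at hv
    exact hv
  | succ m ih =>
    intro V _ hV hsep
    by_cases h : ∃ i, ∃ v ∈ V, e i v ≠ 0
    · obtain ⟨i, v, hv, hiv⟩ := h
      let V' := V ⊓ LinearMap.ker (e i)
      have hlt : V' < V := by
        refine lt_of_le_of_ne inf_le_left fun h ↦ hiv ?_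
        have : v ∈ V' := h ▸ hv
        exact this.2
      have : FiniteDimensional K V' := Submodule.finiteDimensional_of_le hlt.le
      obtain ⟨g, hg⟩ := ih V' (by have := Submodule.finrank_lt_finrank_of_lt hlt; lia)
        fun v hv ↦ hsep v hv.1
      refine ⟨Fin.cons i g, fun v hv h ↦ hg v ⟨hv, ?_⟩ fun l ↦ ?_⟩
      · simpa using h 0
      · simpa using h l.succ
    · push Not at h
      exact ⟨fun _ ↦ Classical.arbitrary ι, fun v hv _ ↦ hsep v hv fun i ↦ h i v hv⟩

end Basis

section BaseChange

open TensorProduct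

variable {k C R : Type*} {K : Type u} {A : Type u} [Field k] [Field K] [Algebra k K] [CommRing A] [Algebra k A]
  [CommRing C] [Algebra k C] [CommRing R] [Algebra k R] [Algebra R C] [IsScalarTower k R C] {n : ℕ}
  [MulSemiringAction (Equiv.Perm (Fin n)) C] {ι : Fin n → (A →ₐ[k] C)}

namespace IsSymmetricTensorPower

/-- The action of the symmetric group by algebra automorphisms. -/
def toAlgEquiv (h : IsSymmetricTensorPower R ι) : Equiv.Perm (Fin n) →* (C ≃ₐ[k] C) where
  toFun σ := AlgEquiv.ofRingEquiv (f := MulSemiringAction.toRingEquiv _ C σ) fun x ↦ by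
    rw [IsScalarTower.algebraMap_apply k R C]
    exact h.smul_algebraMap σ _
  map_one' := by ext; simp
  map_mul' σ τ := by ext; simp

end IsSymmetricTensorPower

/-- The `K`-point of the scalar extension given by a `K`-valued point. -/
def extendScalars {A : Type*} [CommRing A] [Algebra k A] (z : A →ₐ[k] K) : K ⊗[k] A →ₐ[K] K :=
  Algebra.TensorProduct.lift (AlgHom.id K K) z fun _ _ ↦ Commute.all _ _

@[simp]
theorem extendScalars_tmul {A : Type*} [CommRing A] [Algebra k A] (z : A →ₐ[k] K) (x : K) (a : A) :
    extendScalars z (x ⊗ₜ a) = x * z a := rfl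

namespace IsSymmetricTensorPower

variable (K) in
/-- The action of the symmetric group on the scalar extension. -/
abbrev baseChangeAction (h : IsSymmetricTensorPower R ι) :
    MulSemiringAction (Equiv.Perm (Fin n)) (K ⊗[k] C) :=
  MulSemiringAction.compHom (K ⊗[k] C) (M := K ⊗[k] C ≃ₐ[K] K ⊗[k] C)
    { toFun := fun σ ↦ Algebra.TensorProduct.congr AlgEquiv.refl (h.toAlgEquiv σ)
      map_one' := by
        ext x
        induction x with
        | zero => simp
        | add x y hx hy => simpa using congrArg₂ (· + ·) hx hy
        | tmul a c => simp
      map_mul' := fun σ τ ↦ by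
        ext x
        induction x with
        | zero => simp
        | add x y hx hy => simpa using congrArg₂ (· + ·) hx hy
        | tmul a c => simp }

theorem baseChangeAction_tmul (h : IsSymmetricTensorPower R ι) (σ : Equiv.Perm (Fin n))
    (x : K) (c : C) : letI := h.baseChangeAction K
    σ • (x ⊗ₜ[k] c) = x ⊗ₜ (σ • c) := rfl

variable (k K C R) in
/-- The scalar extension of the ring of invariants maps to the scalar extension of the ring. -/
abbrev baseChangeAlgebra : Algebra (K ⊗[k] R) (K ⊗[k] C) :=
  (Algebra.TensorProduct.map (AlgHom.id K K) (IsScalarTower.toAlgHom k R C)).toAlgebra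

/-- The invariants are the kernel of `c ↦ (σ c - c)_σ`, a linear map over `k` to a finite product;
extension of the ground field is exact. -/
theorem baseChange (h : IsSymmetricTensorPower R ι) :
    letI := h.baseChangeAction K
    letI := baseChangeAlgebra k C R K
    IsSymmetricTensorPower (K := K) (K ⊗[k] R)
      fun i ↦ Algebra.TensorProduct.map (AlgHom.id K K) (ι i) := by
  let := h.baseChangeAction K
  let := baseChangeAlgebra k C R K
  have hmap (x : K ⊗[k] R) : algebraMap (K ⊗[k] R) (K ⊗[k] C) x =
      (IsScalarTower.toAlgHom k R C).toLinearMap.lTensor K x := rfl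
  have hinj : Function.Injective (IsScalarTower.toAlgHom k R C).toLinearMap := h.injective
  let d : C →ₗ[k] (Equiv.Perm (Fin n) → C) :=
    LinearMap.pi fun σ ↦ (h.toAlgEquiv σ).toLinearMap - LinearMap.id
  refine ⟨fun σ i a ↦ ?_, fun σ r ↦ ?_, ?_, fun x hx ↦ ?_, ?_⟩
  · induction a with
    | zero => simp
    | add x y hx hy => simp only [map_add, smul_add, hx, hy]
    | tmul x a => simp [baseChangeAction_tmul, h.smul_apply]
  · induction r with
    | zero => simp
    | add x y hx hy => simp only [map_add, smul_add, hx, hy]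
    | tmul x a =>
      rw [hmap, LinearMap.lTensor_tmul, baseChangeAction_tmul]
      exact congrArg _ (h.smul_algebraMap σ a)
  · exact Module.Flat.lTensor_preserves_injective_linearMap _ hinj
  · have hex : Function.Exact (IsScalarTower.toAlgHom k R C).toLinearMap d := by
      intro c
      constructor
      · intro hc
        obtain ⟨r, hr⟩ := h.exists_of_invariant c fun σ ↦ sub_eq_zero.mp (congrFun hc σ)
        exact ⟨r, hr⟩
      · rintro ⟨r, rfl⟩
        funext σ
        exact sub_eq_zero.mpr (h.smul_algebraMap σ r)
    have hex' := Module.Flat.lTensor_exact K hex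
    have hd (σ) (y : K ⊗[k] C) : TensorProduct.piRight k k K (fun _ ↦ C) (d.lTensor K y) σ =
        σ • y - y := by
      induction y with
      | zero => simp
      | add x y hx hy => rw [map_add, map_add, Pi.add_apply, hx, hy, smul_add]; abel
      | tmul x c =>
        rw [LinearMap.lTensor_tmul, TensorProduct.piRight_apply, TensorProduct.piRightHom_tmul,
          baseChangeAction_tmul, ← TensorProduct.tmul_sub]
        rfl
    obtain ⟨r, hr⟩ := (hex' x).mp <| (TensorProduct.piRight k k K (fun _ ↦ C)).injective <| by
      rw [map_zero]
      funext σ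
      rw [hd, hx σ, sub_self]; rfl
    exact ⟨r, hr⟩
  · obtain ⟨B, b, bC, hb⟩ := h.exists_basis
    refine ⟨B, b.baseChange K, bC.baseChange K, fun w ↦ ?_⟩
    simp only [Module.Basis.baseChange_apply, hb, Algebra.TensorProduct.map_tmul, map_one]
    rw [← Algebra.TensorProduct.includeRight_apply (R := k) (A := K), map_prod]
    rfl

end IsSymmetricTensorPower

variable (K) in
/-- The kernel of a rational point given by a principal ideal stays principal after scalar
extension. -/
theorem baseChange_point_eq_zero_iff (s : A →ₐ[k] k) (f : A) (hf : ∀ a, s a = 0 ↔ f ∣ a)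
    (z : A →ₐ[k] K) (hz : ∀ a, z a = algebraMap k K (s a)) (x : K ⊗[k] A) :
    extendScalars z x = 0 ↔
      (1 : K) ⊗ₜ[k] f ∣ x := by
  have hs : Function.Surjective s.toLinearMap := fun c ↦ ⟨algebraMap k A c, s.commutes c⟩
  -- The hypothesis on `f` says that `A → A → k → 0`, multiplication by `f` followed by `s`, is
  -- exact; tensoring keeps this.
  have hex : Function.Exact (LinearMap.mulLeft k f) s.toLinearMap := by
    intro a
    rw [AlgHom.toLinearMap_apply, hf]
    exact ⟨fun ⟨c, hc⟩ ↦ ⟨c, hc.symm⟩, fun ⟨c, hc⟩ ↦ ⟨c, hc.symm⟩⟩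
  have hex' := lTensor_exact K hex hs
  have h1 (x : K ⊗[k] A) : extendScalars z x =
      TensorProduct.rid k K (s.toLinearMap.lTensor K x) := by
    induction x with
    | zero => simp
    | add x y hx hy => simp only [map_add, hx, hy]
    | tmul x a => simp [hz, Algebra.smul_def, mul_comm]
  have h2 (x : K ⊗[k] A) : (LinearMap.mulLeft k f).lTensor K x = (1 ⊗ₜ f) * x := by
    induction x with
    | zero => simp
    | add x y hx hy => simp only [map_add, mul_add, hx, hy]
    | tmul x a => simp
  rw [h1, LinearEquiv.map_eq_zero_iff, hex' x]
  exact ⟨fun ⟨c, hc⟩ ↦ ⟨c, by rw [← hc, h2]⟩, fun ⟨c, hc⟩ ↦ ⟨c, by rw [hc, h2]⟩⟩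

/-- The `K`-space of `k`-linear derivations of `R` at a `K`-valued point `ψ` along which the elements
of a family vanish. -/
def pointDerivations (ψ : C →ₐ[k] K) {α : Type*} (f : α → R) : Submodule K (R →ₗ[k] K) where
  carrier := {D | (∀ x y, D (x * y) = ψ (algebraMap R C x) * D y + ψ (algebraMap R C y) * D x) ∧
    ∀ j, D (f j) = 0}
  zero_mem' := by simp
  add_mem' := fun {a b} ha hb ↦ ⟨fun x y ↦ by
    simp only [LinearMap.add_apply, ha.1, hb.1]; ring, fun j ↦ by simp [ha.2, hb.2]⟩
  smul_mem' := fun c a ha ↦ ⟨fun x y ↦ by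
    simp only [LinearMap.smul_apply, ha.1, smul_eq_mul]; ring, fun j ↦ by simp [ha.2]⟩

namespace IsSymmetricTensorPower

/-- Over a field that is not algebraically closed, `n - r` functions together with the norms of
equations of `r` distinct rational points detect the derivations at a geometric point. -/
theorem exists_detecting_geometric [IsAlgClosed K] (h : IsSymmetricTensorPower R ι)
    (ψ : C →ₐ[k] K)
    (hz : ∀ i, ∃ τ : K ⊗[k] A,
      extendScalars (ψ.comp (ι i)) τ = 0 ∧
      ∀ a, extendScalars (ψ.comp (ι i)) a = 0 →
        ∃ g c, extendScalars (ψ.comp (ι i)) g ≠ 0 ∧ g * a = τ * c)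
    {r : ℕ} (f : Fin r → A) (s : Fin r → (A →ₐ[k] k)) (idx : Fin r → Fin n)
    (hs : Function.Injective s) (hf : ∀ j a, s j a = 0 ↔ f j ∣ a)
    (hidx : ∀ j a, ψ (ι (idx j) a) = algebraMap k K (s j a)) :
    ∃ G : Fin (n - r) → R, ∀ D : R →ₗ[k] K,
      (∀ x y, D (x * y) = ψ (algebraMap R C x) * D y + ψ (algebraMap R C y) * D x) →
      (∀ j, D (h.norm (f j)) = 0) → (∀ l, D (G l) = 0) → D = 0 := by
  let := h.baseChangeAction K
  let := baseChangeAlgebra k C R K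
  let ψ' : K ⊗[k] C →ₐ[K] K := extendScalars ψ
  let ι' (i : Fin n) : K ⊗[k] A →ₐ[K] K ⊗[k] C := Algebra.TensorProduct.map (AlgHom.id K K) (ι i)
  have : IsScalarTower K (K ⊗[k] R) (K ⊗[k] C) := IsScalarTower.of_algebraMap_eq fun x ↦ by
    simp [RingHom.algebraMap_toAlgebra]
  have h' : IsSymmetricTensorPower (K := K) (K ⊗[k] R) ι' := h.baseChange
  have hψι (i) (a : K ⊗[k] A) : ψ' (ι' i a) = extendScalars (ψ.comp (ι i)) a := by
    induction a with
    | zero => simp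
    | add x y hx hy => simp only [map_add, hx, hy]
    | tmul x a => simp [ψ', ι']
  have hmap (x : K) (r : R) : algebraMap (K ⊗[k] R) (K ⊗[k] C) (x ⊗ₜ r) =
    x ⊗ₜ algebraMap R C r := rfl
  obtain ⟨G, hG⟩ := h'.exists_detecting ψ' (by simpa only [hψι] using hz)
    (fun j ↦ 1 ⊗ₜ[k] f j) idx (fun a b e ↦ hs <| AlgHom.ext fun x ↦ by
      have := DFunLike.congr_fun e (1 ⊗ₜ[k] x)
      apply (algebraMap k K).injective
      simpa [ψ', ι', hidx] using this)
    (fun j x ↦ by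
      rw [hψι]
      exact baseChange_point_eq_zero_iff K (s j) (f j) (hf j) _ (hidx j) x)
  have hnorm (a : A) : h'.norm (1 ⊗ₜ[k] a) = 1 ⊗ₜ h.norm a := by
    apply h'.injective
    rw [h'.algebraMap_norm, hmap, h.algebraMap_norm]
    simp only [ι', Algebra.TensorProduct.map_tmul, map_one]
    rw [← Algebra.TensorProduct.includeRight_apply (R := k) (A := K), map_prod]
    rfl
  -- The detecting functions found so far lie in `K ⊗ R`. They embed `V` into `K^(n - r)`, which
  -- bounds its dimension; as all of `R` separates `V`, some `n - r` elements of `R` already do.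
  let V := pointDerivations ψ fun j ↦ h.norm (f j)
  let ev : (R →ₗ[k] K) →ₗ[K] (Fin (n - r) → K) :=
    LinearMap.pi fun l ↦ LinearMap.applyₗ (G l) ∘ₗ (LinearMap.liftBaseChangeEquiv K).toLinearMap
  have hev : ∀ D ∈ V, ev D = 0 → D = 0 := by
    intro D hD hD0
    have hder : IsPointDerivation ψ' (LinearMap.liftBaseChange K D) := by
      intro x y
      induction x with
      | zero => simp
      | add x x' hx hx' => simp only [map_add, add_mul, hx, hx', mul_add]; ring
      | tmul x a =>
        induction y with
        | zero => simp
        | add x x' hx hx' => simp only [map_add, add_mul, hx, hx', mul_add]; ring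
        | tmul y b =>
          simp only [Algebra.TensorProduct.tmul_mul_tmul, LinearMap.liftBaseChange_tmul, hD.1,
            hmap, ψ', extendScalars_tmul, smul_eq_mul]
          ring
    have h0 := hG _ hder (fun j ↦ by
      rw [hnorm, LinearMap.liftBaseChange_tmul, hD.2 j, smul_zero]) (fun l ↦ congrFun hD0 l)
    ext x
    simpa using LinearMap.congr_fun h0 (1 ⊗ₜ x)
  have hinj : Function.Injective (ev ∘ₗ V.subtype) := by
    rw [injective_iff_map_eq_zero]
    exact fun D hD ↦ Subtype.ext (hev D D.2 hD)
  have : FiniteDimensional K V := Module.Finite.of_injective _ hinj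
  obtain ⟨g, hg⟩ := exists_separating_subfamily
    (fun x : R ↦ (LinearMap.applyₗ' K x : (R →ₗ[k] K) →ₗ[K] K)) (n - r) V
    (by simpa using LinearMap.finrank_le_finrank_of_injective hinj)
    (fun D _ hD ↦ LinearMap.ext hD)
  exact ⟨g, fun D hD h1 h2 ↦ hg D ⟨hD, h1⟩ h2⟩

end IsSymmetricTensorPower

end BaseChange

/-! ### Unramifiedness by derivations; étale coordinates in the affine case. -/

section Unramified

open TensorProduct

/-- By Nakayama the differentials of the local ring vanish if their fibre does. A linear functional
on the fibre, followed by the embedding of the residue field in `K`, would be a `K`-valued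
derivation. -/
theorem isUnramifiedAt_of_derivation {T R K : Type*} [CommRing T] [CommRing R] [Field K]
    [Algebra T R] [Algebra R K] [Algebra T K] [IsScalarTower T R K] [Algebra.FiniteType T R]
    (y : Ideal R) [y.IsPrime] (hy : y = RingHom.ker (algebraMap R K))
    (hD : ∀ D : Derivation T R K, D = 0) : Algebra.IsUnramifiedAt T y := by
  let O := Localization.AtPrime y
  have hunit (s : y.primeCompl) : IsUnit (algebraMap R K s) :=
    isUnit_iff_ne_zero.mpr fun h ↦ s.2 (hy ▸ h)
  let χ : O →+* K := IsLocalization.lift (M := y.primeCompl) hunit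
  have hχ (r : R) : χ (algebraMap R O r) = algebraMap R K r := IsLocalization.lift_eq _ r
  let := χ.toAlgebra
  have : IsScalarTower R O K := IsScalarTower.of_algebraMap_eq fun r ↦ (hχ r).symm
  have : IsScalarTower T O K := IsScalarTower.of_algebraMap_eq fun t ↦ by
    rw [IsScalarTower.algebraMap_apply T R O, ← IsScalarTower.algebraMap_apply R O K,
      ← IsScalarTower.algebraMap_apply T R K]
  have : IsLocalHom χ := by
    constructor
    intro a ha
    obtain ⟨r, s, rfl⟩ := IsLocalization.exists_mk'_eq y.primeCompl a
    by_contra h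
    have h1 : r ∈ y := by
      by_contra h1
      exact h ((IsLocalization.AtPrime.isUnit_mk'_iff O y r s).mpr h1)
    rw [hy] at h1
    have h2 : χ (IsLocalization.mk' O r s) * χ (algebraMap R O s) = χ (algebraMap R O r) := by
      rw [← map_mul, IsLocalization.mk'_spec]
    rw [hχ r, show algebraMap R K r = 0 from h1] at h2
    rcases mul_eq_zero.mp h2 with h2 | h2
    · exact ha.ne_zero h2
    · rw [hχ] at h2
      exact (hunit s).ne_zero h2
  let ψ : IsLocalRing.ResidueField O →+* K := IsLocalRing.ResidueField.lift χ
  have : Algebra.EssFiniteType T O := Algebra.EssFiniteType.comp T R O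
  rw [Algebra.IsUnramifiedAt, Algebra.formallyUnramified_iff,
    ← IsLocalRing.subsingleton_tensorProduct (R := O)]
  refine subsingleton_of_forall_eq 0 fun w ↦ ?_
  rw [← Module.forall_dual_apply_eq_zero_iff (IsLocalRing.ResidueField O)]
  intro φ
  let ℓ : Ω[O⁄T] →ₗ[O] K :=
    { toFun := fun x ↦ ψ (φ (1 ⊗ₜ x))
      map_add' := fun x y ↦ by rw [TensorProduct.tmul_add, map_add, map_add]
      map_smul' := fun c x ↦ by
        rw [TensorProduct.tmul_smul, ← algebraMap_smul (IsLocalRing.ResidueField O), map_smul,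
          smul_eq_mul, map_mul]
        rfl }
  have h0 : (ℓ.compDer (KaehlerDifferential.D T O)).compAlgebraMap R = 0 := hD _
  have h1 : ℓ.compDer (KaehlerDifferential.D T O) = 0 := by
    ext a
    obtain ⟨r, s, rfl⟩ := IsLocalization.exists_mk'_eq y.primeCompl a
    have e := congrArg (ℓ.compDer (KaehlerDifferential.D T O)) (IsLocalization.mk'_spec O r s)
    have h2 (r : R) : ℓ.compDer (KaehlerDifferential.D T O) (algebraMap R O r) = 0 :=
      DFunLike.congr_fun h0 r
    rw [Derivation.leibniz, h2, h2, smul_zero, zero_add, Algebra.smul_def,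
      ← IsScalarTower.algebraMap_apply] at e
    exact (mul_eq_zero.mp e).resolve_left (hunit s).ne_zero
  have h2 : ℓ = 0 := Derivation.liftKaehlerDifferential_unique ℓ 0 (by rw [h1]; ext; simp)
  have h3 (x) : φ (1 ⊗ₜ x) = 0 := by
    have : ψ (φ (1 ⊗ₜ x)) = 0 := LinearMap.congr_fun h2 x
    exact (map_eq_zero ψ).mp this
  induction w with
  | zero => simp
  | add a b ha hb => rw [map_add, ha, hb, add_zero]
  | tmul c x =>
    rw [← mul_one c, ← smul_eq_mul, ← TensorProduct.smul_tmul', map_smul, h3, smul_zero]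

/-- By incomparability, chains of primes stay strict when contracted along an integral extension. -/
theorem height_le_height_under_of_isIntegral {R C : Type*} [CommRing R] [CommRing C] [Algebra R C]
    [Algebra.IsIntegral R C] (M : Ideal C) [M.IsPrime] : M.height ≤ (M.under R).height := by
  have hmono : StrictMono (PrimeSpectrum.comap (algebraMap R C)) := fun p q h ↦
    Ideal.IsIntegral.comap_lt_comap h
  rw [PrimeSpectrum.height_eq_orderHeight ⟨M, inferInstance⟩,
    PrimeSpectrum.height_eq_orderHeight ⟨M.under R, inferInstance⟩]
  exact Order.height_le_height_apply_of_strictMono _ hmono ⟨M, inferInstance⟩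

end Unramified

section Coordinates

open TensorProduct

variable {k K A C R : Type u} [Field k] [Field K] [Algebra k K] [CommRing A] [Algebra k A]
  [CommRing C] [Algebra k C] [CommRing R] [Algebra k R] [Algebra R C] [IsScalarTower k R C] {n : ℕ}
  [MulSemiringAction (Equiv.Perm (Fin n)) C] {ι : Fin n → (A →ₐ[k] C)}

namespace IsSymmetricTensorPower

theorem isIntegral (h : IsSymmetricTensorPower R ι) : Algebra.IsIntegral R C := by
  have : Algebra.IsInvariant R C (Equiv.Perm (Fin n)) := ⟨h.exists_of_invariant⟩
  have : SMulCommClass (Equiv.Perm (Fin n)) R C := ⟨fun σ r c ↦ by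
    rw [Algebra.smul_def, Algebra.smul_def, smul_mul', h.smul_algebraMap]⟩
  exact Algebra.IsInvariant.isIntegral R C (Equiv.Perm (Fin n))

/-- The Artin–Tate lemma: `C` is of finite type over `k` and finite over `R`. -/
theorem finiteType (h : IsSymmetricTensorPower R ι) [Algebra.FiniteType k C] :
    Algebra.FiniteType k R := by
  have := h.isIntegral
  have : Algebra.FiniteType R C := Algebra.FiniteType.of_restrictScalars_finiteType k R C
  have : Module.Finite R C := Algebra.IsIntegral.finite
  exact ⟨fg_of_fg_of_fg k R C Algebra.FiniteType.out Module.Finite.fg_top h.injective⟩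

/-- Étale coordinates on the symmetric power of a curve at a geometric point, among which are the
norms of equations of rational points. -/
theorem exists_etale_coordinates [IsAlgClosed K] [Algebra.FiniteType k C]
    (h : IsSymmetricTensorPower R ι) (ψ : C →ₐ[k] K)
    (hz : ∀ i, ∃ τ : K ⊗[k] A, extendScalars (ψ.comp (ι i)) τ = 0 ∧
      ∀ a, extendScalars (ψ.comp (ι i)) a = 0 →
        ∃ g c, extendScalars (ψ.comp (ι i)) g ≠ 0 ∧ g * a = τ * c)
    (hψ : n ≤ (RingHom.ker ψ).height)
    {r : ℕ} (f : Fin r → A) (s : Fin r → (A →ₐ[k] k)) (idx : Fin r → Fin n)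
    (hs : Function.Injective s) (hf : ∀ j a, s j a = 0 ↔ f j ∣ a)
    (hidx : ∀ j a, ψ (ι (idx j) a) = algebraMap k K (s j a)) :
    ∃ (t : Fin n → R) (J : Fin r → Fin n) (ρ : R), Function.Injective J ∧
      (∀ j, t (J j) = h.norm (f j)) ∧ ψ (algebraMap R C ρ) ≠ 0 ∧
      ((algebraMap R (Localization.Away ρ)).comp
        (MvPolynomial.aeval (R := k) t : MvPolynomial (Fin n) k →ₐ[k] R).toRingHom).Etale := by
  have := h.isIntegral
  have := h.finiteType
  have hr : r ≤ n := by
    have : Function.Injective idx := fun a b e ↦ hs <| AlgHom.ext fun x ↦ by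
      apply (algebraMap k K).injective
      rw [← hidx, ← hidx, e]
    simpa using Fintype.card_le_of_injective idx this
  obtain ⟨G, hG⟩ := h.exists_detecting_geometric ψ hz f s idx hs hf hidx
  let e : Fin r ⊕ Fin (n - r) ≃ Fin n := finSumFinEquiv.trans (finCongr (by lia))
  let t (l : Fin n) : R := Sum.elim (fun j ↦ h.norm (f j)) G (e.symm l)
  refine ⟨t, fun j ↦ e (.inl j), ?_⟩
  let T := MvPolynomial (Fin n) k
  let at' : T →ₐ[k] R := MvPolynomial.aeval t
  let := at'.toAlgebra
  let χ : R →+* K := ψ.toRingHom.comp (algebraMap R C)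
  let := χ.toAlgebra
  let : Algebra T K := (χ.comp at'.toRingHom).toAlgebra
  have : IsScalarTower T R K := IsScalarTower.of_algebraMap_eq fun _ ↦ rfl
  have : IsScalarTower k T R := IsScalarTower.of_algebraMap_eq fun c ↦ (at'.commutes c).symm
  have : IsScalarTower k R K := IsScalarTower.of_algebraMap_eq fun c ↦ by
    change _ = ψ (algebraMap R C (algebraMap k R c))
    rw [← IsScalarTower.algebraMap_apply, ψ.commutes]
  have : IsScalarTower k T K := IsScalarTower.of_algebraMap_eq fun c ↦ by
    rw [IsScalarTower.algebraMap_apply T R K, ← IsScalarTower.algebraMap_apply k T R,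
      ← IsScalarTower.algebraMap_apply k R K]
  have : Algebra.FiniteType T R := Algebra.FiniteType.of_restrictScalars_finiteType k T R
  let y : Ideal R := RingHom.ker χ
  have hyp : y.IsPrime := RingHom.ker_isPrime χ
  -- A derivation over `T` kills the images `t l` of the variables, which are precisely the norms
  -- and the detecting functions.
  have hun : Algebra.IsUnramifiedAt T y := by
    refine isUnramifiedAt_of_derivation (K := K) y rfl fun D ↦ ?_
    have hD0 (l) : D (t l) = 0 := by
      have := D.map_algebraMap (MvPolynomial.X l)
      rwa [show algebraMap T R (MvPolynomial.X l) = t l from MvPolynomial.aeval_X t l] at this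
    have := hG (D.toLinearMap.restrictScalars k) (fun x y ↦ D.leibniz x y)
      (fun j ↦ by simpa [t] using hD0 (e (.inl j))) (fun l ↦ by simpa [t] using hD0 (e (.inr l)))
    ext x
    exact LinearMap.congr_fun this x
  have hMp : (RingHom.ker ψ).IsPrime := RingHom.ker_isPrime ψ
  have hy : n ≤ y.height :=
    hψ.trans (height_le_height_under_of_isIntegral (R := R) (RingHom.ker ψ))
  obtain ⟨ρ, hρ, het⟩ := exists_etale_of_isUnramifiedAt (k := k) (R := R) (n := n) y hy
  refine ⟨ρ, e.injective.comp Sum.inl_injective, fun j ↦ by simp [t], hρ, ?_⟩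
  convert! RingHom.etale_algebraMap.mpr het

end IsSymmetricTensorPower

end Coordinates

/-! ### Local rings of smooth algebras at algebraic points. -/

section SmoothAlgebra

open IsLocalRing

variable {k A K : Type u} [Field k] [CommRing A] [Algebra k A] [Field K] [Algebra k K]

theorem ker_isMaximal_of_isAlgebraic {A : Type*} [CommRing A] [Algebra k A]
    [Algebra.IsAlgebraic k K] (χ : A →ₐ[k] K) : (RingHom.ker χ).IsMaximal := by
  have hf : IsField χ.range := Subalgebra.isField_of_algebraic _
  apply Ideal.Quotient.maximal_of_isField
  exact MulEquiv.isField hf (Ideal.quotientKerEquivRange χ).toMulEquiv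

/-- A standard smooth algebra is étale over affine space, and an algebraic point lies over a maximal
ideal there, whose height is `n`. -/
theorem isRegularLocalRing_of_isStandardSmooth [Algebra.IsAlgebraic k K] {n : ℕ}
    [Algebra.IsStandardSmoothOfRelativeDimension n k A] (χ : A →ₐ[k] K)
    (q : Ideal A) [q.IsPrime] (hq : q = RingHom.ker χ) :
    IsRegularLocalRing (Localization.AtPrime q) ∧
      ringKrullDim (Localization.AtPrime q) = n := by
  obtain ⟨g, hg⟩ := Algebra.IsStandardSmoothOfRelativeDimension.exists_etale_mvPolynomial n k A
  let := g.toRingHom.toAlgebra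
  have : Algebra.Etale (MvPolynomial (Fin n) k) A := hg
  refine ⟨(isRegular_of_etale_mvPolynomial (k := k) (n := n) q _).1, ?_⟩
  have hB : IsNoetherianRing A := Algebra.FiniteType.isNoetherianRing (MvPolynomial (Fin n) k) A
  set p := q.under (MvPolynomial (Fin n) k) with hp
  let := Localization.AtPrime.algebraOfLiesOver p q
  have hpm : p.IsMaximal := by
    have h : p = RingHom.ker (χ.comp g) := by
      ext x
      change g x ∈ q ↔ χ (g x) = 0
      rw [hq]; rfl
    rw [h]
    exact ker_isMaximal_of_isAlgebraic _
  rw [ringKrullDim_eq_of_map_maximalIdeal (map_maximalIdeal_of_etale p q),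
    IsLocalization.AtPrime.ringKrullDim_eq_height p, height_eq_of_isMaximal_mvPolynomial]
  rfl

/-- An algebra over a field which is locally standard smooth of relative dimension `n` is regular
of dimension `n` at algebraic points. -/
theorem isRegularLocalRing_of_locally_isStandardSmooth [Algebra.IsAlgebraic k K] {n : ℕ}
    (hA : RingHom.Locally (RingHom.IsStandardSmoothOfRelativeDimension n) (algebraMap k A))
    (χ : A →ₐ[k] K) (q : Ideal A) [q.IsPrime] (hq : q = RingHom.ker χ) :
    IsRegularLocalRing (Localization.AtPrime q) ∧
      ringKrullDim (Localization.AtPrime q) = n := by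
  obtain ⟨s, hs, h⟩ := hA
  obtain ⟨t, hts, htq⟩ : ∃ t ∈ s, t ∉ q := by
    by_contra! hc
    exact ‹q.IsPrime›.ne_top (top_le_iff.mp (hs ▸ Ideal.span_le.mpr hc))
  have ht : χ t ≠ 0 := by rw [hq] at htq; exact htq
  have hB := h t hts
  rw [← IsScalarTower.algebraMap_eq, RingHom.isStandardSmoothOfRelativeDimension_algebraMap] at hB
  let B := Localization.Away t
  let χ' : B →ₐ[k] K := IsLocalization.liftAlgHom (M := Submonoid.powers t) (f := χ) (by
    rintro ⟨-, m, rfl⟩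
    simpa using ht.isUnit.pow m)
  have hχ' (a : A) : χ' (algebraMap A B a) = χ a := IsLocalization.lift_eq _ a
  let q' : Ideal B := RingHom.ker χ'
  have hq'p : q'.IsPrime := RingHom.ker_isPrime χ'
  obtain ⟨h1, h2⟩ := isRegularLocalRing_of_isStandardSmooth (n := n) χ' q' rfl
  have h3 : IsLocalization.AtPrime (Localization.AtPrime q') (q'.comap (algebraMap A B)) :=
    IsLocalization.isLocalization_atPrime_localization_atPrime (Submonoid.powers t) q'
  have h4 : q'.comap (algebraMap A B) = q := by
    ext a
    change χ' (algebraMap A B a) = 0 ↔ _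
    rw [hχ', hq]; rfl
  have h5 : IsLocalization.AtPrime (Localization.AtPrime q') q := by
    convert! h3
    exact h4.symm
  let e : Localization.AtPrime q' ≃ₐ[A] Localization.AtPrime q :=
    IsLocalization.algEquiv q.primeCompl _ _
  exact ⟨IsRegularLocalRing.of_ringEquiv e.toRingEquiv,
    by rw [← ringKrullDim_eq_of_ringEquiv e.toRingEquiv, h2]⟩

/-- The maximal ideal of a regular local ring of dimension one is principal. -/
theorem exists_maximalIdeal_eq_span_singleton {R : Type*} [CommRing R] [IsRegularLocalRing R]
    (h : ringKrullDim R = (1 : ℕ)) : ∃ π : R, maximalIdeal R = Ideal.span {π} := by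
  have h1 := IsRegularLocalRing.spanFinrank_maximalIdeal (R := R)
  rw [h, Nat.cast_inj] at h1
  have hfg : (maximalIdeal R).FG := IsNoetherian.noetherian _
  rw [← Submodule.FG.generators_ncard hfg, Set.ncard_eq_one] at h1
  obtain ⟨π, hπ⟩ := h1
  exact ⟨π, by rw [← (maximalIdeal R).span_generators, hπ]⟩

theorem exists_local_generator_of_maximalIdeal_eq {A : Type*} [CommRing A] (q : Ideal A) [q.IsPrime]
    {π : Localization.AtPrime q} (h : maximalIdeal (Localization.AtPrime q) = Ideal.span {π}) :
    ∃ τ ∈ q, ∀ a ∈ q, ∃ g c, g ∉ q ∧ g * a = τ * c := by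
  obtain ⟨τ, s, rfl⟩ := IsLocalization.exists_mk'_eq q.primeCompl π
  have hτ : τ ∈ q := by
    rw [← IsLocalization.AtPrime.to_map_mem_maximal_iff (Localization.AtPrime q) q, h,
      Ideal.mem_span_singleton]
    exact ⟨algebraMap A _ s, (IsLocalization.mk'_spec _ _ _).symm⟩
  refine ⟨τ, hτ, fun a ha ↦ ?_⟩
  rw [← IsLocalization.AtPrime.to_map_mem_maximal_iff (Localization.AtPrime q) q, h,
    Ideal.mem_span_singleton] at ha
  obtain ⟨b, hb⟩ := ha
  obtain ⟨c, s', rfl⟩ := IsLocalization.exists_mk'_eq q.primeCompl b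
  rw [← IsLocalization.mk'_mul, IsLocalization.eq_mk'_iff_mul_eq, ← map_mul] at hb
  obtain ⟨u, hu⟩ := (IsLocalization.eq_iff_exists q.primeCompl _).mp hb
  refine ⟨u * (s * s'), u * c, fun hm ↦ ?_, ?_⟩
  · exact (u * (s * s')).2 hm
  · rw [Submonoid.coe_mul] at hu
    linear_combination hu

/-- On a smooth curve the ideal of an algebraic point is locally principal. -/
theorem exists_local_generator [Algebra.IsAlgebraic k K]
    (hA : RingHom.Locally (RingHom.IsStandardSmoothOfRelativeDimension 1) (algebraMap k A))
    (χ : A →ₐ[k] K) : ∃ τ, χ τ = 0 ∧ ∀ a, χ a = 0 → ∃ g c, χ g ≠ 0 ∧ g * a = τ * c := by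
  have : (RingHom.ker χ).IsPrime := RingHom.ker_isPrime χ
  obtain ⟨_, h2⟩ := isRegularLocalRing_of_locally_isStandardSmooth hA χ _ rfl
  obtain ⟨π, hπ⟩ := exists_maximalIdeal_eq_span_singleton h2
  exact exists_local_generator_of_maximalIdeal_eq _ hπ

open TensorProduct in
theorem locally_isStandardSmooth_baseChange {n : ℕ} (hA : RingHom.Locally
    (RingHom.IsStandardSmoothOfRelativeDimension n) (algebraMap k A)) :
    RingHom.Locally (RingHom.IsStandardSmoothOfRelativeDimension n)
      (algebraMap K (K ⊗[k] A)) := by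
  let : Algebra A (K ⊗[k] A) := Algebra.TensorProduct.rightAlgebra
  exact (RingHom.locally_isStableUnderBaseChange
    RingHom.isStandardSmoothOfRelativeDimension_respectsIso
    (RingHom.isStandardSmoothOfRelativeDimension_isStableUnderBaseChange n)) k A K
      (K ⊗[k] A) hA

theorem height_ker_of_locally_isStandardSmooth [Algebra.IsAlgebraic k K] {n : ℕ}
    (hA : RingHom.Locally (RingHom.IsStandardSmoothOfRelativeDimension n) (algebraMap k A))
    (χ : A →ₐ[k] K) : (RingHom.ker χ).height = n := by
  have : (RingHom.ker χ).IsPrime := RingHom.ker_isPrime χ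
  have h := (isRegularLocalRing_of_locally_isStandardSmooth hA χ _ rfl).2
  rw [IsLocalization.AtPrime.ringKrullDim_eq_height (RingHom.ker χ)] at h
  exact_mod_cast h

end SmoothAlgebra

/-! ### Fibre powers and their affine description. -/

section FibrePowerLemmas

variable {B X X' P P' : Scheme.{u}} {n : ℕ} {f : X ⟶ B} {p : P ⟶ B} {π : Fin n → (P ⟶ X)}

namespace IsFibrePower

/-- The morphism to a fibre power with given components. -/
noncomputable def lift (h : IsFibrePower f p π) {T : Scheme.{u}} (t : T ⟶ B)
    (φ : Fin n → (T ⟶ X)) (hφ : ∀ i, φ i ≫ f = t) : T ⟶ P :=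
  (h.existsUnique_lift T t φ hφ).choose

section

variable (h : IsFibrePower f p π) {T : Scheme.{u}} (t : T ⟶ B)
    (φ : Fin n → (T ⟶ X)) (hφ : ∀ i, φ i ≫ f = t)

@[simp]
theorem lift_base : h.lift t φ hφ ≫ p = t := (h.existsUnique_lift T t φ hφ).choose_spec.1.1

@[simp]
theorem lift_proj (i : Fin n) : h.lift t φ hφ ≫ π i = φ i :=
  (h.existsUnique_lift T t φ hφ).choose_spec.1.2 i

include h in
theorem hom_ext {a b : T ⟶ P} (hp : a ≫ p = b ≫ p) (hπ : ∀ i, a ≫ π i = b ≫ π i) : a = b :=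
  (h.existsUnique_lift T (b ≫ p) (fun i ↦ b ≫ π i) fun i ↦ by rw [Category.assoc, h.w]).unique
    ⟨hp, hπ⟩ ⟨rfl, fun _ ↦ rfl⟩

end

theorem exists_iso {p' : P' ⟶ B} {π' : Fin n → (P' ⟶ X)} (h : IsFibrePower f p π)
    (h' : IsFibrePower f p' π') :
    ∃ e : P ≅ P', e.hom ≫ p' = p ∧ ∀ i, e.hom ≫ π' i = π i :=
  ⟨{  hom := h'.lift p π h.w
      inv := h.lift p' π' h'.w
      hom_inv_id := h.hom_ext (by simp) (by simp)
      inv_hom_id := h'.hom_ext (by simp) (by simp) }, by simp, by simp⟩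

end IsFibrePower

theorem IsFibrePower.of_iso (h : IsFibrePower f p π) (e : P' ≅ P) :
    IsFibrePower f (e.hom ≫ p) fun i ↦ e.hom ≫ π i := by
  refine ⟨fun i ↦ by rw [Category.assoc, h.w], fun T t φ hφ ↦
    ⟨h.lift t φ hφ ≫ e.inv, by simp, fun g hg ↦ ?_⟩⟩
  rw [Iso.eq_comp_inv]
  exact h.hom_ext (by simpa using hg.1) fun i ↦ by simpa using hg.2 i

/-- The open subset `U ×_B ⋯ ×_B U` of a fibre power. -/
def powerOpen (π : Fin n → (P ⟶ X)) (U : X.Opens) : P.Opens :=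
  ⟨⋂ i, π i ⁻¹' U, isOpen_iInter_of_finite fun i ↦ U.2.preimage (π i).continuous⟩

theorem mem_powerOpen {U : X.Opens} {x : P} : x ∈ powerOpen π U ↔ ∀ i, π i x ∈ U :=
  Set.mem_iInter

theorem powerOpen_le (U : X.Opens) (i : Fin n) : powerOpen π U ≤ π i ⁻¹ᵁ U :=
  fun _ hx ↦ mem_powerOpen.mp hx i

theorem range_powerOpen_subset (u : X' ⟶ X) [IsOpenImmersion u] {U : X.Opens}
    (hu : u.opensRange = U) (i : Fin n) :
    Set.range ((powerOpen π U).ι ≫ π i) ⊆ Set.range u := by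
  subst hu
  rintro _ ⟨x, rfl⟩
  exact mem_powerOpen.mp x.2 i

theorem IsFibrePower.restrict (h : IsFibrePower f p π) (u : X' ⟶ X) [IsOpenImmersion u]
    {U : X.Opens} (hu : u.opensRange = U) :
    IsFibrePower (u ≫ f) ((powerOpen π U).ι ≫ p)
      fun i ↦ IsOpenImmersion.lift u ((powerOpen π U).ι ≫ π i)
        (range_powerOpen_subset u hu i) := by
  subst hu
  refine ⟨fun i ↦ by simp [h.w], fun T t φ hφ ↦ ?_⟩
  have hφ' (i) : (φ i ≫ u) ≫ f = t := by simpa using hφ i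
  have hr : Set.range (h.lift t (fun i ↦ φ i ≫ u) hφ') ⊆
      Set.range (powerOpen π u.opensRange).ι := by
    rw [Scheme.Opens.range_ι]
    rintro _ ⟨x, rfl⟩
    refine mem_powerOpen.mpr fun i ↦ ?_
    rw [← Scheme.Hom.comp_apply, h.lift_proj]
    exact ⟨φ i x, rfl⟩
  refine ⟨IsOpenImmersion.lift (powerOpen π u.opensRange).ι _ hr, ⟨?_, fun i ↦ ?_⟩, ?_⟩
  · rw [IsOpenImmersion.lift_fac_assoc, h.lift_base]
  · rw [← cancel_mono u]
    simp
  · rintro g ⟨hg1, hg2⟩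
    rw [← cancel_mono (powerOpen π u.opensRange).ι, IsOpenImmersion.lift_fac]
    refine h.hom_ext (by simpa using hg1) fun i ↦ ?_
    rw [h.lift_proj, ← hg2]
    simp

/-- Fibre powers exist, and are smooth if the given morphism is. -/
theorem exists_isFibrePower_smooth (f : X ⟶ B) [SmoothOfRelativeDimension 1 f] (n : ℕ) :
    ∃ (P : Scheme.{u}) (p : P ⟶ B) (π : Fin n → (P ⟶ X)), IsFibrePower f p π ∧
      SmoothOfRelativeDimension n p := by
  induction n with
  | zero =>
    refine ⟨B, 𝟙 B, Fin.elim0, ⟨fun i ↦ i.elim0, fun T t φ _ ↦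
      ⟨t, ⟨by simp, fun i ↦ i.elim0⟩, fun g hg ↦ by simpa using hg.1⟩⟩, inferInstance⟩
  | succ n ih =>
    obtain ⟨P, p, π, h, hp⟩ := ih
    -- The projection to the new factor is a base change of the `n`-fold power; composing it with
    -- `f` adds one to the relative dimension.
    have h1 : SmoothOfRelativeDimension n (Limits.pullback.snd p f) :=
      (smoothOfRelativeDimension_isStableUnderBaseChange n).of_isPullback
        (IsPullback.of_hasPullback p f) hp
    refine ⟨Limits.pullback p f, Limits.pullback.snd p f ≫ f,
      Fin.cons (Limits.pullback.snd p f) fun i ↦ Limits.pullback.fst p f ≫ π i,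
      ⟨fun i ↦ ?_, fun T t φ hφ ↦ ?_⟩, inferInstance⟩
    · cases i using Fin.cases with
      | zero => rfl
      | succ i => simp [h.w, Limits.pullback.condition]
    · refine ⟨Limits.pullback.lift (h.lift t (fun i ↦ φ i.succ) fun i ↦ hφ _) (φ 0)
        (by rw [h.lift_base, hφ]), ⟨?_, fun i ↦ ?_⟩, ?_⟩
      · rw [Limits.pullback.lift_snd_assoc, hφ]
      · cases i using Fin.cases with
        | zero => exact Limits.pullback.lift_snd _ _ _
        | succ i =>
          rw [Fin.cons_succ, Limits.pullback.lift_fst_assoc, h.lift_proj]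
      · rintro g ⟨hg1, hg2⟩
        apply Limits.pullback.hom_ext
        · rw [Limits.pullback.lift_fst]
          refine h.hom_ext ?_ fun i ↦ ?_
          · rw [h.lift_base, Category.assoc, Limits.pullback.condition, hg1]
          · simpa using hg2 i.succ
        · rw [Limits.pullback.lift_snd]; exact hg2 0

theorem IsFibrePower.smoothOfRelativeDimension [SmoothOfRelativeDimension 1 f]
    (h : IsFibrePower f p π) : SmoothOfRelativeDimension n p := by
  obtain ⟨P', p', π', h', hp'⟩ := exists_isFibrePower_smooth f n
  obtain ⟨e, he, -⟩ := h.exists_iso h'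
  rw [← he]
  have := smoothOfRelativeDimension_comp (n := 0) (m := n) e.hom p'
  rwa [zero_add] at this

end FibrePowerLemmas

section Sections

variable {k : Type u} [CommRing k] {X P : Scheme.{u}}

theorem le_preimage_top {Y : Scheme.{u}} (f : X ⟶ Y) (U : X.Opens) : U ≤ f ⁻¹ᵁ ⊤ := le_top

/-- The structure morphism of the ring of sections of a `k`-scheme. -/
noncomputable def structureHom (f : X ⟶ Spec (.of k)) (U : X.Opens) :
    CommRingCat.of k ⟶ Γ(X, U) :=
  (Scheme.ΓSpecIso (.of k)).inv ≫ f.appLE ⊤ U (le_preimage_top f U)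

/-- The ring of sections of a `k`-scheme as a `k`-algebra. -/
noncomputable abbrev sectionsAlgebra (f : X ⟶ Spec (.of k)) (U : X.Opens) : Algebra k Γ(X, U) :=
  (structureHom f U).hom.toAlgebra

theorem toSpecΓ_structureHom (f : X ⟶ Spec (.of k)) (U : X.Opens) :
    U.toSpecΓ ≫ Spec.map (structureHom f U) = U.ι ≫ f := by
  rw [structureHom, Spec.map_comp, Scheme.Opens.toSpecΓ_SpecMap_appLE_assoc,
    Scheme.Opens.toSpecΓ_top, Category.assoc, toSpecΓ_SpecMap_ΓSpecIso_inv, Category.comp_id,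
    Scheme.Hom.resLE_comp_ι]

theorem fromSpec_comp_eq (f : X ⟶ Spec (.of k)) {U : X.Opens} (hU : IsAffineOpen U) :
    hU.fromSpec ≫ f = Spec.map (structureHom f U) := by
  rw [← cancel_epi hU.isoSpec.hom, hU.isoSpec_hom_fromSpec_assoc, IsAffineOpen.isoSpec_hom,
    toSpecΓ_structureHom]

theorem structureHom_appLE {f : X ⟶ Spec (.of k)} {p : P ⟶ Spec (.of k)} (g : P ⟶ X)
    (h : g ≫ f = p) (U : X.Opens) (V : P.Opens) (e : V ≤ g ⁻¹ᵁ U) :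
    structureHom f U ≫ g.appLE U V e = structureHom p V := by
  subst h
  rw [structureHom, structureHom, Category.assoc, Scheme.Hom.appLE_comp_appLE]

/-- Restriction of sections along a morphism of `k`-schemes. -/
noncomputable def sectionsMap {f : X ⟶ Spec (.of k)} {p : P ⟶ Spec (.of k)} (g : P ⟶ X)
    (h : g ≫ f = p) (U : X.Opens) (V : P.Opens) (e : V ≤ g ⁻¹ᵁ U) :
    letI := sectionsAlgebra f U
    letI := sectionsAlgebra p V
    Γ(X, U) →ₐ[k] Γ(P, V) :=
  letI := sectionsAlgebra f U
  letI := sectionsAlgebra p V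
  { (g.appLE U V e).hom with
    commutes' := fun c ↦ congr($(structureHom_appLE g h U V e) c) }

end Sections

section AffinePower

variable {k A C : Type u} [CommRing k] [CommRing A] [Algebra k A] [CommRing C] [Algebra k C]
  {n : ℕ}

/-- `C` with the homomorphisms `ι i` is the `n`-fold coproduct of `A` in the category of
commutative `k`-algebras. -/
def IsCoproductPower (ι : Fin n → (A →ₐ[k] C)) : Prop :=
  ∀ (D : Type u) [CommRing D] [Algebra k D] (φ : Fin n → (A →ₐ[k] D)),
    ∃! g : C →ₐ[k] D, ∀ i, g.comp (ι i) = φ i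

theorem isCoproductPower_singleAlgHom (k A : Type u) [CommRing k] [CommRing A] [Algebra k A]
    (n : ℕ) : IsCoproductPower fun i : Fin n ↦
      (PiTensorProduct.singleAlgHom (R := k) (A := fun _ : Fin n ↦ A) i) := by
  intro D _ _ φ
  have hex : ∃ g : PiTensorProduct k (fun _ : Fin n ↦ A) →ₐ[k] D,
      ∀ x, g (PiTensorProduct.tprod k x) = ∏ i, φ i (x i) := by
    refine ⟨PiTensorProduct.liftAlgHom (MultilinearMap.mkPiAlgebra k (Fin n) D |>.compLinearMap
      fun i ↦ (φ i).toLinearMap) ?_ ?_, fun x ↦ ?_⟩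
    · simp
    · intro x y
      simp [Finset.prod_mul_distrib]
    · simp [PiTensorProduct.liftAlgHom]
  obtain ⟨g, hg⟩ := hex
  have h1 (i : Fin n) : g.comp (PiTensorProduct.singleAlgHom i) = φ i := by
    ext a
    simp only [AlgHom.comp_apply, PiTensorProduct.singleAlgHom_apply, hg]
    rw [Finset.prod_eq_single i]
    · simp
    · intro j _ hj
      simp [hj]
    · simp
  refine ⟨g, h1, fun g' hg' ↦ PiTensorProduct.algHom_ext fun i ↦ ?_⟩
  rw [h1, hg']

/-- Coproducts are unique, so `C` is the tensor power of `A`, with its basis of pure tensors of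
basis vectors. -/
theorem IsCoproductPower.exists_basis {k : Type u} [Field k] [Algebra k A] [Algebra k C]
    {ι : Fin n → (A →ₐ[k] C)} (h : IsCoproductPower ι) :
    ∃ (B : Type u) (b : Module.Basis B k A) (bC : Module.Basis (Fin n → B) k C),
      ∀ w, bC w = ∏ i, ι i (b (w i)) := by
  classical
  let b := Module.Basis.ofVectorSpace k A
  have h' := isCoproductPower_singleAlgHom k A n
  obtain ⟨g, hg, -⟩ := h _ fun i : Fin n ↦
      (PiTensorProduct.singleAlgHom (R := k) (A := fun _ : Fin n ↦ A) i)
  obtain ⟨g', hg', -⟩ := h' _ ι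
  have h1 : g'.comp g = AlgHom.id k C := (h _ ι).unique
    (fun i ↦ by rw [AlgHom.comp_assoc, hg, hg']) fun i ↦ AlgHom.id_comp _
  have h2 : g.comp g' = AlgHom.id k _ := (h' _ _).unique
    (fun i ↦ by rw [AlgHom.comp_assoc, hg', hg]) fun i ↦ AlgHom.id_comp _
  let e := AlgEquiv.ofAlgHom g' g h1 h2
  refine ⟨_, b, (Basis.piTensorProduct fun _ : Fin n ↦ b).map e.toLinearEquiv, fun w ↦ ?_⟩
  rw [Module.Basis.map_apply, Basis.piTensorProduct_apply]
  have : PiTensorProduct.tprod k (fun i ↦ b (w i)) = ∏ i, PiTensorProduct.singleAlgHom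
      (R := k) (A := fun _ : Fin n ↦ A) i (b (w i)) := by
    simp only [PiTensorProduct.singleAlgHom_apply]
    rw [← PiTensorProduct.tprod_prod]
    congr 1
    funext i
    rw [Finset.prod_apply, Finset.prod_eq_single i] <;> simp +contextual [Pi.mulSingle_eq_of_ne']
  rw [this]
  change g' _ = _
  rw [map_prod]
  exact Finset.prod_congr rfl fun i _ ↦ DFunLike.congr_fun (hg' i) _

/-- A morphism to an affine scheme is given by a ring homomorphism. -/
theorem exists_toSpecΓ_comp {T : Scheme.{u}} {R : Type u} [CommRing R] (g : T ⟶ Spec (.of R)) :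
    ∃ r : R →+* Γ(T, ⊤), g = T.toSpecΓ ≫ Spec.map (CommRingCat.ofHom r) := by
  refine ⟨((Scheme.ΓSpecIso (.of R)).inv ≫ g.appTop).hom, ?_⟩
  rw [CommRingCat.ofHom_hom, Spec.map_comp, ← Scheme.toSpecΓ_naturality_assoc,
    toSpecΓ_SpecMap_ΓSpecIso_inv, Category.comp_id]

theorem toSpecΓ_comp_injective {T : Scheme.{u}} {R : Type u} [CommRing R] {r r' : R →+* Γ(T, ⊤)}
    (h : T.toSpecΓ ≫ Spec.map (CommRingCat.ofHom r) = T.toSpecΓ ≫ Spec.map (CommRingCat.ofHom r')) :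
    r = r' := by
  have key (r : R →+* Γ(T, ⊤)) : (Scheme.ΓSpecIso (.of R)).inv ≫
      (T.toSpecΓ ≫ Spec.map (CommRingCat.ofHom r)).appTop = CommRingCat.ofHom r := by
    rw [Scheme.Hom.comp_appTop, Scheme.toSpecΓ_appTop, Scheme.ΓSpecIso_naturality,
      Iso.inv_hom_id_assoc]
  have := key r
  rw [h, key] at this
  exact congr(($this).hom).symm

theorem IsCoproductPower.isFibrePower {ι : Fin n → (A →ₐ[k] C)} (h : IsCoproductPower ι) :
    IsFibrePower (Spec.map (CommRingCat.ofHom (algebraMap k A)))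
      (Spec.map (CommRingCat.ofHom (algebraMap k C)))
      fun i ↦ Spec.map (CommRingCat.ofHom (ι i).toRingHom) := by
  refine ⟨fun i ↦ ?_, fun T t φ hφ ↦ ?_⟩
  · rw [← Spec.map_comp, ← CommRingCat.ofHom_comp]
    congr 2
    exact (ι i).comp_algebraMap
  obtain ⟨t, rfl⟩ := exists_toSpecΓ_comp t
  choose r hr using fun i ↦ exists_toSpecΓ_comp (φ i)
  obtain rfl : φ = _ := funext hr
  let := t.toAlgebra
  let r' (i) : A →ₐ[k] Γ(T, ⊤) :=
    { r i with
      commutes' := fun c ↦ by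
        have := hφ i
        rw [Category.assoc, ← Spec.map_comp, ← CommRingCat.ofHom_comp] at this
        exact congr($(toSpecΓ_comp_injective this) c) }
  obtain ⟨g, hg, hgu⟩ := h Γ(T, ⊤) r'
  refine ⟨T.toSpecΓ ≫ Spec.map (CommRingCat.ofHom g.toRingHom), ⟨?_, fun i ↦ ?_⟩, ?_⟩
  · rw [Category.assoc, ← Spec.map_comp, ← CommRingCat.ofHom_comp]
    congr 3
    exact g.comp_algebraMap
  · rw [Category.assoc, ← Spec.map_comp, ← CommRingCat.ofHom_comp]
    congr 3
    exact congr(($(hg i)).toRingHom)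
  · rintro y ⟨hy1, hy2⟩
    obtain ⟨s, rfl⟩ := exists_toSpecΓ_comp y
    simp only [Category.assoc, ← Spec.map_comp, ← CommRingCat.ofHom_comp] at hy1 hy2
    let s' : C →ₐ[k] Γ(T, ⊤) :=
      { s with commutes' := fun c ↦ congr($(toSpecΓ_comp_injective hy1) c) }
    have : s' = g := hgu _ fun i ↦ by
      ext a
      exact congr($(toSpecΓ_comp_injective (hy2 i)) a)
    rw [← this]

theorem isCoproductPower_of_isFibrePower {ι : Fin n → (A →ₐ[k] C)}
    (h : IsFibrePower (Spec.map (CommRingCat.ofHom (algebraMap k A)))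
      (Spec.map (CommRingCat.ofHom (algebraMap k C)))
      fun i ↦ Spec.map (CommRingCat.ofHom (ι i).toRingHom)) : IsCoproductPower ι := by
  intro D _ _ φ
  obtain ⟨g, ⟨hg1, hg2⟩, hgu⟩ := h.existsUnique_lift (Spec (.of D))
    (Spec.map (CommRingCat.ofHom (algebraMap k D)))
    (fun i ↦ Spec.map (CommRingCat.ofHom (φ i).toRingHom)) fun i ↦ by
      rw [← Spec.map_comp, ← CommRingCat.ofHom_comp]
      congr 2
      exact (φ i).comp_algebraMap
  obtain ⟨s, rfl⟩ := Spec.map_surjective g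
  simp only [← Spec.map_comp] at hg1 hg2
  let s' : C →ₐ[k] D :=
    { s.hom with commutes' := fun c ↦ congr($(Spec.map_injective hg1) c) }
  refine ⟨s', fun i ↦ ?_, fun s'' hs'' ↦ ?_⟩
  · ext a
    exact congr($(Spec.map_injective (hg2 i)) a)
  · have := hgu (Spec.map (CommRingCat.ofHom s''.toRingHom)) ⟨?_, fun i ↦ ?_⟩
    · ext c
      exact congr($(Spec.map_injective this) c)
    · rw [← Spec.map_comp, ← CommRingCat.ofHom_comp]
      congr 2
      exact s''.comp_algebraMap
    · rw [← Spec.map_comp, ← CommRingCat.ofHom_comp]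
      congr 2
      exact congr(($(hs'' i)).toRingHom)

variable {X P : Scheme.{u}} {f : X ⟶ Spec (.of k)} {p : P ⟶ Spec (.of k)} {π : Fin n → (P ⟶ X)}

/-- By uniqueness of fibre powers, `U^n` is isomorphic to the spectrum of a tensor power. -/
theorem IsFibrePower.isAffineOpen_powerOpen (h : IsFibrePower f p π) {U : X.Opens}
    (hU : IsAffineOpen U) : IsAffineOpen (powerOpen π U) := by
  let := sectionsAlgebra f U
  have h1 := h.restrict hU.fromSpec hU.opensRange_fromSpec
  rw [fromSpec_comp_eq] at h1
  have h2 := (isCoproductPower_singleAlgHom k Γ(X, U) n).isFibrePower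
  obtain ⟨e, -⟩ := h1.exists_iso h2
  exact IsAffine.of_isIso e.hom

theorem IsFibrePower.isCoproductPower (h : IsFibrePower f p π) {U : X.Opens}
    (hU : IsAffineOpen U) :
    letI := sectionsAlgebra f U
    letI := sectionsAlgebra p (powerOpen π U)
    IsCoproductPower fun i ↦ sectionsMap (π i) (h.w i) U (powerOpen π U) (powerOpen_le U i) := by
  let := sectionsAlgebra f U
  let := sectionsAlgebra p (powerOpen π U)
  have hP := h.isAffineOpen_powerOpen hU
  apply isCoproductPower_of_isFibrePower
  have h1 := (h.restrict hU.fromSpec hU.opensRange_fromSpec).of_iso hP.isoSpec.symm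
  convert! h1 using 2
  · exact (fromSpec_comp_eq f hU).symm
  · rw [Iso.symm_hom, hP.isoSpec_inv_ι_assoc, fromSpec_comp_eq]
    rfl
  · rw [← cancel_mono hU.fromSpec, Category.assoc, IsOpenImmersion.lift_fac, Iso.symm_hom,
      hP.isoSpec_inv_ι_assoc]
    exact hU.SpecMap_appLE_fromSpec _ hP (powerOpen_le U _)

end AffinePower

/-! ### Points of affine open subsets as prime ideals. -/

section Affine

variable {X Y : Scheme.{u}}

theorem mem_basicOpen_iff_notMem_primeIdealOf {U : X.Opens} (hU : IsAffineOpen U) (a : Γ(X, U))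
    (x : U) : x.1 ∈ X.basicOpen a ↔ a ∉ (hU.primeIdealOf x).asIdeal := by
  have := congr(hU.primeIdealOf x ∈ $(hU.fromSpec_preimage_basicOpen a))
  have h : hU.fromSpec (hU.primeIdealOf x) ∈ X.basicOpen a ↔
    hU.primeIdealOf x ∈ PrimeSpectrum.basicOpen a := iff_of_eq this
  rwa [hU.fromSpec_primeIdealOf] at h

theorem eq_of_forall_mem_basicOpen_iff {U : X.Opens}
    (hU : IsAffineOpen U) {x y : X} (hx : x ∈ U) (hy : y ∈ U)
    (h : ∀ a : Γ(X, U), x ∈ X.basicOpen a ↔ y ∈ X.basicOpen a) : x = y := by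
  have h1 : hU.primeIdealOf ⟨x, hx⟩ = hU.primeIdealOf ⟨y, hy⟩ :=
    PrimeSpectrum.ext <| Ideal.ext fun a ↦ not_iff_not.mp <| by
      rw [← mem_basicOpen_iff_notMem_primeIdealOf hU a ⟨x, hx⟩,
        ← mem_basicOpen_iff_notMem_primeIdealOf hU a ⟨y, hy⟩, h]
  exact (hU.fromSpec_primeIdealOf ⟨x, hx⟩).symm.trans
    ((congrArg _ h1).trans (hU.fromSpec_primeIdealOf ⟨y, hy⟩))

theorem exists_primeIdealOf_eq {U : X.Opens} (hU : IsAffineOpen U) (Q : Ideal Γ(X, U))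
    [hQ : Q.IsPrime] : ∃ x : U, (hU.primeIdealOf x).asIdeal = Q := by
  obtain ⟨x, hx⟩ := (ConcreteCategory.bijective_of_isIso hU.isoSpec.hom.base).2 ⟨Q, hQ⟩
  exact ⟨x, congr(($hx).asIdeal)⟩

/-- A function on an affine open subset which vanishes off a given open subset, and at none of
finitely many given points of it. -/
theorem exists_basicOpen_le_forall_mem {α : Type*} [Finite α] {U W : X.Opens} (hU : IsAffineOpen U)
    (x : α → X) (hxU : ∀ i, x i ∈ U) (hxW : ∀ i, x i ∈ W) :
    ∃ a : Γ(X, U), X.basicOpen a ≤ W ∧ ∀ i, x i ∈ X.basicOpen a := by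
  let Z : Set (PrimeSpectrum Γ(X, U)) := (hU.fromSpec ⁻¹ᵁ W : Set (Spec Γ(X, U)))ᶜ
  have hZ : IsClosed Z := (hU.fromSpec ⁻¹ᵁ W).2.isClosed_compl
  obtain ⟨a, haJ, ha⟩ := exists_mem_forall_notMem (J := PrimeSpectrum.vanishingIdeal Z)
    (fun i ↦ (hU.primeIdealOf ⟨x i, hxU i⟩).asIdeal) (fun i ↦ inferInstance) (fun i ↦ by
      by_contra! h
      have h1 : hU.primeIdealOf ⟨x i, hxU i⟩ ∈
          PrimeSpectrum.zeroLocus (PrimeSpectrum.vanishingIdeal Z : Set Γ(X, U)) := h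
      rw [PrimeSpectrum.zeroLocus_vanishingIdeal_eq_closure, hZ.closure_eq] at h1
      refine h1 ?_
      change hU.fromSpec _ ∈ W
      rw [hU.fromSpec_primeIdealOf]
      exact hxW i)
  refine ⟨a, fun z hz ↦ ?_, fun i ↦ (mem_basicOpen_iff_notMem_primeIdealOf hU a _).mpr (ha i)⟩
  have hzU : z ∈ U := X.basicOpen_le a hz
  by_contra hzW
  refine (mem_basicOpen_iff_notMem_primeIdealOf hU a ⟨z, hzU⟩).mp hz
    ((PrimeSpectrum.mem_vanishingIdeal _ _).mp haJ _ ?_)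
  change ¬ hU.fromSpec _ ∈ W
  rwa [hU.fromSpec_primeIdealOf]

theorem isAffineOpen_basicOpen_of_le {U V : X.Opens} (hV : IsAffineOpen V) (a : Γ(X, U))
    (hVU : V ≤ U) (h : X.basicOpen a ≤ V) : IsAffineOpen (X.basicOpen a) := by
  have := hV.basicOpen (X.presheaf.map (homOfLE hVU).op a)
  rwa [Scheme.basicOpen_res, inf_eq_right.mpr h] at this

end Affine

/-! ### Topology of the quotient by the symmetric group. -/

section Quotient

variable {B X P Y : Scheme.{u}} {n : ℕ} {f : X ⟶ B} {p : P ⟶ B} {π : Fin n → (P ⟶ X)}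
  {q : P ⟶ Y}

/-- The automorphism of a fibre power that permutes the coordinates. -/
noncomputable def IsFibrePower.perm (hP : IsFibrePower f p π) (σ : Equiv.Perm (Fin n)) : P ⟶ P :=
  hP.lift p (fun i ↦ π (σ i)) fun i ↦ hP.w (σ i)

theorem IsFibrePower.perm_proj (hP : IsFibrePower f p π) (σ : Equiv.Perm (Fin n)) (i : Fin n) :
    hP.perm σ ≫ π i = π (σ i) := hP.lift_proj _ _ _ i

theorem IsFibrePower.permutesBy_perm (hP : IsFibrePower f p π) (σ : Equiv.Perm (Fin n)) :
    PermutesBy p π σ (hP.perm σ) := ⟨hP.lift_base _ _ _, hP.perm_proj σ⟩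

theorem IsFibrePower.eq_perm (hP : IsFibrePower f p π) {σ : Equiv.Perm (Fin n)} {h : P ⟶ P}
    (H : PermutesBy p π σ h) : h = hP.perm σ :=
  hP.hom_ext (by rw [H.1, (hP.permutesBy_perm σ).1]) fun i ↦ by rw [H.2, hP.perm_proj]

theorem IsFibrePower.perm_one (hP : IsFibrePower f p π) : hP.perm 1 = 𝟙 P :=
  (hP.eq_perm ⟨Category.id_comp p, fun _ ↦ Category.id_comp _⟩).symm

theorem IsFibrePower.perm_mul (hP : IsFibrePower f p π) (σ τ : Equiv.Perm (Fin n)) :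
    hP.perm (σ * τ) = hP.perm σ ≫ hP.perm τ :=
  (hP.eq_perm ⟨by rw [Category.assoc, (hP.permutesBy_perm τ).1, (hP.permutesBy_perm σ).1],
    fun i ↦ by rw [Category.assoc, hP.perm_proj, hP.perm_proj]; rfl⟩).symm

theorem appLE_eq_id {h : P ⟶ P} (e : h = 𝟙 P) (W : P.Opens) (hW : W ≤ h ⁻¹ᵁ W) :
    h.appLE W W hW = 𝟙 _ := by
  subst e
  rw [Scheme.Hom.appLE, Scheme.Hom.id_app]
  exact (Category.id_comp _).trans (P.presheaf.map_id _)

namespace IsSymmetricQuotient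

variable (hP : IsFibrePower f p π) (hq : IsSymmetricQuotient p π q)

include hq in
theorem perm_comp (σ : Equiv.Perm (Fin n)) : hP.perm σ ≫ q = q :=
  hq.invariant σ _ (hP.permutesBy_perm σ)

/-- The action of the symmetric group on the sections of the fibre power over an open subset of
the quotient. -/
noncomputable abbrev action (V : Y.Opens) :
    MulSemiringAction (Equiv.Perm (Fin n)) Γ(P, q ⁻¹ᵁ V) where
  smul σ a := ((hP.perm σ).appLE (q ⁻¹ᵁ V) (q ⁻¹ᵁ V)
    (le_preimage_of_comp_eq (perm_comp hP hq σ) V)).hom a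
  one_smul a := by
    change ((hP.perm 1).appLE _ _ _).hom a = a
    rw [appLE_eq_id hP.perm_one]
    rfl
  mul_smul σ τ a := by
    change ((hP.perm (σ * τ)).appLE _ _ _).hom a = ((hP.perm σ).appLE _ _ _).hom
      (((hP.perm τ).appLE _ _ _).hom a)
    rw [← CommRingCat.comp_apply, Scheme.Hom.appLE_comp_appLE]
    simp only [hP.perm_mul]
  smul_zero σ := map_zero _
  smul_add σ := map_add _
  smul_one σ := map_one _
  smul_mul σ := map_mul _

theorem smul_def (V : Y.Opens) (σ : Equiv.Perm (Fin n)) (a : Γ(P, q ⁻¹ᵁ V)) :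
    letI := action hP hq V
    σ • a = ((hP.perm σ).appLE (q ⁻¹ᵁ V) (q ⁻¹ᵁ V)
      (le_preimage_of_comp_eq (perm_comp hP hq σ) V)).hom a := rfl

theorem smul_app (V : Y.Opens) (σ : Equiv.Perm (Fin n)) (b : Γ(Y, V)) :
    letI := action hP hq V
    σ • (q.app V).hom b = (q.app V).hom b := by
  rw [smul_def, ← CommRingCat.comp_apply, q.app_eq_appLE, Scheme.Hom.appLE_comp_appLE]
  simp only [perm_comp hP hq]

theorem exists_of_smul_eq (V : Y.Opens) (a : Γ(P, q ⁻¹ᵁ V)) (ha : letI := action hP hq V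
    ∀ σ : Equiv.Perm (Fin n), σ • a = a) : ∃ b, (q.app V).hom b = a :=
  hq.exists_of_invariant V a fun σ h H ↦ by
    obtain rfl := hP.eq_perm H
    exact ha σ

theorem isInvariant (V : Y.Opens) :
    letI := action hP hq V
    letI := (q.app V).hom.toAlgebra
    Algebra.IsInvariant Γ(Y, V) Γ(P, q ⁻¹ᵁ V) (Equiv.Perm (Fin n)) :=
  letI := action hP hq V
  letI := (q.app V).hom.toAlgebra
  ⟨fun a ha ↦ exists_of_smul_eq hP hq V a ha⟩

theorem sMulCommClass (V : Y.Opens) :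
    letI := action hP hq V
    letI := (q.app V).hom.toAlgebra
    SMulCommClass (Equiv.Perm (Fin n)) Γ(Y, V) Γ(P, q ⁻¹ᵁ V) :=
  letI := action hP hq V
  letI := (q.app V).hom.toAlgebra
  ⟨fun σ b a ↦ by
    rw [Algebra.smul_def, Algebra.smul_def, smul_mul']
    congr 1
    exact smul_app hP hq V σ b⟩

include hP hq in
theorem isIntegral_app (V : Y.Opens) : (q.app V).hom.IsIntegral := by
  let := action hP hq V
  let := (q.app V).hom.toAlgebra
  have := isInvariant hP hq V
  have := sMulCommClass hP hq V
  exact (Algebra.IsInvariant.isIntegral Γ(Y, V) Γ(P, q ⁻¹ᵁ V) (Equiv.Perm (Fin n))).1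

include hP hq in
theorem isIntegralHom : IsIntegralHom q :=
  { hq.isAffineHom with isIntegral_app := fun V _ ↦ isIntegral_app hP hq V }

include hP hq in
-- The quotient map is integral, hence closed. Over the complement of its image the sections inject
-- into the zero ring, so that complement is empty.
theorem surjective : Function.Surjective q := by
  have := isIntegralHom hP hq
  by_contra hne
  let V : Y.Opens := ⟨(Set.range q)ᶜ, q.isClosedMap.isClosed_range.isOpen_compl⟩
  have hV : q ⁻¹ᵁ V = ⊥ := by
    ext x
    simp [V]
  have h1 : (1 : Γ(Y, V)) = 0 := by
    apply hq.injective_app V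
    have : Subsingleton Γ(P, q ⁻¹ᵁ V) := by rw [hV]; infer_instance
    exact Subsingleton.elim _ _
  have h2 : V = ⊥ := by
    rw [← Scheme.basicOpen_zero Y V, ← h1, Scheme.basicOpen_of_isUnit _ isUnit_one]
  refine hne fun y ↦ ?_
  by_contra hy
  have : y ∈ V := hy
  rw [h2] at this
  exact this

include hq in
-- Fibres are orbits: over an affine open subset this is the transitivity of a finite group on the
-- primes above a prime of the ring of invariants.
theorem exists_perm_eq {x x' : P} (h : q x = q x') : ∃ σ, hP.perm σ x = x' := by
  obtain ⟨V, hV, hxV, -⟩ := exists_isAffineOpen_mem_and_subset (X := Y) (x := q x) (U := ⊤) trivial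
  have := hq.isAffineHom
  have hW : IsAffineOpen (q ⁻¹ᵁ V) := hV.preimage q
  have hx'V : q x' ∈ V := h ▸ hxV
  let := action hP hq V
  let := (q.app V).hom.toAlgebra
  have := isInvariant hP hq V
  have := sMulCommClass hP hq V
  obtain ⟨σ, hσ⟩ := Algebra.IsInvariant.exists_smul_of_under_eq Γ(Y, V) Γ(P, q ⁻¹ᵁ V)
    (Equiv.Perm (Fin n)) (hW.primeIdealOf ⟨x, hxV⟩).asIdeal (hW.primeIdealOf ⟨x', hx'V⟩).asIdeal (by
      have h1 := IsAffineOpen.comap_primeIdealOf_appLE V hV (q ⁻¹ᵁ V) hW le_rfl hxV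
      have h2 := IsAffineOpen.comap_primeIdealOf_appLE V hV (q ⁻¹ᵁ V) hW le_rfl hx'V
      have h3 := h1.trans ((congrArg hV.primeIdealOf (Subtype.ext h)).trans h2.symm)
      rw [q.appLE_eq_app] at h3
      exact congr(($h3).asIdeal))
  -- The action on prime ideals is by image, that of a morphism on points by inverse image, hence
  -- the inverse.
  refine ⟨σ⁻¹, ?_⟩
  have hmem : hP.perm σ⁻¹ x ∈ q ⁻¹ᵁ V :=
    le_preimage_of_comp_eq (perm_comp hP hq σ⁻¹) V hxV
  have h4 := IsAffineOpen.comap_primeIdealOf_appLE (f := hP.perm σ⁻¹) (q ⁻¹ᵁ V) hW (q ⁻¹ᵁ V) hW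
    (le_preimage_of_comp_eq (perm_comp hP hq σ⁻¹) V) hxV
  have h5 : hW.primeIdealOf ⟨hP.perm σ⁻¹ x, hmem⟩ = hW.primeIdealOf ⟨x', hx'V⟩ := by
    rw [← h4]
    ext a
    rw [hσ, Ideal.mem_pointwise_smul_iff_inv_smul_mem]
    rfl
  have := congrArg hW.fromSpec h5
  rwa [hW.fromSpec_primeIdealOf, hW.fromSpec_primeIdealOf] at this

include hP hq in
-- Fibres are orbits, and having some coordinate in `S` is a condition stable under permutation.
theorem mem_symmetricLocus_iff (S : Set X) (x : P) :
    q x ∈ symmetricLocus π q S ↔ ∃ i, π i x ∈ S := by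
  rw [symmetricLocus, Set.mem_compl_iff, Set.mem_image]
  constructor
  · intro h
    by_contra! h'
    exact h ⟨x, Set.mem_iInter.mpr h', rfl⟩
  · rintro ⟨i, hi⟩ ⟨x', hx', he⟩
    obtain ⟨σ, rfl⟩ := exists_perm_eq hP hq he
    rw [← Scheme.Hom.comp_apply, hP.perm_proj] at hi
    exact Set.mem_iInter.mp hx' _ hi

include hP hq in
theorem exists_preimage_eq_powerOpen (U : X.Opens) : ∃ V : Y.Opens, q ⁻¹ᵁ V = powerOpen π U := by
  have := isIntegralHom hP hq
  refine ⟨⟨(q '' (powerOpen π U : Set P)ᶜ)ᶜ,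
    (q.isClosedMap _ (powerOpen π U).2.isClosed_compl).isOpen_compl⟩, ?_⟩
  ext x
  change ¬ (∃ x', x' ∉ powerOpen π U ∧ q x' = q x) ↔ x ∈ powerOpen π U
  constructor
  · intro h
    by_contra h'
    exact h ⟨x, h', rfl⟩
  · rintro hx ⟨x', hx', he⟩
    obtain ⟨σ, rfl⟩ := exists_perm_eq hP hq he
    rw [mem_powerOpen] at hx hx'
    refine hx' fun i ↦ ?_
    have := hx (σ.symm i)
    rwa [← Scheme.Hom.comp_apply, hP.perm_proj, Equiv.apply_symm_apply] at this

include hP hq in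
/-- The quotient of an affine scheme is affine. -/
theorem isAffineOpen_of_preimage {W : Y.Opens} (hW : IsAffineOpen (q ⁻¹ᵁ W)) : IsAffineOpen W := by
  let := action hP hq W
  let := (q.app W).hom.toAlgebra
  have hint : Algebra.IsIntegral Γ(Y, W) Γ(P, q ⁻¹ᵁ W) := ⟨isIntegral_app hP hq W⟩
  have hmem (r : Γ(Y, W)) (x : P) : q x ∈ Y.basicOpen r ↔ x ∈ P.basicOpen ((q.app W).hom r) := by
    rw [← Scheme.Hom.mem_preimage, Scheme.preimage_basicOpen]
  have key (x : P) (hx : q x ∈ W) :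
      ∃ r : Γ(Y, W), q x ∈ Y.basicOpen r ∧ IsAffineOpen (Y.basicOpen r) := by
    obtain ⟨V, hV, hxV, hVW⟩ := exists_isAffineOpen_mem_and_subset hx
    have hσx (σ) : q (hP.perm σ x) = q x := by
      rw [← Scheme.Hom.comp_apply, perm_comp hP hq]
    -- Choose `a` nonzero on the whole orbit of `x` and vanishing off the preimage of `V`. The
    -- product of its conjugates descends to `r`, whose basic open subset contains `q x` and lies in
    -- `V`, hence is affine.
    obtain ⟨a, haV, hax⟩ := exists_basicOpen_le_forall_mem (W := q ⁻¹ᵁ V) hW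
      (fun σ : Equiv.Perm (Fin n) ↦ hP.perm σ x) (fun σ ↦ by
        rw [Scheme.Hom.mem_preimage, hσx]; exact hx) (fun σ ↦ by
        rw [Scheme.Hom.mem_preimage, hσx]; exact hxV)
    obtain ⟨r, hr⟩ := exists_of_smul_eq hP hq W (∏ σ : Equiv.Perm (Fin n), σ • a) fun τ ↦ by
      rw [Finset.smul_prod']
      simp only [smul_smul]
      exact Fintype.prod_equiv (Equiv.mulLeft τ) _ _ fun _ ↦ rfl
    have hrx (z : P) (hz : z ∈ q ⁻¹ᵁ W) : z ∈ P.basicOpen ((q.app W).hom r) ↔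
        ∀ σ, hP.perm σ z ∈ P.basicOpen a := by
      have hσz (σ) : hP.perm σ z ∈ q ⁻¹ᵁ W := le_preimage_of_comp_eq (perm_comp hP hq σ) W hz
      rw [hr, mem_basicOpen_iff_notMem_primeIdealOf hW _ ⟨z, hz⟩, Ideal.IsPrime.prod_mem_iff]
      simp only [Finset.mem_univ, true_and, not_exists]
      refine forall_congr' fun σ ↦ ?_
      rw [mem_basicOpen_iff_notMem_primeIdealOf hW _ ⟨hP.perm σ z, hσz σ⟩,
        ← IsAffineOpen.comap_primeIdealOf_appLE (f := hP.perm σ) (q ⁻¹ᵁ W) hW (q ⁻¹ᵁ W) hW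
          (le_preimage_of_comp_eq (perm_comp hP hq σ) W) hz]
      rfl
    refine ⟨r, (hmem r x).mpr ((hrx x hx).mpr hax),
      isAffineOpen_basicOpen_of_le hV r hVW fun y hy ↦ ?_⟩
    obtain ⟨z, rfl⟩ := surjective hP hq y
    have hz := (hrx z (Y.basicOpen_le r hy)).mp ((hmem r z).mp hy) 1
    rw [hP.perm_one] at hz
    exact haV hz
  -- Affineness follows once such `r` generate the unit ideal. Otherwise they lie in a maximal
  -- ideal, which by integrality lies under a prime of the affine preimage, that is, under a point
  -- `x` excluded by `key`.
  refine isAffineOpen_of_isAffineOpen_basicOpen W {r | IsAffineOpen (Y.basicOpen r)} ?_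
    fun r hr ↦ hr
  by_contra hne
  obtain ⟨m, hm, hle⟩ := Ideal.exists_le_maximal _ hne
  obtain ⟨Q, hQ, hQm⟩ := Ideal.exists_ideal_over_maximal_of_isIntegral (S := Γ(P, q ⁻¹ᵁ W)) m (by
    change RingHom.ker (q.app W).hom ≤ m
    rw [(RingHom.injective_iff_ker_eq_bot _).mp (hq.injective_app W)]
    exact bot_le)
  have hQp := hQ.isPrime
  obtain ⟨⟨x, hx⟩, hxQ⟩ := exists_primeIdealOf_eq hW Q
  obtain ⟨r, hr, hra⟩ := key x hx
  have h1 : r ∈ m := hle (Ideal.subset_span hra)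
  rw [← hQm] at h1
  rw [hmem, mem_basicOpen_iff_notMem_primeIdealOf hW _ ⟨x, hx⟩, hxQ] at hr
  exact hr h1

end IsSymmetricQuotient

end Quotient

/-! ### Field-valued points and étale charts. -/

section Evaluation

variable {k L : Type u} [Field k] [Field L] [Algebra k L] {X : Scheme.{u}}
  {f : X ⟶ Spec (.of k)}

/-- Evaluation of functions at a point with values in a field. -/
theorem exists_evaluation (ψ : Spec (.of L) ⟶ X)
    (hψ : ψ ≫ f = Spec.map (CommRingCat.ofHom (algebraMap k L))) (U : X.Opens) (t : Spec (.of L))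
    (ht : ψ t ∈ U) : letI := sectionsAlgebra f U
    ∃ χ : Γ(X, U) →ₐ[k] L, ∀ a, ψ t ∈ X.basicOpen a ↔ χ a ≠ 0 := by
  let := sectionsAlgebra f U
  have hU : (⊤ : (Spec (.of L)).Opens) ≤ ψ ⁻¹ᵁ U := fun t' _ ↦ by
    rw [Subsingleton.elim (α := PrimeSpectrum L) t' t]
    exact ht
  let φ : Γ(X, U) ⟶ .of L := ψ.appLE U ⊤ hU ≫ (Scheme.ΓSpecIso (.of L)).hom
  have hφ : structureHom f U ≫ φ = CommRingCat.ofHom (algebraMap k L) := by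
    rw [← Category.assoc, structureHom_appLE ψ hψ, structureHom, Category.assoc, Iso.inv_comp_eq]
    have := Scheme.ΓSpecIso_naturality (CommRingCat.ofHom (algebraMap k L))
    rw [← this]
    congr 1
  refine ⟨{ φ.hom with commutes' := fun c ↦ congr($hφ c) }, fun a ↦ ?_⟩
  change _ ↔ φ a ≠ 0
  have h1 := congr(t ∈ $(Scheme.basicOpen_appLE ψ ⊤ U hU a))
  have h2 : t ∈ (Spec (.of L)).basicOpen (ψ.appLE U ⊤ hU a) ↔ ψ t ∈ X.basicOpen a :=
    (iff_of_eq h1).trans ⟨fun h ↦ h.2, fun h ↦ ⟨trivial, h⟩⟩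
  rw [← h2]
  by_cases h0 : ψ.appLE U ⊤ hU a = 0
  · rw [h0, Scheme.basicOpen_zero]
    have h3 : φ a = 0 := by
      change (Scheme.ΓSpecIso (.of L)).hom (ψ.appLE U ⊤ hU a) = 0
      rw [h0, map_zero]
    exact iff_of_false id (not_not.mpr h3)
  · have h3 : φ a ≠ 0 := fun h ↦ h0 <| by
      have := congr((Scheme.ΓSpecIso (.of L)).inv $h)
      simpa [φ] using this
    have h4 : IsUnit (ψ.appLE U ⊤ hU a) := by
      have := (isUnit_iff_ne_zero.mpr h3).map (Scheme.ΓSpecIso (.of L)).inv.hom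
      simpa [φ] using this
    rw [Scheme.basicOpen_of_isUnit _ h4]
    exact iff_of_true trivial h3

end Evaluation

section Chart

variable {k : Type u} [Field k] {X P Y : Scheme.{u}} {n : ℕ} {f : X ⟶ Spec (.of k)}
  {p : P ⟶ Spec (.of k)} {π : Fin n → (P ⟶ X)} {q : P ⟶ Y} {g : Y ⟶ Spec (.of k)}

theorem locally_isStandardSmooth_structureHom [SmoothOfRelativeDimension n f] {U : X.Opens}
    (hU : IsAffineOpen U) :
    RingHom.Locally (RingHom.IsStandardSmoothOfRelativeDimension n) (structureHom f U).hom := by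
  have h : SmoothOfRelativeDimension (0 + n) (hU.fromSpec ≫ f) := inferInstance
  rw [zero_add, fromSpec_comp_eq] at h
  exact (HasRingHomProperty.Spec_iff (P := @SmoothOfRelativeDimension n)).mp h

theorem finiteType_structureHom [LocallyOfFiniteType f] {U : X.Opens}
    (hU : IsAffineOpen U) : (structureHom f U).hom.FiniteType := by
  have h : LocallyOfFiniteType (hU.fromSpec ≫ f) := inferInstance
  rw [fromSpec_comp_eq] at h
  exact (HasRingHomProperty.Spec_iff (P := @LocallyOfFiniteType)).mp h

theorem IsFibrePower.isCoproductPower_of_eq (h : IsFibrePower f p π) {U : X.Opens}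
    (hU : IsAffineOpen U) {V : P.Opens} (hV : V = powerOpen π U) :
    letI := sectionsAlgebra f U
    letI := sectionsAlgebra p V
    IsCoproductPower fun i ↦ sectionsMap (π i) (h.w i) U V (hV ▸ powerOpen_le U i) := by
  subst hV
  exact h.isCoproductPower hU

theorem IsSymmetricPower.isScalarTower (h : IsSymmetricPower f p π q g) (V : Y.Opens) :
    letI := sectionsAlgebra g V
    letI := sectionsAlgebra p (q ⁻¹ᵁ V)
    letI := (q.app V).hom.toAlgebra
    IsScalarTower k Γ(Y, V) Γ(P, q ⁻¹ᵁ V) := by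
  let := sectionsAlgebra g V
  let := sectionsAlgebra p (q ⁻¹ᵁ V)
  let := (q.app V).hom.toAlgebra
  refine IsScalarTower.of_algebraMap_eq fun c ↦ ?_
  have := structureHom_appLE q h.w V (q ⁻¹ᵁ V) le_rfl
  rw [q.appLE_eq_app] at this
  exact congr($this c).symm

theorem IsSymmetricPower.isSymmetricTensorPower (h : IsSymmetricPower f p π q g) {U : X.Opens}
    (hU : IsAffineOpen U) {V : Y.Opens} (hV : q ⁻¹ᵁ V = powerOpen π U) :
    letI := sectionsAlgebra f U
    letI := sectionsAlgebra p (q ⁻¹ᵁ V)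
    letI := (q.app V).hom.toAlgebra
    letI := IsSymmetricQuotient.action h.isFibrePower h.isSymmetricQuotient V
    IsSymmetricTensorPower (K := k) Γ(Y, V)
      fun i ↦ sectionsMap (π i) (h.isFibrePower.w i) U (q ⁻¹ᵁ V) (hV ▸ powerOpen_le U i) := by
  let := sectionsAlgebra f U
  let := sectionsAlgebra p (q ⁻¹ᵁ V)
  let := (q.app V).hom.toAlgebra
  let := IsSymmetricQuotient.action h.isFibrePower h.isSymmetricQuotient V
  refine ⟨fun σ i a ↦ ?_, fun σ r ↦ ?_, h.isSymmetricQuotient.injective_app V,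
    fun c hc ↦ ?_, (h.isFibrePower.isCoproductPower_of_eq hU hV).exists_basis⟩
  · change ((h.isFibrePower.perm σ).appLE _ _ _).hom (((π i).appLE _ _ _).hom a) =
      ((π (σ i)).appLE _ _ _).hom a
    rw [← CommRingCat.comp_apply, Scheme.Hom.appLE_comp_appLE]
    simp only [h.isFibrePower.perm_proj]
  · exact IsSymmetricQuotient.smul_app h.isFibrePower h.isSymmetricQuotient V σ r
  · exact IsSymmetricQuotient.exists_of_smul_eq h.isFibrePower h.isSymmetricQuotient V c hc

theorem toSpecΓ_SpecMap_mem_zeroLocus_iff {W : Y.Opens} {T : Type u} [CommRing T]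
    (φ : T →+* Γ(Y, W)) (w : W) (t : T) :
    (W.toSpecΓ ≫ Spec.map (CommRingCat.ofHom φ)) w ∈
      (PrimeSpectrum.zeroLocus {t} : Set (Spec (.of T))) ↔ w.1 ∉ Y.basicOpen (φ t) := by
  have h1 := congr(w ∈ $(Scheme.Opens.toSpecΓ_preimage_basicOpen W (φ t)))
  have h2 : W.toSpecΓ w ∈ PrimeSpectrum.basicOpen (φ t) ↔ w.1 ∈ Y.basicOpen (φ t) :=
    iff_of_eq h1
  have h3 : ((W.toSpecΓ ≫ Spec.map (CommRingCat.ofHom φ)) w ∈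
      (PrimeSpectrum.zeroLocus {t} : Set (Spec (.of T)))) ↔
      φ t ∈ (W.toSpecΓ w).asIdeal := Set.singleton_subset_iff
  exact h3.trans ((not_congr h2).symm.trans not_not).symm

/-- Étale coordinates on the symmetric power near the image of a geometric point. -/
theorem IsSymmetricPower.exists_etale_chart [SmoothOfRelativeDimension 1 f]
    (h : IsSymmetricPower f p π q g) {K : Type u} [Field K] [Algebra k K] [IsAlgClosed K]
    [Algebra.IsAlgebraic k K] (ψ : Spec (.of K) ⟶ P)
    (hψ : ψ ≫ p = Spec.map (CommRingCat.ofHom (algebraMap k K))) (x : P) (t₀ : Spec (.of K))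
    (hx : ψ t₀ = x) {U : X.Opens} (hU : IsAffineOpen U) (hxU : ∀ i, π i x ∈ U) (S : Set X) {r : ℕ}
    (z : Fin r → X) (hz : Function.Injective z) (idx : Fin r → Fin n)
    (hidx : ∀ j, π (idx j) x = z j)
    (hk : letI := sectionsAlgebra f U
      ∀ j, ∃ s : Γ(X, U) →ₐ[k] k, ∀ a, z j ∈ X.basicOpen a ↔ s a ≠ 0)
    (e : Fin r → Γ(X, U)) (he : ∀ j a, z j ∉ X.basicOpen a ↔ e j ∣ a)
    (hS : ∀ x ∈ U, x ∈ S ↔ ∃ j, x ∉ X.basicOpen (e j)) :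
    ∃ (W : Y.Opens) (c : (W : Scheme.{u}) ⟶ affineSpace k n) (J : Finset (Fin n)), q x ∈ W ∧
      Etale c ∧ c ≫ affineSpaceHom k n = W.ι ≫ g ∧
        W.ι ⁻¹' symmetricLocus π q S = c ⁻¹' ⋃ j ∈ J, coordinateHyperplane k n j := by
  classical
  have hP := h.isFibrePower
  have hq := h.isSymmetricQuotient
  obtain ⟨V, hV⟩ := IsSymmetricQuotient.exists_preimage_eq_powerOpen hP hq U
  have hPV : IsAffineOpen (q ⁻¹ᵁ V) := hV ▸ hP.isAffineOpen_powerOpen hU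
  have hYV : IsAffineOpen V := IsSymmetricQuotient.isAffineOpen_of_preimage hP hq hPV
  have hxV : q x ∈ V := by
    change x ∈ q ⁻¹ᵁ V
    rw [hV, mem_powerOpen]
    exact hxU
  let := sectionsAlgebra f U
  let := sectionsAlgebra p (q ⁻¹ᵁ V)
  let := sectionsAlgebra g V
  let := (q.app V).hom.toAlgebra
  let := IsSymmetricQuotient.action hP hq V
  have htower := h.isScalarTower V
  have hsym := h.isSymmetricTensorPower hU hV
  have hpsm : SmoothOfRelativeDimension n p := hP.smoothOfRelativeDimension
  have hsmooth : Smooth p := SmoothOfRelativeDimension.smooth n p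
  have hCft : Algebra.FiniteType k Γ(P, q ⁻¹ᵁ V) := finiteType_structureHom hPV
  have hCsm := locally_isStandardSmooth_structureHom (f := p) (n := n) hPV
  have hAsm := locally_isStandardSmooth_structureHom (f := f) (n := 1) hU
  obtain ⟨χ, hχ⟩ := exists_evaluation ψ hψ (q ⁻¹ᵁ V) t₀ (by rw [hx]; exact hxV)
  rw [hx] at hχ
  choose s hs using hk
  have hι (i : Fin n) (a : Γ(X, U)) (y : P) (hy : y ∈ q ⁻¹ᵁ V) :
      y ∈ P.basicOpen (sectionsMap (π i) (hP.w i) U (q ⁻¹ᵁ V) (hV ▸ powerOpen_le U i) a) ↔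
        π i y ∈ X.basicOpen a := by
    have := Scheme.basicOpen_appLE (π i) (q ⁻¹ᵁ V) U (hV ▸ powerOpen_le U i) a
    exact (iff_of_eq congr(y ∈ $this)).trans ⟨fun h ↦ h.2, fun h ↦ ⟨hy, h⟩⟩
  obtain ⟨t, J, ρ, hJ, htJ, hρ, het⟩ := hsym.exists_etale_coordinates χ
    (fun i ↦ exists_local_generator (K := K) (locally_isStandardSmooth_baseChange hAsm) _)
    (height_ker_of_locally_isStandardSmooth hCsm χ).ge e s idx
    (fun a b hab ↦ hz <| eq_of_forall_mem_basicOpen_iff hU (hidx a ▸ hxU _) (hidx b ▸ hxU _)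
      fun c ↦ by rw [hs, hs, hab])
    (fun j a ↦ by rw [← he, hs, not_not])
    -- The point `z j` is rational, so `a - s j a` vanishes there and hence in `K`; thus the
    -- geometric point has the value `s j a`.
    (fun j a ↦ by
      have h1 : ∀ a, s j a = 0 → χ (sectionsMap (π (idx j)) (hP.w (idx j)) U (q ⁻¹ᵁ V)
          (hV ▸ powerOpen_le U (idx j)) a) = 0 := by
        intro a ha
        by_contra h2
        rw [← ne_eq, ← hχ, hι _ _ _ hxV, hidx, hs] at h2
        exact h2 ha
      have h2 := h1 (a - algebraMap k _ (s j a)) (by simp)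
      rw [map_sub, map_sub, sub_eq_zero, AlgHom.commutes, AlgHom.commutes] at h2
      exact h2)
  let W := Y.basicOpen ρ
  have hWV : W ≤ V := Y.basicOpen_le ρ
  have hWaff : IsAffineOpen W := hYV.basicOpen ρ
  let T := MvPolynomial (Fin n) k
  let φ₀ : T →ₐ[k] Γ(Y, V) := MvPolynomial.aeval t
  let res : Γ(Y, V) →+* Γ(Y, W) := (Y.presheaf.map (homOfLE hWV).op).hom
  let φ : T →+* Γ(Y, W) := res.comp φ₀.toRingHom
  have hloc : @IsLocalization.Away _ _ ρ Γ(Y, W) _ res.toAlgebra := hYV.isLocalization_basicOpen ρ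
  have hφet : φ.Etale := by
    let := res.toAlgebra
    have hl : IsLocalization.Away ρ Γ(Y, W) := hloc
    let e' : Localization.Away ρ ≃ₐ[Γ(Y, V)] Γ(Y, W) :=
      IsLocalization.algEquiv (Submonoid.powers ρ) _ _
    have h1 : φ = e'.toRingEquiv.toRingHom.comp
        ((algebraMap Γ(Y, V) (Localization.Away ρ)).comp φ₀.toRingHom) := by
      exact RingHom.ext fun a ↦ (e'.commutes (φ₀ a)).symm
    rw [h1]
    exact RingHom.Etale.respectsIso.1 _ e'.toRingEquiv het
  refine ⟨W, W.toSpecΓ ≫ Spec.map (CommRingCat.ofHom φ), Finset.univ.image J, ?_, ?_, ?_, ?_⟩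
  · have h1 : x ∈ P.basicOpen ((q.app V).hom ρ) := (hχ _).mpr hρ
    rwa [← Scheme.preimage_basicOpen] at h1
  · have h1 : Etale (Spec.map (CommRingCat.ofHom φ)) :=
      (HasRingHomProperty.Spec_iff (P := @Etale)).mpr hφet
    have h2 : IsIso W.toSpecΓ := hWaff.isoSpec_hom ▸ inferInstance
    infer_instance
  · rw [Category.assoc, affineSpaceHom, ← Spec.map_comp, ← toSpecΓ_structureHom]
    congr 2
    have h1 := structureHom_appLE (𝟙 Y) (Category.id_comp g) V W hWV
    rw [← h1]
    ext c
    change res (φ₀ (algebraMap k T c)) = _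
    rw [φ₀.commutes]
    simp [Scheme.Hom.appLE]
    rfl
  · ext w
    obtain ⟨y, hy⟩ := IsSymmetricQuotient.surjective hP hq w.1
    have hyV : y ∈ q ⁻¹ᵁ V := by
      change q y ∈ V
      rw [hy]; exact hWV w.2
    have hyU : ∀ i, π i y ∈ U := by
      rw [hV, mem_powerOpen] at hyV; exact hyV
    -- On `P` the norm is the product of the pullbacks of `e j` along the projections, so it
    -- vanishes exactly where some coordinate is a zero of `e j`.
    have h1 (j) : w.1 ∈ Y.basicOpen (hsym.norm (e j)) ↔ ∀ i, π i y ∈ X.basicOpen (e j) := by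
      rw [← hy, ← Scheme.Hom.mem_preimage, Scheme.preimage_basicOpen,
        show q.app V (hsym.norm (e j)) = _ from hsym.algebraMap_norm (e j),
        mem_basicOpen_iff_notMem_primeIdealOf hPV _ ⟨y, hyV⟩, Ideal.IsPrime.prod_mem_iff]
      simp only [Finset.mem_univ, true_and, not_exists]
      refine forall_congr' fun i ↦ ?_
      rw [← mem_basicOpen_iff_notMem_primeIdealOf hPV _ ⟨y, hyV⟩, hι _ _ _ hyV]
    have h2 (j) : (W.toSpecΓ ≫ Spec.map (CommRingCat.ofHom φ)) w ∈
        coordinateHyperplane k n (J j) ↔ ∃ i, π i y ∉ X.basicOpen (e j) := by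
      refine (toSpecΓ_SpecMap_mem_zeroLocus_iff φ w _).trans ?_
      have : φ (MvPolynomial.X (J j)) = res (hsym.norm (e j)) := by
        rw [← htJ]
        exact congrArg res (MvPolynomial.aeval_X _ _)
      rw [this]
      change w.1 ∉ Y.basicOpen (Y.presheaf.map (homOfLE hWV).op _) ↔ _
      rw [Scheme.basicOpen_res]
      have h3 : w.1 ∈ W ⊓ Y.basicOpen (hsym.norm (e j)) ↔ ∀ i, π i y ∈ X.basicOpen (e j) :=
        (and_iff_right w.2).trans (h1 j)
      rw [h3, not_forall]
    have h3 : w ∈ W.ι ⁻¹' symmetricLocus π q S ↔ ∃ i, π i y ∈ S := by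
      rw [← IsSymmetricQuotient.mem_symmetricLocus_iff hP hq, hy]
      rfl
    rw [h3]
    simp only [Set.mem_preimage, Set.mem_iUnion, Finset.mem_image, Finset.mem_univ, true_and,
      exists_prop, exists_exists_eq_and, h2]
    rw [exists_comm]
    exact exists_congr fun i ↦ hS _ (hyU i)

end Chart

/-! ### Function fields and valuations. -/

section FunctionField

open Polynomial

/-- Given finitely many valuation rings of a field `F` over `k`, any transcendental element of `F`
has a rational function over `k` which lies in all of them and is again transcendental. -/
theorem exists_transcendental_mem {k F : Type*} [Field k] [Field F] [Algebra k F] {ι : Type*}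
    [Finite ι] (A : ι → ValuationSubring F) (hk : ∀ i c, algebraMap k F c ∈ A i) {t : F}
    (ht : Transcendental k t) : ∃ h : F, Transcendental k h ∧ ∀ i, h ∈ A i := by
  classical
  have := Fintype.ofFinite ι
  have hmem (i) (hti : t ∈ A i) (P : k[X]) : aeval t P ∈ A i := by
    rw [aeval_eq_sum_range]
    exact sum_mem fun j _ ↦ by
      rw [Algebra.smul_def]
      exact mul_mem (hk i _) (pow_mem hti _)
  -- If some nonzero polynomial in `t` has positive valuation at `i`, then `p i` is one; otherwise
  -- `p i = 1` will do.
  have hex (i) : ∃ p : k[X], p ≠ 0 ∧ ∀ P : k[X], P ≠ 0 → (A i).valuation (aeval t P) < 1 →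
      (A i).valuation (aeval t p) < 1 := by
    by_cases h : ∃ P : k[X], P ≠ 0 ∧ (A i).valuation (aeval t P) < 1
    · obtain ⟨P, h1, h2⟩ := h
      exact ⟨P, h1, fun _ _ _ ↦ h2⟩
    · push Not at h
      exact ⟨1, one_ne_zero, fun P h1 h2 ↦ absurd h2 (not_lt.mpr (h P h1))⟩
  choose p hp0 hp using hex
  let Q : k[X] := ∏ i, p i
  have hQ0 : Q ≠ 0 := Finset.prod_ne_zero_iff.mpr fun i _ ↦ hp0 i
  -- The function sought is `1 / P(t)`. Were `P(t)` in the maximal ideal of `A i`, then `t` would be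
  -- integral over `A i`, hence in it; as `p i` divides `Q`, also `t Q(t)` would be in the maximal
  -- ideal, forcing `P(t)` to be a unit.
  let P : k[X] := 1 + X * Q
  have hdeg : P.natDegree = Q.natDegree + 1 := by
    have h1 : (X * Q).natDegree = Q.natDegree + 1 := natDegree_X_mul hQ0
    rw [← h1]
    refine natDegree_add_eq_right_of_natDegree_lt ?_
    rw [h1, natDegree_one]
    exact Nat.succ_pos _
  have hP0 : P ≠ 0 := fun h ↦ by simp [h] at hdeg
  have htP : Transcendental k (aeval t P) :=
    ht.aeval P (by omega) (by simpa using hP0)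
  refine ⟨(aeval t P)⁻¹, fun h ↦ htP (IsAlgebraic.inv_iff.mp h), fun i ↦ ?_⟩
  by_contra hcon
  have hlt : (A i).valuation (aeval t P) < 1 := by
    rw [← ValuationSubring.valuation_le_one_iff, map_inv₀, not_le] at hcon
    exact (one_lt_inv₀ (lt_of_le_of_ne zero_le (Ne.symm fun h ↦ by simp [h] at hcon))).mp hcon
  have hti : t ∈ A i := by
    have hPA : aeval t P ∈ A i := ((A i).valuation_le_one_iff _).mp hlt.le
    have hint : IsIntegral (A i) t := by
      let a₀ : A i := ⟨aeval t P, hPA⟩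
      let φ : k →+* A i := (algebraMap k F).codRestrict (A i).toSubring (hk i)
      have hφ : (algebraMap (A i) F).comp φ = algebraMap k F := rfl
      let P' : (A i)[X] := C (φ P.leadingCoeff⁻¹) * (P.map φ - C a₀)
      have hd : (P.map φ - C a₀).natDegree = P.natDegree := by
        rw [natDegree_sub_C, natDegree_map]
      refine ⟨P', ?_, ?_⟩
      · have hl : (P.map φ - C a₀).leadingCoeff = φ P.leadingCoeff := by
          rw [leadingCoeff, hd, coeff_sub, coeff_C_of_ne_zero (by omega), sub_zero, coeff_map]
          rfl
        rw [Monic, leadingCoeff_mul, leadingCoeff_C, hl, ← map_mul,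
          inv_mul_cancel₀ (leadingCoeff_ne_zero.mpr hP0), map_one]
      · rw [← aeval_def, map_mul, map_sub, aeval_C, aeval_C, aeval_def, eval₂_map, hφ]
        change _ * (aeval t P - aeval t P) = 0
        rw [sub_self, mul_zero]
    obtain ⟨y, hy⟩ := IsIntegrallyClosed.isIntegral_iff.mp hint
    exact hy ▸ y.2
  have h1 := hp i P hP0 hlt
  have h2 : (A i).valuation (aeval t (X * Q)) < 1 := by
    have : X * Q = p i * (X * ∏ j ∈ Finset.univ.erase i, p j) := by
      rw [mul_left_comm, Finset.mul_prod_erase _ _ (Finset.mem_univ i)]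
    rw [this, map_mul, map_mul]
    exact mul_lt_one_of_lt_of_le h1 (((A i).valuation_le_one_iff _).mpr (hmem i hti _))
  have h3 : (A i).valuation (aeval t P) = 1 := by
    rw [map_add, map_one, Valuation.map_one_add_of_lt _ h2]
  exact hlt.ne h3

/-- A regular local ring of dimension one is a valuation ring. Membership is expressed by fractions
so that elements extend to sections near the point. -/
theorem exists_valuationSubring_of_isRegularLocalRing {B F : Type u} [CommRing B] [IsDomain B]
    [Field F] [Algebra B F] [IsFractionRing B F] (q : Ideal B) [q.IsPrime]
    [IsRegularLocalRing (Localization.AtPrime q)]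
    (hd : ringKrullDim (Localization.AtPrime q) = (1 : ℕ)) :
    ∃ A : ValuationSubring F, ∀ x, x ∈ A ↔
      ∃ g ∉ q, ∃ a, algebraMap B F g * x = algebraMap B F a := by
  let R := Localization.AtPrime q
  have : IsDomain R := isDomain_of_isRegularLocalRing R
  have hu (y : q.primeCompl) : IsUnit (algebraMap B F y) :=
    isUnit_iff_ne_zero.mpr ((map_ne_zero_iff _ (IsFractionRing.injective B F)).mpr
      fun h ↦ y.2 (h ▸ q.zero_mem))
  let φ : R →+* F := IsLocalization.lift hu
  let := φ.toAlgebra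
  have : IsScalarTower B R F := IsScalarTower.of_algebraMap_eq fun b ↦
    (IsLocalization.lift_eq hu b).symm
  have : IsFractionRing R F :=
    IsFractionRing.isFractionRing_of_isDomain_of_isLocalization q.primeCompl R F
  obtain ⟨π, hπ⟩ := exists_maximalIdeal_eq_span_singleton hd
  have htfae : (IsLocalRing.maximalIdeal R).IsPrincipal ↔ ValuationRing R :=
    (tfae_of_isNoetherianRing_of_isLocalRing_of_isDomain R).out 4 1
  have : ValuationRing R := htfae.mp ⟨⟨π, hπ⟩⟩
  refine ⟨(ValuationRing.valuation R F).valuationSubring, fun x ↦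
    (ValuationRing.mem_integer_iff R F x).trans ⟨?_, ?_⟩⟩
  · rintro ⟨r, rfl⟩
    obtain ⟨a, s, rfl⟩ := IsLocalization.exists_mk'_eq q.primeCompl r
    refine ⟨s, s.2, a, ?_⟩
    rw [IsScalarTower.algebraMap_apply B R F, ← map_mul, IsLocalization.mk'_spec',
      ← IsScalarTower.algebraMap_apply]
  · rintro ⟨g, hg, a, h⟩
    refine ⟨IsLocalization.mk' R a (⟨g, hg⟩ : q.primeCompl), ?_⟩
    have h0 : algebraMap B F g ≠ 0 := (hu ⟨g, hg⟩).ne_zero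
    refine mul_left_cancel₀ h0 (Eq.trans ?_ h.symm)
    rw [IsScalarTower.algebraMap_apply B R F, ← map_mul]
    rw [show algebraMap B R g = algebraMap B R (⟨g, hg⟩ : q.primeCompl) from rfl,
      IsLocalization.mk'_spec', ← IsScalarTower.algebraMap_apply]

/-- A prime ideal of height one of a Noetherian domain is isolated in the zero locus of each nonzero
element of it, provided that it is maximal. -/
theorem exists_notMem_forall_eq_of_height_eq_one {B : Type*} [CommRing B] [IsDomain B]
    [IsNoetherianRing B] (q : Ideal B) [hq : q.IsMaximal] (hd : q.height = 1) {b : B} (hb : b ≠ 0)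
    (hbq : b ∈ q) : ∃ g ∉ q, ∀ Q : Ideal B, Q.IsPrime → g ∉ Q → b ∈ Q → Q = q := by
  classical
  have hfin : (Ideal.span {b}).minimalPrimes.Finite :=
    Ideal.finite_minimalPrimes_of_isNoetherianRing _ _
  have hqm : ∀ Q : Ideal B, Q.IsPrime → b ∈ Q → Q ≤ q → Q = q := fun Q hQ hbQ hle ↦ by
    by_contra hne
    have hlt : Q < q := lt_of_le_of_ne hle hne
    have h1 : (⊥ : Ideal B) < Q := bot_lt_iff_ne_bot.mpr fun h ↦ hb (by simpa [h] using hbQ)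
    have h2 := Ideal.height_add_one_le_of_lt_of_isPrime h1
    have h3 := Ideal.height_add_one_le_of_lt_of_isPrime hlt
    rw [hd, Ideal.height_bot, zero_add] at *
    exact absurd ((add_le_add_left h2 1).trans h3) (by decide)
  -- The other components of the zero locus of `b`: none of these primes lies in `q`, since `q` has
  -- height one, so some `g` outside `q` vanishes on all of them.
  let M := hfin.toFinset.erase q
  have hg : ∃ g ∈ ∏ Q ∈ M, Q, g ∉ q := by
    by_contra! h
    have h1 : ∏ Q ∈ M, Q ≤ q := h
    obtain ⟨Q, hQM, hQ⟩ := (Ideal.IsPrime.prod_le hq.isPrime).mp h1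
    have hQ' := (hfin.mem_toFinset.mp (Finset.mem_of_mem_erase hQM))
    exact Finset.ne_of_mem_erase hQM (hqm Q hQ'.1.1
      (hQ'.1.2 (Ideal.mem_span_singleton_self b)) hQ)
  obtain ⟨g, hgM, hgq⟩ := hg
  refine ⟨g, hgq, fun Q hQ hgQ hbQ ↦ ?_⟩
  obtain ⟨Q', hQ', hle⟩ := Ideal.exists_minimalPrimes_le
    ((Ideal.span_singleton_le_iff_mem Q).mpr hbQ)
  have : Q' = q := by
    by_contra hne
    have hM : Q' ∈ M := Finset.mem_erase.mpr ⟨hne, hfin.mem_toFinset.mpr hQ'⟩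
    exact hgQ (hle (Ideal.prod_le_inf.trans (Finset.inf_le hM) hgM))
  subst this
  exact (hq.eq_of_le hQ.ne_top hle).symm

end FunctionField

/-! ### Generic points and functions on smooth curves. -/

section Generic

variable {X : Scheme.{u}} {V : X.Opens} {ξ : X}

/-- The generic point of an integral affine open subset lies in every open subset meeting it. -/
theorem mem_of_primeIdealOf_eq_bot (hV : IsAffineOpen V) (hξ : ξ ∈ V)
    (hbot : (hV.primeIdealOf ⟨ξ, hξ⟩).asIdeal = ⊥) (O : X.Opens) (w : X) (hwO : w ∈ O)
    (hwV : w ∈ V) : ξ ∈ O := by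
  obtain ⟨a, haO, hwa⟩ := hV.exists_basicOpen_le ⟨w, hwO⟩ hwV
  refine haO ((mem_basicOpen_iff_notMem_primeIdealOf hV a ⟨ξ, hξ⟩).mpr ?_)
  rw [hbot, Ideal.mem_bot]
  rintro rfl
  rw [Scheme.basicOpen_zero] at hwa
  exact hwa

theorem germ_injective_of_le (hV : IsAffineOpen V) [IsDomain Γ(X, V)] (hξ : ξ ∈ V)
    (hbot : (hV.primeIdealOf ⟨ξ, hξ⟩).asIdeal = ⊥) {W : X.Opens} (hWV : W ≤ V) (hξW : ξ ∈ W) :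
    Function.Injective (X.presheaf.germ W ξ hξW) := by
  have H : Function.Injective (X.presheaf.germ V ξ hξ) := by
    let := X.presheaf.algebra_section_stalk (U := V) ⟨ξ, hξ⟩
    have := hV.isLocalization_stalk ⟨ξ, hξ⟩
    refine IsLocalization.injective (M := (hV.primeIdealOf ⟨ξ, hξ⟩).asIdeal.primeCompl)
      (X.presheaf.stalk ξ) fun a ha ↦ mem_nonZeroDivisors_of_ne_zero fun h ↦ ha ?_
    rw [h]
    exact zero_mem _
  rw [injective_iff_map_eq_zero]
  intro s hs
  refine TopCat.Presheaf.section_ext X.sheaf W s 0 fun w hw ↦ ?_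
  obtain ⟨a, haW, hwa⟩ := hV.exists_basicOpen_le ⟨w, hw⟩ (hWV hw)
  have hξa : ξ ∈ X.basicOpen a := mem_of_primeIdealOf_eq_bot hV hξ hbot _ w hwa (hWV hw)
  have h1 := injective_germ_basicOpen V hV ξ hξ a hξa H
  have h2 : X.presheaf.map (homOfLE haW).op s = 0 := h1 <| by
    rw [map_zero, TopCat.Presheaf.germ_res_apply, hs]
  have h3 := X.presheaf.germ_res_apply (homOfLE haW) w hwa s
  rw [h2, map_zero] at h3
  rw [map_zero]
  exact h3.symm

/-- For a morphism locally of finite type, being quasi-finite at a point means that the point is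
isolated in its fibre. -/
theorem quasiFiniteAt_of_forall_eq {Y : Scheme.{u}} (φ : X ⟶ Y) [LocallyOfFiniteType φ] (x : X)
    (O : X.Opens) (hx : x ∈ O) (h : ∀ x' ∈ O, φ x' = φ x → x' = x) : φ.QuasiFiniteAt x := by
  rw [Scheme.Hom.quasiFiniteAt_iff_isOpen_singleton_asFiber]
  convert! (φ.fiberι (φ x) ⁻¹ᵁ O).2
  ext y
  constructor
  · rintro rfl
    change φ.fiberι _ _ ∈ O
    rwa [φ.fiberι_asFiber]
  · intro hy
    have h1 : φ (φ.fiberι (φ x) y) = φ x := by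
      have : φ.fiberι (φ x) y ∈ φ ⁻¹' {φ x} := φ.range_fiberι (φ x) ▸ Set.mem_range_self y
      exact this
    refine (φ.fiberι (φ x)).isEmbedding.injective ?_
    rw [h _ hy h1, φ.fiberι_asFiber]

end Generic

section Curve

variable {k K : Type u} [Field k] [Field K] [Algebra k K] {X : Scheme.{u}}
  {f : X ⟶ Spec (.of k)}

theorem exists_evaluation_of_isAffineOpen (ψ : Spec (.of K) ⟶ X)
    (hψ : ψ ≫ f = Spec.map (CommRingCat.ofHom (algebraMap k K))) {U : X.Opens}
    (hU : IsAffineOpen U) (t : Spec (.of K)) (ht : ψ t ∈ U) : letI := sectionsAlgebra f U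
    ∃ χ : Γ(X, U) →ₐ[k] K, (hU.primeIdealOf ⟨ψ t, ht⟩).asIdeal = RingHom.ker χ := by
  let := sectionsAlgebra f U
  obtain ⟨χ, hχ⟩ := exists_evaluation ψ hψ U t ht
  refine ⟨χ, Ideal.ext fun a ↦ ?_⟩
  rw [RingHom.mem_ker, ← not_iff_not, ← ne_eq (χ a), ← hχ,
    mem_basicOpen_iff_notMem_primeIdealOf hU a ⟨ψ t, ht⟩]

variable [Algebra.IsAlgebraic k K]

theorem isLocallyNoetherian_of_locallyOfFiniteType (f : X ⟶ Spec (.of k)) [LocallyOfFiniteType f] :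
    IsLocallyNoetherian X :=
  LocallyOfFiniteType.isLocallyNoetherian f

/-- The local ring at the point is regular, hence a domain, and on a locally Noetherian scheme
sections over a small neighbourhood inject into it. -/
theorem exists_isAffineOpen_isDomain [SmoothOfRelativeDimension 1 f] (ψ : Spec (.of K) ⟶ X)
    (hψ : ψ ≫ f = Spec.map (CommRingCat.ofHom (algebraMap k K))) (t : Spec (.of K)) :
    ∃ V : X.Opens, IsAffineOpen V ∧ ψ t ∈ V ∧ IsDomain Γ(X, V) := by
  have : Smooth f := SmoothOfRelativeDimension.smooth 1 f
  have : IsLocallyNoetherian X := isLocallyNoetherian_of_locallyOfFiniteType f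
  obtain ⟨V, hxV, hV, hinj⟩ := X.exists_germ_injective (ψ t)
  refine ⟨V, hV, hxV, ?_⟩
  let := sectionsAlgebra f V
  obtain ⟨χ, hχ⟩ := exists_evaluation_of_isAffineOpen ψ hψ hV t hxV
  have hreg := (isRegularLocalRing_of_locally_isStandardSmooth
    (locally_isStandardSmooth_structureHom (f := f) (n := 1) hV) χ _ hχ).1
  have hdom := isDomain_of_isRegularLocalRing
    (Localization.AtPrime (hV.primeIdealOf ⟨ψ t, hxV⟩).asIdeal)
  let := X.presheaf.algebra_section_stalk (U := V) ⟨ψ t, hxV⟩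
  have := hV.isLocalization_stalk ⟨ψ t, hxV⟩
  let e : X.presheaf.stalk (ψ t) ≃ₐ[Γ(X, V)] _ :=
    IsLocalization.algEquiv (hV.primeIdealOf ⟨ψ t, hxV⟩).asIdeal.primeCompl
      (X.presheaf.stalk (ψ t)) (Localization.AtPrime (hV.primeIdealOf ⟨ψ t, hxV⟩).asIdeal)
  have : IsDomain (X.presheaf.stalk (ψ t)) := e.toMulEquiv.isDomain _
  exact hinj.isDomain (X.presheaf.germ V (ψ t) hxV).hom

theorem structureHom_map (f : X ⟶ Spec (.of k)) {U V : X.Opens} (h : V ≤ U) :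
    structureHom f U ≫ X.presheaf.map (homOfLE h).op = structureHom f V := by
  rw [structureHom, structureHom, Category.assoc, Scheme.Hom.appLE_map]

theorem structureHom_germ (f : X ⟶ Spec (.of k)) (U : X.Opens) (x : X) (h : x ∈ U) :
    structureHom f U ≫ X.presheaf.germ U x h =
      structureHom f ⊤ ≫ X.presheaf.germ ⊤ x trivial := by
  rw [← structureHom_map f le_top, Category.assoc, TopCat.Presheaf.germ_res]

/-- Algebraic points of a smooth curve with a common generic point `ξ` have neighbourhoods on which a
single transcendental element of the function field is regular. -/
theorem exists_regular_of_generic [SmoothOfRelativeDimension 1 f] {ι : Type*} [Finite ι]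
    (ψ : ι → (Spec (.of K) ⟶ X))
    (hψ : ∀ i, ψ i ≫ f = Spec.map (CommRingCat.ofHom (algebraMap k K))) (t : Spec (.of K))
    (V : ι → X.Opens) (hV : ∀ i, IsAffineOpen (V i)) (hx : ∀ i, ψ i t ∈ V i)
    (hdom : ∀ i, IsDomain Γ(X, V i)) (ξ : X) (hξ : ∀ i, ξ ∈ V i)
    (hbot : ∀ i, ((hV i).primeIdealOf ⟨ξ, hξ i⟩).asIdeal = ⊥) :
    ∃ h : X.presheaf.stalk ξ, ∀ i, ∃ V' ≤ V i, IsAffineOpen V' ∧ ψ i t ∈ V' ∧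
      ∃ (hξ' : ξ ∈ V') (s : Γ(X, V')), X.presheaf.germ V' ξ hξ' s = h ∧
        letI := sectionsAlgebra f V'
        Transcendental k s := by
  rcases isEmpty_or_nonempty ι with hι | ⟨⟨i₀⟩⟩
  · exact ⟨0, fun i ↦ hι.elim i⟩
  let F := X.presheaf.stalk ξ
  let : Algebra k F := (structureHom f ⊤ ≫ X.presheaf.germ ⊤ ξ trivial).hom.toAlgebra
  let algk (i) : Algebra k Γ(X, V i) := sectionsAlgebra f (V i)
  let algF (i) : Algebra Γ(X, V i) F := (X.presheaf.germ (V i) ξ (hξ i)).hom.toAlgebra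
  have htower (i) : IsScalarTower k Γ(X, V i) F :=
    IsScalarTower.of_algebraMap_eq fun c ↦ congr($(structureHom_germ f (V i) ξ (hξ i)) c).symm
  have hfrac (i) : IsFractionRing Γ(X, V i) F := by
    have h1 := (hV i).isLocalization_stalk ⟨ξ, hξ i⟩
    have h2 : ((hV i).primeIdealOf ⟨ξ, hξ i⟩).asIdeal.primeCompl = nonZeroDivisors Γ(X, V i) := by
      ext a
      rw [mem_nonZeroDivisors_iff_ne_zero]
      change a ∉ ((hV i).primeIdealOf ⟨ξ, hξ i⟩).asIdeal ↔ _
      rw [hbot i, Ideal.mem_bot]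
    change IsLocalization (nonZeroDivisors Γ(X, V i)) F
    rw [← h2]
    exact h1
  let : Field F := IsFractionRing.toField Γ(X, V i₀)
  let q (i) : Ideal Γ(X, V i) := ((hV i).primeIdealOf ⟨ψ i t, hx i⟩).asIdeal
  have hq (i) : (q i).IsPrime := inferInstance
  have hsm (i) := locally_isStandardSmooth_structureHom (f := f) (n := 1) (hV i)
  have hreg (i) : IsRegularLocalRing (Localization.AtPrime (q i)) ∧
      ringKrullDim (Localization.AtPrime (q i)) = (1 : ℕ) := by
    obtain ⟨χ, hχ⟩ := exists_evaluation_of_isAffineOpen (ψ i) (hψ i) (hV i) t (hx i)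
    exact isRegularLocalRing_of_locally_isStandardSmooth (hsm i) χ _ hχ
  have hA (i) : ∃ A : ValuationSubring F, ∀ x, x ∈ A ↔
      ∃ g ∉ q i, ∃ a, algebraMap Γ(X, V i) F g * x = algebraMap Γ(X, V i) F a := by
    have := (hreg i).1
    exact exists_valuationSubring_of_isRegularLocalRing (q i) (hreg i).2
  choose A hA using hA
  obtain ⟨b, hbq, hb0⟩ : ∃ b ∈ q i₀, b ≠ 0 := by
    refine Submodule.exists_mem_ne_zero_of_ne_bot fun h0 ↦ ?_
    have h1 := (hreg i₀).2
    rw [IsLocalization.AtPrime.ringKrullDim_eq_height (q i₀), h0, Ideal.height_bot] at h1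
    norm_num at h1
  -- A nonzero element of a domain which is algebraic over `k` is a unit, so it cannot vanish at a
  -- point.
  have hbt : Transcendental k (algebraMap Γ(X, V i₀) F b) := fun halg ↦ by
    have h1 : IsIntegral k b := (isIntegral_algebraMap_iff
      (IsFractionRing.injective Γ(X, V i₀) F)).mp halg.isIntegral
    exact (hq i₀).ne_top (Ideal.eq_top_of_isUnit_mem _ hbq (h1.isUnit hb0))
  obtain ⟨h, hht, hhA⟩ := exists_transcendental_mem A (fun i c ↦ (hA i _).mpr
    ⟨1, (Ideal.ne_top_iff_one _).mp (hq i).ne_top, algebraMap k _ c, by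
      rw [map_one, one_mul, ← IsScalarTower.algebraMap_apply]⟩) hbt
  refine ⟨h, fun i ↦ ?_⟩
  obtain ⟨g, hg, a, hga⟩ := (hA i h).mp (hhA i)
  have hle := X.basicOpen_le g
  have hxg : ψ i t ∈ X.basicOpen g := (mem_basicOpen_iff_notMem_primeIdealOf (hV i) g ⟨_, hx i⟩).mpr hg
  have hξg : ξ ∈ X.basicOpen g := mem_of_primeIdealOf_eq_bot (hV i) (hξ i) (hbot i) _ _ hxg (hx i)
  have hu : IsUnit (X.presheaf.map (homOfLE hle).op g) := RingedSpace.isUnit_res_basicOpen _ g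
  let s : Γ(X, X.basicOpen g) := X.presheaf.map (homOfLE hle).op a * ↑hu.unit⁻¹
  have hs : X.presheaf.germ _ ξ hξg s = h := by
    have h0 : algebraMap Γ(X, V i) F g ≠ 0 := by
      rw [map_ne_zero_iff _ (IsFractionRing.injective _ _)]
      rintro rfl
      exact hg (zero_mem _)
    refine mul_left_cancel₀ h0 (Eq.trans ?_ hga.symm)
    change X.presheaf.germ _ ξ (hξ i) g * _ = X.presheaf.germ _ ξ (hξ i) a
    rw [← X.presheaf.germ_res_apply (homOfLE hle) ξ hξg g,
      ← X.presheaf.germ_res_apply (homOfLE hle) ξ hξg a]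
    erw [← map_mul]
    congr 1
    rw [mul_left_comm, IsUnit.mul_val_inv, mul_one]
  refine ⟨X.basicOpen g, hle, (hV i).basicOpen g, hxg, hξg, s, hs, fun halg ↦ hht ?_⟩
  let := sectionsAlgebra f (X.basicOpen g)
  let φ : Γ(X, X.basicOpen g) →ₐ[k] F :=
    { (X.presheaf.germ _ ξ hξg).hom with
      commutes' := fun c ↦ congr($(structureHom_germ f _ ξ hξg) c) }
  have : φ s = h := hs
  rw [← this]
  exact halg.algHom φ

end Curve

/-! ### Finitely many points in an affine open subset. -/

section QuasiAffine

variable {X Y : Scheme.{u}}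

/-- Finitely many points in the quasi-finite locus of a separated morphism of finite type to an
affine scheme lie in an affine open subset. -/
theorem exists_isAffineOpen_of_quasiFiniteAt (φ : X ⟶ Y) [IsAffine Y] [LocallyOfFiniteType φ]
    [IsSeparated φ] [QuasiCompact φ] {ι : Type*} [Finite ι] (x : ι → X)
    (hx : ∀ i, φ.QuasiFiniteAt (x i)) : ∃ U : X.Opens, IsAffineOpen U ∧ ∀ i, x i ∈ U := by
  -- Zariski's main theorem: this is an open immersion, into a scheme affine over the affine `Y`.
  -- Finitely many points of an open subset of an affine scheme lie in a basic open subset inside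
  -- it.
  let j := φ.quasiFiniteLocus.ι ≫ φ.toNormalization
  have : IsAffine φ.normalization := isAffine_of_isAffineHom φ.fromNormalization
  let x' (i) : φ.quasiFiniteLocus := ⟨x i, hx i⟩
  obtain ⟨a, ha, hxa⟩ := exists_basicOpen_le_forall_mem (isAffineOpen_top φ.normalization)
    (W := j.opensRange) (fun i ↦ j (x' i)) (fun _ ↦ trivial) (fun i ↦ ⟨x' i, rfl⟩)
  have h1 : IsAffineOpen (j ⁻¹ᵁ φ.normalization.basicOpen a) :=
    ((isAffineOpen_top φ.normalization).basicOpen a).preimage_of_isOpenImmersion j ha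
  refine ⟨φ.quasiFiniteLocus.ι ''ᵁ (j ⁻¹ᵁ φ.normalization.basicOpen a),
    h1.image_of_isOpenImmersion _, fun i ↦ ⟨x' i, hxa i, rfl⟩⟩

theorem isDomain_of_le {V : X.Opens} {ξ : X} (hV : IsAffineOpen V) [IsDomain Γ(X, V)] (hξ : ξ ∈ V)
    (hbot : (hV.primeIdealOf ⟨ξ, hξ⟩).asIdeal = ⊥) {W : X.Opens} (hWV : W ≤ V) (hξW : ξ ∈ W) :
    IsDomain Γ(X, W) := by
  let := X.presheaf.algebra_section_stalk (U := V) ⟨ξ, hξ⟩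
  have := hV.isLocalization_stalk ⟨ξ, hξ⟩
  have : IsDomain (X.presheaf.stalk ξ) :=
    IsLocalization.isDomain_of_le_nonZeroDivisors (M := (hV.primeIdealOf ⟨ξ, hξ⟩).asIdeal.primeCompl)
      (X.presheaf.stalk ξ) fun a ha ↦ mem_nonZeroDivisors_of_ne_zero fun h ↦ ha (h ▸ zero_mem _)
  exact (germ_injective_of_le hV hξ hbot hWV hξW).isDomain (X.presheaf.germ W ξ hξW).hom

end QuasiAffine

section Curve

open Polynomial

variable {k K : Type u} [Field k] [Field K] [Algebra k K] [Algebra.IsAlgebraic k K] {X : Scheme.{u}}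
  {f : X ⟶ Spec (.of k)}

theorem map_eval₂_structureHom {U V : X.Opens} (h : V ≤ U) (s : Γ(X, U)) (P : k[X]) :
    X.presheaf.map (homOfLE h).op (eval₂ (structureHom f U).hom s P) =
      eval₂ (structureHom f V).hom (X.presheaf.map (homOfLE h).op s) P := by
  rw [← structureHom_map f h]
  exact hom_eval₂ P _ (X.presheaf.map (homOfLE h).op).hom s

/-- This replaces quasi-projectivity. Transcendental functions near the points glue to a morphism
from a neighbourhood `W` to the affine line which is quasi-finite at the points, and Zariski's main
theorem gives an affine open subset. -/
theorem exists_isAffineOpen_forall_mem [SmoothOfRelativeDimension 1 f] [IsSeparated f] {ι : Type u}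
    [Finite ι] (ψ : ι → (Spec (.of K) ⟶ X))
    (hψ : ∀ i, ψ i ≫ f = Spec.map (CommRingCat.ofHom (algebraMap k K))) (t : Spec (.of K)) :
    ∃ U : X.Opens, IsAffineOpen U ∧ ∀ i, ψ i t ∈ U := by
  have : Smooth f := SmoothOfRelativeDimension.smooth 1 f
  have : IsLocallyNoetherian X := isLocallyNoetherian_of_locallyOfFiniteType f
  choose V hV hx hdom using fun i ↦ exists_isAffineOpen_isDomain (ψ i) (hψ i) t
  have hgen (i) : ∃ ξ, ∃ (h : ξ ∈ V i), ((hV i).primeIdealOf ⟨ξ, h⟩).asIdeal = ⊥ := by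
    have := hdom i
    obtain ⟨ξ, hξ⟩ := exists_primeIdealOf_eq (hV i) (⊥ : Ideal Γ(X, V i))
    exact ⟨ξ.1, ξ.2, hξ⟩
  choose ξ hξ hbot using hgen
  have hreg (η : X) : ∃ h : X.presheaf.stalk η, ∀ i : {i // ξ i = η}, ∃ V' ≤ V i,
      IsAffineOpen V' ∧ ψ i t ∈ V' ∧ ∃ (hξ' : η ∈ V') (s : Γ(X, V')),
        X.presheaf.germ V' η hξ' s = h ∧ letI := sectionsAlgebra f V'
        Transcendental k s :=
    exists_regular_of_generic (fun i : {i // ξ i = η} ↦ ψ i) (fun i ↦ hψ i) t (fun i ↦ V i)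
      (fun i ↦ hV i) (fun i ↦ hx i) (fun i ↦ hdom i) η (fun ⟨i, hi⟩ ↦ by
        subst hi
        exact hξ i) (fun ⟨i, hi⟩ ↦ by
        subst hi
        exact hbot i)
  -- One element of the function field is fixed for each generic point, so that points on the same
  -- component use restrictions of the same function.
  choose H hH using hreg
  choose V' hV'V hV' hx' hξ' s hs htr using fun i ↦ hH (ξ i) ⟨i, rfl⟩
  have hs' (i) (η : X) (h : ξ i = η) : X.presheaf.germ (V' i) η (h ▸ hξ' i) (s i) = H η := by
    subst h
    exact hs i
  -- Overlapping neighbourhoods have the same generic point, where both sections are the chosen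
  -- function; germs there determine sections. The other overlaps are empty.
  have hcompat : TopCat.Presheaf.IsCompatible X.presheaf V' s := fun i j ↦ by
    by_cases hne : ∃ w, w ∈ V' i ∧ w ∈ V' j
    · obtain ⟨w, hwi, hwj⟩ := hne
      have hξj : ξ i ∈ V j := mem_of_primeIdealOf_eq_bot (hV i) (hξ i) (hbot i) _ w
        (hV'V j hwj) (hV'V i hwi)
      have hξi : ξ j ∈ V i := mem_of_primeIdealOf_eq_bot (hV j) (hξ j) (hbot j) _ w
        (hV'V i hwi) (hV'V j hwj)
      have heq : ξ i = ξ j := (inseparable_iff_forall_isOpen.mpr fun O hO ↦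
        ⟨fun h ↦ mem_of_primeIdealOf_eq_bot (hV j) (hξ j) (hbot j) ⟨O, hO⟩ _ h hξj,
          fun h ↦ mem_of_primeIdealOf_eq_bot (hV i) (hξ i) (hbot i) ⟨O, hO⟩ _ h hξi⟩).eq
      have := hdom i
      refine germ_injective_of_le (hV i) (hξ i) (hbot i) (inf_le_left.trans (hV'V i))
        ⟨hξ' i, heq ▸ hξ' j⟩ ?_
      refine (X.presheaf.germ_res_apply _ _ _ _).trans
        (Eq.trans ?_ (X.presheaf.germ_res_apply _ _ _ _).symm)
      rw [hs i, hs' j _ heq.symm]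
    · have h0 : V' i ⊓ V' j = ⊥ := by
        ext w
        exact ⟨fun h ↦ hne ⟨w, h⟩, fun h ↦ h.elim⟩
      have : Subsingleton Γ(X, V' i ⊓ V' j) := by rw [h0]; infer_instance
      exact Subsingleton.elim (α := Γ(X, V' i ⊓ V' j)) _ _
  let W : X.Opens := ⨆ i, V' i
  have hVW (i) : V' i ≤ W := le_iSup V' i
  obtain ⟨σ, hσ⟩ : ∃ σ : Γ(X, W), ∀ i, X.presheaf.map (homOfLE (hVW i)).op σ = s i :=
    (X.sheaf.existsUnique_gluing' V' W (fun i ↦ homOfLE (hVW i)) le_rfl s hcompat).exists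
  let φ : (W : Scheme.{u}) ⟶ Spec (.of k[X]) :=
    W.toSpecΓ ≫ Spec.map (CommRingCat.ofHom (eval₂RingHom (structureHom f W).hom σ))
  have hφ : φ ≫ Spec.map (CommRingCat.ofHom C) = W.ι ≫ f := by
    rw [Category.assoc, ← Spec.map_comp, ← toSpecΓ_structureHom]
    congr 2
    ext c
    exact eval₂_C _ _
  have hft : LocallyOfFiniteType (φ ≫ Spec.map (CommRingCat.ofHom C)) := hφ ▸ inferInstance
  have hsep : IsSeparated (φ ≫ Spec.map (CommRingCat.ofHom C)) := hφ ▸ inferInstance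
  have : LocallyOfFiniteType φ := locallyOfFiniteType_of_comp φ (Spec.map (CommRingCat.ofHom C))
  have : IsSeparated φ := IsSeparated.of_comp φ (Spec.map (CommRingCat.ofHom C))
  have hWc : IsCompact (W : Set X) := by
    rw [TopologicalSpace.Opens.coe_iSup]
    exact isCompact_iUnion fun i ↦ (hV' i).isCompact
  have : CompactSpace W := isCompact_iff_compactSpace.mp hWc
  have : QuasiCompact φ := (quasiCompact_iff_compactSpace φ).mpr this
  obtain ⟨O, hO, hOx⟩ := exists_isAffineOpen_of_quasiFiniteAt φ (fun i ↦ ⟨ψ i t, hVW i (hx' i)⟩)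
    fun i ↦ by
      let := sectionsAlgebra f (V' i)
      obtain ⟨χ, hχ⟩ := exists_evaluation_of_isAffineOpen (ψ i) (hψ i) (hV' i) t (hx' i)
      have := hdom i
      have : IsDomain Γ(X, V' i) :=
        isDomain_of_le (hV i) (hξ i) (hbot i) (hV'V i) (hξ' i)
      have : IsNoetherianRing Γ(X, V' i) :=
        IsLocallyNoetherian.component_noetherian ⟨V' i, hV' i⟩
      have := ker_isMaximal_of_isAlgebraic χ
      -- The value of `s i` at the point is a root of some `P`. Locally the fibre of `φ` lies in the
      -- zero locus of `P(s i)`, a nonzero function as `s i` is transcendental, and the point is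
      -- isolated in that locus.
      obtain ⟨P, hP0, hP⟩ := Algebra.IsAlgebraic.isAlgebraic (R := k) (χ (s i))
      have hb0 : aeval (s i) P ≠ 0 := fun h ↦ htr i ⟨P, hP0, h⟩
      obtain ⟨g, hg, hgq⟩ := exists_notMem_forall_eq_of_height_eq_one (RingHom.ker χ)
        (height_ker_of_locally_isStandardSmooth (n := 1)
          (locally_isStandardSmooth_structureHom (f := f) (n := 1) (hV' i)) χ) hb0
        (by rw [RingHom.mem_ker, ← aeval_algHom_apply, hP])
      have hb (w : W) (hw : w.1 ∈ V' i) :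
          φ w ∈ (PrimeSpectrum.zeroLocus {P} : Set (Spec (.of k[X]))) ↔
            aeval (s i) P ∈ ((hV' i).primeIdealOf ⟨w.1, hw⟩).asIdeal := by
        refine (toSpecΓ_SpecMap_mem_zeroLocus_iff _ w P).trans ?_
        rw [← not_iff_not, not_not,
          ← mem_basicOpen_iff_notMem_primeIdealOf (hV' i) _ ⟨w.1, hw⟩]
        have h1 : aeval (s i) P = X.presheaf.map (homOfLE (hVW i)).op
            (eval₂ (structureHom f W).hom σ P) := by
          rw [map_eval₂_structureHom]
          rw [hσ i]
          rfl
        rw [h1, Scheme.basicOpen_res]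
        exact ⟨fun h ↦ ⟨hw, h⟩, fun h ↦ h.2⟩
      refine quasiFiniteAt_of_forall_eq φ _ (W.ι ⁻¹ᵁ X.basicOpen g) ?_ fun w hw hφw ↦ ?_
      · change ψ i t ∈ X.basicOpen g
        rw [mem_basicOpen_iff_notMem_primeIdealOf (hV' i) g ⟨_, hx' i⟩, hχ]
        exact hg
      · have hwV : w.1 ∈ V' i := X.basicOpen_le g hw
        have h1 := (mem_basicOpen_iff_notMem_primeIdealOf (hV' i) g ⟨_, hwV⟩).mp hw
        have h2 := (hb ⟨ψ i t, hVW i (hx' i)⟩ (hx' i)).mpr (by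
          rw [hχ, RingHom.mem_ker, ← aeval_algHom_apply, hP])
        rw [← hφw] at h2
        have h3 := hgq _ inferInstance h1 ((hb w hwV).mp h2)
        rw [← hχ] at h3
        refine Subtype.ext (eq_of_forall_mem_basicOpen_iff (hV' i) hwV (hx' i) fun a ↦ ?_)
        rw [mem_basicOpen_iff_notMem_primeIdealOf (hV' i) a ⟨_, hwV⟩,
          mem_basicOpen_iff_notMem_primeIdealOf (hV' i) a ⟨_, hx' i⟩, h3]
  exact ⟨W.ι ''ᵁ O, hO.image_of_isOpenImmersion _, fun i ↦ ⟨_, hOx i, rfl⟩⟩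

end Curve

/-! ### Affine neighbourhoods with principal ideals at the points of `S`. -/

section LocallyPrincipal

variable {A : Type*} [CommRing A]

/-- A locally principal maximal ideal has an element which generates it near finitely many given
maximal ideals. -/
theorem exists_colon_not_le {ι : Type*} [Finite ι] (M : ι → Ideal A) [∀ i, (M i).IsMaximal]
    (m : Ideal A) [hm : m.IsMaximal] (hfg : m.FG) {τ : A} (hτ : τ ∈ m)
    (hgen : ∀ a ∈ m, ∃ g c, g ∉ m ∧ g * a = τ * c) :
    ∃ f ∈ m, ∀ i, ∃ g ∉ M i, ∀ a ∈ m, f ∣ g * a := by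
  classical
  have := Fintype.ofFinite ι
  obtain ⟨g₀, hg₀, hg₀m⟩ : ∃ g ∉ m, ∀ a ∈ m, τ ∣ g * a := by
    obtain ⟨s, hs⟩ := hfg
    have hsm : ∀ a ∈ s, a ∈ m := fun a ha ↦ hs ▸ Ideal.subset_span ha
    choose! G C hG hGC using hgen
    refine ⟨∏ a ∈ s, G a, fun h ↦ ?_, fun a ha ↦ ?_⟩
    · obtain ⟨a, ha, h⟩ := (hm.isPrime.prod_mem_iff).mp h
      exact hG a (hsm a ha) h
    · rw [← hs] at ha
      induction ha using Submodule.span_induction with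
      | mem a ha =>
        rw [← Finset.prod_erase_mul _ _ ha, mul_assoc, hGC a (hsm a ha)]
        exact Dvd.intro _ (by rw [mul_left_comm])
      | zero => simp
      | add a b _ _ h1 h2 => rw [mul_add]; exact dvd_add h1 h2
      | smul c a _ h => rw [smul_eq_mul, mul_left_comm]; exact h.mul_left c
  have hsq : ∀ w ∈ m * m, ∃ w' ∈ m, g₀ * w = τ * w' := fun w hw ↦ by
    induction hw using Submodule.mul_induction_on' with
    | mem_mul_mem a ha b hb =>
      obtain ⟨c, hc⟩ := hg₀m a ha
      exact ⟨c * b, m.mul_mem_left c hb, by rw [← mul_assoc, hc, mul_assoc]⟩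
    | add a _ b _ h1 h2 =>
      obtain ⟨a', ha', h1⟩ := h1
      obtain ⟨b', hb', h2⟩ := h2
      exact ⟨a' + b', add_mem ha' hb', by rw [mul_add, mul_add, h1, h2]⟩
  have hcop : IsCoprime (m * m) (∏ i with M i ≠ m, M i) := by
    refine IsCoprime.prod_right fun i hi ↦ ?_
    have h1 : IsCoprime m (M i) := Ideal.isCoprime_iff_sup_eq.mpr
      (hm.coprime_of_ne inferInstance (Ne.symm (Finset.mem_filter.mp hi).2))
    exact h1.mul_left h1
  obtain ⟨u, hu, v, hv, huv⟩ := Ideal.isCoprime_iff_exists.mp hcop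
  have hum : u ∈ m := Ideal.mul_le_left hu
  -- With `u + v = 1`, this is congruent to `τ` modulo `m²`, hence a generator near `m`, and
  -- congruent to `1` at the other maximal ideals.
  refine ⟨τ * v + u, add_mem (m.mul_mem_right _ hτ) hum, fun i ↦ ?_⟩
  by_cases hi : M i = m
  · obtain ⟨w', hw', hw⟩ := hsq (u * (1 - τ)) (Ideal.mul_mem_right _ _ hu)
    refine ⟨(g₀ + w') * g₀, fun h ↦ ?_, fun a ha ↦ ?_⟩
    · rw [hi] at h
      rcases hm.isPrime.mem_or_mem h with h | h
      · exact hg₀ ((Ideal.add_mem_iff_left _ hw').mp h)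
      · exact hg₀ h
    · obtain ⟨c, hc⟩ := hg₀m a ha
      refine ⟨c * g₀, ?_⟩
      have hv' : v = 1 - u := by rw [← huv]; ring
      rw [mul_assoc, hc, hv']
      linear_combination -c * hw
  · refine ⟨τ * v + u, fun h ↦ ?_, fun a _ ↦ Dvd.intro _ rfl⟩
    have hvM : v ∈ M i := Ideal.prod_le_inf.trans
      (Finset.inf_le (Finset.mem_filter.mpr ⟨Finset.mem_univ i, hi⟩)) hv
    have huM : u ∈ M i := (Ideal.add_mem_iff_right _ (Ideal.mul_mem_left _ _ hvM)).mp h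
    exact (Ideal.ne_top_iff_one _).mp (‹∀ i, (M i).IsMaximal› i).ne_top (huv ▸ add_mem huM hvM)

/-- The multipliers carrying `m j` into `(f j)` form an ideal contained in no `M i`, so prime
avoidance supplies one common to all `M i`, and the product over `j` is `h`. After inverting `h` the
ideals `m j` are principal. -/
theorem exists_generators_of_locally_principal {ι κ : Type*} [Finite ι] [Finite κ]
    (M : ι → Ideal A) [∀ i, (M i).IsMaximal] (m : κ → Ideal A) [∀ j, (m j).IsMaximal]
    (hfg : ∀ j, (m j).FG) (hgen : ∀ j, ∃ τ ∈ m j, ∀ a ∈ m j, ∃ g c, g ∉ m j ∧ g * a = τ * c) :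
    ∃ (h : A) (f : κ → A), (∀ i, h ∉ M i) ∧ ∀ j, f j ∈ m j ∧ ∀ a ∈ m j, f j ∣ h * a := by
  classical
  have := Fintype.ofFinite κ
  have h1 (j) : ∃ f ∈ m j, ∃ h, (∀ i, h ∉ M i) ∧ ∀ a ∈ m j, f ∣ h * a := by
    obtain ⟨τ, hτ, hτm⟩ := hgen j
    obtain ⟨f, hf, hfM⟩ := exists_colon_not_le M (m j) (hfg j) hτ hτm
    let I : Ideal A :=
      { carrier := {h | ∀ a ∈ m j, f ∣ h * a}
        add_mem' := fun h h' a ha ↦ by rw [add_mul]; exact dvd_add (h a ha) (h' a ha)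
        zero_mem' := fun a _ ↦ by rw [zero_mul]; exact dvd_zero _
        smul_mem' := fun c h hh a ha ↦ by
          rw [smul_eq_mul, mul_assoc]; exact (hh a ha).mul_left c }
    obtain ⟨h, hhI, hh⟩ := exists_mem_forall_notMem (J := I) M (fun i ↦ inferInstance) fun i ↦ by
      obtain ⟨g, hg, hgm⟩ := hfM i
      exact ⟨g, hgm, hg⟩
    exact ⟨f, hf, h, hh, hhI⟩
  choose f hf h hh hhf using h1
  refine ⟨∏ j, h j, f, fun i hi ↦ ?_, fun j ↦ ⟨hf j, fun a ha ↦ ?_⟩⟩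
  · obtain ⟨j, -, hj⟩ := (Ideal.IsPrime.prod_mem_iff).mp hi
    exact hh j i hj
  · rw [← Finset.prod_erase_mul _ _ (Finset.mem_univ j), mul_assoc]
    exact (hhf j a ha).mul_left _

end LocallyPrincipal

section Points

variable {k : Type u} [Field k] {X : Scheme.{u}} {f : X ⟶ Spec (.of k)}

/-- A section of a separated morphism is a closed immersion. -/
theorem IsRationalPoint.isClosed [IsSeparated f] {x : X} (hx : IsRationalPoint f x) :
    IsClosed {x} := by
  obtain ⟨s, hs, hr⟩ := hx
  have : IsClosedImmersion (s ≫ f) := hs ▸ inferInstance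
  have : IsClosedImmersion s := IsClosedImmersion.of_comp s f
  exact hr ▸ s.isClosedEmbedding.isClosed_range

/-- A prime lies in a maximal ideal, whose residue field is finite over `k` by the Nullstellensatz.
An open neighbourhood of the specialization contains `x`, so charts are needed only at algebraic
points. -/
theorem exists_geometric_specialization [LocallyOfFiniteType f] (K : Type u) [Field K]
    [Algebra k K] [IsAlgClosed K] (x : X) : ∃ (ψ : Spec (.of K) ⟶ X) (t : Spec (.of K)),
      ψ ≫ f = Spec.map (CommRingCat.ofHom (algebraMap k K)) ∧ x ⤳ ψ t := by
  obtain ⟨_, ⟨V, hV : IsAffineOpen V, rfl⟩, hxV, -⟩ :=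
    X.isBasis_affineOpens.exists_subset_of_mem_open (Set.mem_univ x) isOpen_univ
  let := sectionsAlgebra f V
  have hft : Algebra.FiniteType k Γ(X, V) := finiteType_structureHom hV
  obtain ⟨m, hm, hle⟩ := Ideal.exists_le_maximal _
    (inferInstance : (hV.primeIdealOf ⟨x, hxV⟩).asIdeal.IsPrime).ne_top
  let := Ideal.Quotient.field m
  have : Algebra.FiniteType k (Γ(X, V) ⧸ m) :=
    Algebra.FiniteType.of_surjective (Ideal.Quotient.mkₐ k m) (Ideal.Quotient.mkₐ_surjective k m)
  have : Module.Finite k (Γ(X, V) ⧸ m) := finite_of_finite_type_of_isJacobsonRing k _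
  let l : Γ(X, V) ⧸ m →ₐ[k] K := IsAlgClosed.lift
  let χ : Γ(X, V) →ₐ[k] K := l.comp (Ideal.Quotient.mkₐ k m)
  have hχ : RingHom.ker χ = m := by
    ext a
    exact (map_eq_zero_iff l l.toRingHom.injective).trans Ideal.Quotient.eq_zero_iff_mem
  let t : Spec (.of K) := (⊥ : PrimeSpectrum K)
  refine ⟨Spec.map (CommRingCat.ofHom χ.toRingHom) ≫ hV.fromSpec, t, ?_, ?_⟩
  · rw [Category.assoc, fromSpec_comp_eq, ← Spec.map_comp]
    congr 1
    ext c
    exact χ.commutes c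
  · rw [Scheme.Hom.comp_apply]
    have h1 : hV.primeIdealOf ⟨x, hxV⟩ ⤳ Spec.map (CommRingCat.ofHom χ.toRingHom) t := by
      refine (PrimeSpectrum.le_iff_specializes _ _).mp ?_
      change (hV.primeIdealOf ⟨x, hxV⟩).asIdeal ≤ (RingHom.ker χ)
      rw [hχ]
      exact hle
    have h2 := h1.map hV.fromSpec.continuous
    rwa [hV.fromSpec_primeIdealOf] at h2

end Points

section GoodAffine

variable {k K : Type u} [Field k] [Field K] [Algebra k K] [Algebra.IsAlgebraic k K] {X : Scheme.{u}}
  {f : X ⟶ Spec (.of k)}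

theorem dvd_of_basicOpen {U : X.Opens} (h a b : Γ(X, U))
    (s : Γ(X, X.basicOpen h)) (hle : X.basicOpen h ≤ U) {N : ℕ}
    (hs : X.presheaf.map (homOfLE hle).op h ^ N * s = X.presheaf.map (homOfLE hle).op b)
    (hdvd : a ∣ h * b) : X.presheaf.map (homOfLE hle).op a ∣ s := by
  have hu : IsUnit (X.presheaf.map (homOfLE hle).op h) := RingedSpace.isUnit_res_basicOpen _ h
  have h1 := map_dvd (X.presheaf.map (homOfLE hle).op).hom hdvd
  rw [map_mul] at h1
  change X.presheaf.map (homOfLE hle).op a ∣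
    X.presheaf.map (homOfLE hle).op h * X.presheaf.map (homOfLE hle).op b at h1
  rw [← hs] at h1
  exact (hu.pow N).dvd_mul_left.mp (hu.dvd_mul_left.mp h1)

/-- Algebraic points of a smooth separated curve lie in an affine open subset on which each of the
given rational points is either absent or one of these points, and then has a principal ideal. -/
theorem exists_isAffineOpen_principal [SmoothOfRelativeDimension 1 f] [IsSeparated f] {n : ℕ}
    (ψ : Fin n → (Spec (.of K) ⟶ X))
    (hψ : ∀ i, ψ i ≫ f = Spec.map (CommRingCat.ofHom (algebraMap k K))) (t : Spec (.of K))
    {S : Set X} (hS : S.Finite) (hSr : ∀ s ∈ S, IsRationalPoint f s) :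
    ∃ U : X.Opens, IsAffineOpen U ∧ (∀ i, ψ i t ∈ U) ∧
      ∃ (r : ℕ) (z : Fin r → X) (idx : Fin r → Fin n) (e : Fin r → Γ(X, U)),
        Function.Injective z ∧ (∀ j, ψ (idx j) t = z j) ∧ (∀ j, z j ∈ S) ∧
          (∀ j a, z j ∉ X.basicOpen a ↔ e j ∣ a) ∧
            ∀ x ∈ U, x ∈ S ↔ ∃ j, x ∉ X.basicOpen (e j) := by
  classical
  have : Smooth f := SmoothOfRelativeDimension.smooth 1 f
  have : IsLocallyNoetherian X := isLocallyNoetherian_of_locallyOfFiniteType f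
  obtain ⟨U₀, hU₀, hxU₀⟩ := exists_isAffineOpen_forall_mem (ι := ULift (Fin n))
    (fun i ↦ ψ i.down) (fun i ↦ hψ i.down) t
  let Z : Set X := Set.range fun i ↦ ψ i t
  -- Points of `S` that are not among the given points are finite in number and closed, so they can
  -- be removed.
  let W : X.Opens := ⟨(S \ Z)ᶜ, by
    rw [isOpen_compl_iff, ← Set.biUnion_of_singleton (S \ Z)]
    exact (hS.subset Set.sdiff_subset).isClosed_biUnion fun s hs ↦ (hSr s hs.1).isClosed⟩
  obtain ⟨a, haW, hxa⟩ := exists_basicOpen_le_forall_mem hU₀ (W := W) (fun i ↦ ψ i t)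
    (fun i ↦ hxU₀ ⟨i⟩) fun i h ↦ h.2 ⟨i, rfl⟩
  let U₁ := X.basicOpen a
  have hU₁ : IsAffineOpen U₁ := hU₀.basicOpen a
  let := sectionsAlgebra f U₁
  have hnoeth : IsNoetherianRing Γ(X, U₁) := IsLocallyNoetherian.component_noetherian ⟨U₁, hU₁⟩
  have hsm := locally_isStandardSmooth_structureHom (f := f) (n := 1) hU₁
  choose χ hχ using fun i ↦ exists_evaluation_of_isAffineOpen (ψ i) (hψ i) hU₁ t (hxa i)
  have hSZ : (S ∩ Z).Finite := hS.subset Set.inter_subset_left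
  let r := hSZ.toFinset.card
  let z : Fin r → X := fun j ↦ hSZ.toFinset.equivFin.symm j
  have hz : Function.Injective z :=
    Subtype.val_injective.comp hSZ.toFinset.equivFin.symm.injective
  have hzmem (j) : z j ∈ S ∩ Z := hSZ.mem_toFinset.mp (hSZ.toFinset.equivFin.symm j).2
  have hzsurj (x) (hx : x ∈ S ∩ Z) : ∃ j, z j = x :=
    ⟨hSZ.toFinset.equivFin ⟨x, hSZ.mem_toFinset.mpr hx⟩, by simp [z]⟩
  choose idx hidx' using fun j ↦ (hzmem j).2
  have hidx (j) : ψ (idx j) t = z j := hidx' j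
  have hmax (i) : (RingHom.ker (χ i)).IsMaximal := ker_isMaximal_of_isAlgebraic (χ i)
  obtain ⟨h, e, hh, he⟩ := exists_generators_of_locally_principal
    (fun i ↦ RingHom.ker (χ i)) (fun j ↦ RingHom.ker (χ (idx j)))
    (fun j ↦ IsNoetherian.noetherian _) fun j ↦ exists_local_generator hsm (χ (idx j))
  have hker (i) (c : Γ(X, U₁)) : ψ i t ∉ X.basicOpen c ↔ c ∈ RingHom.ker (χ i) := by
    rw [mem_basicOpen_iff_notMem_primeIdealOf hU₁ c ⟨_, hxa i⟩, not_not, hχ]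
  have hle : X.basicOpen h ≤ U₁ := X.basicOpen_le h
  have hxh (i) : ψ i t ∈ X.basicOpen h := by
    by_contra hcon
    exact hh i ((hker i h).mp hcon)
  let res := X.presheaf.map (homOfLE hle).op
  have hres (c : Γ(X, U₁)) (x) (hx : x ∈ X.basicOpen h) :
      x ∈ X.basicOpen (res c) ↔ x ∈ X.basicOpen c := by
    rw [Scheme.basicOpen_res]
    exact ⟨fun h ↦ h.2, fun h ↦ ⟨hx, h⟩⟩
  have hze (j) : z j ∉ X.basicOpen (res (e j)) := by
    rw [hres _ _ (hidx j ▸ hxh (idx j)), ← hidx j]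
    exact (hker _ _).mpr (he j).1
  refine ⟨X.basicOpen h, hU₁.basicOpen h, hxh, r, z, idx, fun j ↦ res (e j), hz, hidx,
    fun j ↦ (hzmem j).1, fun j c ↦ ⟨fun hc ↦ ?_, fun ⟨c', hc⟩ hj ↦ ?_⟩, fun x hx ↦
    ⟨fun hxS ↦ ?_, fun ⟨j, hj⟩ ↦ ?_⟩⟩
  · have hloc := hU₁.isLocalization_basicOpen h
    let := res.hom.toAlgebra
    have hloc : IsLocalization.Away h Γ(X, X.basicOpen h) := hloc
    obtain ⟨N, b, hb⟩ := IsLocalization.Away.surj h c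
    have hb' : res h ^ N * c = res b := by
      rw [mul_comm]
      exact hb
    refine dvd_of_basicOpen h (e j) b c hle hb' ((he j).2 b ?_)
    rw [← hker, ← hres _ _ (hxh _), ← hb', Scheme.basicOpen_mul, hidx]
    exact fun hcon ↦ hc hcon.2
  · rw [hc, Scheme.basicOpen_mul] at hj
    exact hze j hj.1
  · have hxZ : x ∈ Z := by
      by_contra hxZ
      exact haW (hle hx) ⟨hxS, hxZ⟩
    obtain ⟨j, rfl⟩ := hzsurj x ⟨hxS, hxZ⟩
    exact ⟨j, hze j⟩
  · rw [hres _ _ hx, mem_basicOpen_iff_notMem_primeIdealOf hU₁ _ ⟨x, hle hx⟩, not_not] at hj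
    -- A zero of `e j` where `h` is invertible contains the ideal of `z j`, since `h` carries that
    -- ideal into `(e j)`; by maximality it is `z j`.
    have h1 : RingHom.ker (χ (idx j)) ≤ (hU₁.primeIdealOf ⟨x, hle hx⟩).asIdeal := fun c hc ↦
      ((inferInstance : (hU₁.primeIdealOf ⟨x, hle hx⟩).asIdeal.IsPrime).mem_or_mem
        (Ideal.mem_of_dvd _ ((he j).2 c hc) hj)).resolve_left
        ((mem_basicOpen_iff_notMem_primeIdealOf hU₁ _ ⟨x, hle hx⟩).mp hx)
    have h2 := (hmax (idx j)).eq_of_le Ideal.IsPrime.ne_top' h1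
    have h3 : x = z j := by
      refine eq_of_forall_mem_basicOpen_iff hU₁ (hle hx) (hidx j ▸ hxa (idx j)) fun c ↦ ?_
      rw [← hidx j, ← not_iff_not (a := x ∈ _), ← not_iff_not, not_not, not_not, ← not_iff_not,
        hker, h2, mem_basicOpen_iff_notMem_primeIdealOf hU₁ _ ⟨x, hle hx⟩, not_not]
    exact h3 ▸ (hzmem j).1

end GoodAffine

/-! ### Charts everywhere and normal crossings. -/

section SymmetricPower

variable {k : Type u} [Field k] {X P Y : Scheme.{u}} {n : ℕ} {f : X ⟶ Spec (.of k)}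
  {p : P ⟶ Spec (.of k)} {π : Fin n → (P ⟶ X)} {q : P ⟶ Y} {g : Y ⟶ Spec (.of k)}

theorem IsSymmetricPower.exists_etale_chart_of_finite [SmoothOfRelativeDimension 1 f]
    [IsSeparated f] (h : IsSymmetricPower f p π q g) {S : Set X} (hS : S.Finite)
    (hSr : ∀ s ∈ S, IsRationalPoint f s) (y : Y) :
    ∃ (W : Y.Opens) (c : (W : Scheme.{u}) ⟶ affineSpace k n) (J : Finset (Fin n)), y ∈ W ∧
      Etale c ∧ c ≫ affineSpaceHom k n = W.ι ≫ g ∧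
        W.ι ⁻¹' symmetricLocus π q S = c ⁻¹' ⋃ j ∈ J, coordinateHyperplane k n j := by
  have hP := h.isFibrePower
  have : SmoothOfRelativeDimension n p := hP.smoothOfRelativeDimension
  have : Smooth p := SmoothOfRelativeDimension.smooth n p
  obtain ⟨x, rfl⟩ := IsSymmetricQuotient.surjective hP h.isSymmetricQuotient y
  obtain ⟨ψ, t, hψ, hxt⟩ := exists_geometric_specialization (f := p) (AlgebraicClosure k) x
  obtain ⟨U, hU, hxU, r, z, idx, e, hz, hidx, hzS, he, hSe⟩ := exists_isAffineOpen_principal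
    (fun i ↦ ψ ≫ π i) (fun i ↦ by rw [Category.assoc, hP.w i, hψ]) t hS hSr
  obtain ⟨W, c, J, hW, hc⟩ := h.exists_etale_chart ψ hψ (ψ t) t rfl hU
    (fun i ↦ by simpa using hxU i) S z hz idx (fun j ↦ by simpa using hidx j)
    (fun j ↦ by
      obtain ⟨s, hs, hr⟩ := hSr _ (hzS j)
      have hst : s (⊥ : PrimeSpectrum k) = z j := by
        have : s (⊥ : PrimeSpectrum k) ∈ Set.range s := ⟨_, rfl⟩
        rwa [hr] at this
      have hzU : z j ∈ U := hidx j ▸ hxU (idx j)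
      obtain ⟨χ, hχ⟩ := exists_evaluation (L := k) s (hs.trans (by
        rw [Algebra.algebraMap_self]
        exact (Spec.map_id _).symm)) U _ (hst ▸ hzU)
      exact ⟨χ, fun a ↦ hst ▸ hχ a⟩)
    e he hSe
  -- The chart was built at the image of the algebraic specialization; being open, it contains the
  -- generization `q x` as well.
  exact ⟨W, c, J, (hxt.map q.continuous).mem_open W.2 hW, hc⟩

end SymmetricPower

section NormalCrossings

variable {k : Type u} [Field k] {Y : Scheme.{u}} {n : ℕ}

theorem isRegularLocalRing_stalk_of_etale {W : Y.Opens} (c : (W : Scheme.{u}) ⟶ affineSpace k n)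
    [Etale c] (Z : Set Y) (J : Finset (Fin n))
    (hZ : W.ι ⁻¹' Z = c ⁻¹' ⋃ j ∈ J, coordinateHyperplane k n j) (y : Y) (hy : y ∈ W) :
    IsRegularLocalRing (Y.presheaf.stalk y) ∧ ∃ (r : ℕ) (f : Fin r → Y.presheaf.stalk y),
      IsPartOfRegularSystem f ∧
        Y.fromSpecStalk y ⁻¹' Z = PrimeSpectrum.zeroLocus {∏ i, f i} := by
  classical
  obtain ⟨_, ⟨V : Y.Opens, hV : IsAffineOpen V, rfl⟩, hyV, hVW : V ≤ W⟩ :=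
    Y.isBasis_affineOpens.exists_subset_of_mem_open hy W.2
  let T := MvPolynomial (Fin n) k
  obtain ⟨φ, hφ⟩ := Spec.map_surjective (hV.isoSpec.inv ≫ Y.homOfLE hVW ≫ c)
  have hφet : φ.hom.Etale := by
    refine (HasRingHomProperty.Spec_iff (P := @Etale)).mp ?_
    rw [hφ]
    infer_instance
  have hc : Y.homOfLE hVW ≫ c = V.toSpecΓ ≫ Spec.map (CommRingCat.ofHom φ.hom) := by
    rw [← IsAffineOpen.isoSpec_hom hV, ← Iso.inv_comp_eq]
    exact hφ.symm
  have hmem (v : Y) (hv : v ∈ V) : v ∈ Z ↔ ∃ j ∈ J, v ∉ Y.basicOpen (φ.hom (MvPolynomial.X j)) := by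
    have h1 : v ∈ Z ↔ c ⟨v, hVW hv⟩ ∈ ⋃ j ∈ J, coordinateHyperplane k n j :=
      iff_of_eq congr((⟨v, hVW hv⟩ : W) ∈ $hZ)
    have h2 : c ⟨v, hVW hv⟩ = (V.toSpecΓ ≫ Spec.map (CommRingCat.ofHom φ.hom)) ⟨v, hv⟩ := by
      rw [← hc]
      have h3 : Y.homOfLE hVW ⟨v, hv⟩ = (⟨v, hVW hv⟩ : W) := Subtype.ext <| by
        change (Y.homOfLE hVW ≫ W.ι) _ = v
        rw [Scheme.homOfLE_ι]
        rfl
      exact congrArg c h3.symm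
    rw [h1, h2]
    simp only [Set.mem_iUnion, exists_prop]
    exact exists_congr fun j ↦ and_congr_right fun _ ↦
      toSpecΓ_SpecMap_mem_zeroLocus_iff φ.hom ⟨v, hv⟩ _
  let q := (hV.primeIdealOf ⟨y, hyV⟩).asIdeal
  let := Y.presheaf.algebra_section_stalk (U := V) ⟨y, hyV⟩
  have : IsLocalization.AtPrime (Y.presheaf.stalk y) q := hV.isLocalization_stalk ⟨y, hyV⟩
  let := φ.hom.toAlgebra
  have : Algebra.Etale T Γ(Y, V) := hφet
  obtain ⟨hreg, hpart⟩ := isRegular_of_etale_mvPolynomial (k := k) (n := n) q (Y.presheaf.stalk y)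
  refine ⟨hreg, ?_⟩
  -- Only coordinates vanishing at `y` can belong to a system of parameters; the others become units
  -- in the stalk and do not affect the zero locus.
  let J' := J.filter fun j ↦ φ.hom (MvPolynomial.X j) ∈ q
  let enum : Fin J'.card → Fin n := fun i ↦ J'.equivFin.symm i
  have henum (i) : enum i ∈ J' := (J'.equivFin.symm i).2
  let γ := algebraMap Γ(Y, V) (Y.presheaf.stalk y)
  refine ⟨J'.card, fun i ↦ γ (φ.hom (MvPolynomial.X (enum i))),
    hpart enum (Subtype.val_injective.comp J'.equivFin.symm.injective)
      fun i ↦ (Finset.mem_filter.mp (henum i)).2, ?_⟩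
  ext s
  have hs : Y.fromSpecStalk y s = hV.fromSpec (Spec.map (Y.presheaf.germ V y hyV) s) := by
    rw [← hV.fromSpecStalk_eq_fromSpecStalk hyV, IsAffineOpen.fromSpecStalk]
    rfl
  have hsV : Y.fromSpecStalk y s ∈ V := by
    rw [hs]
    exact hV.range_fromSpec.le ⟨_, rfl⟩
  have hD (a : Γ(Y, V)) : Y.fromSpecStalk y s ∉ Y.basicOpen a ↔ γ a ∈ s.asIdeal := by
    have h1 := congr(Spec.map (Y.presheaf.germ V y hyV) s ∈ $(hV.fromSpec_preimage_basicOpen a))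
    have h2 : hV.fromSpec (Spec.map (Y.presheaf.germ V y hyV) s) ∈ Y.basicOpen a ↔
      γ a ∉ s.asIdeal := iff_of_eq h1
    rw [hs, h2, not_not]
  have h3 : s ∈ Y.fromSpecStalk y ⁻¹' Z ↔ ∃ j ∈ J, γ (φ.hom (MvPolynomial.X j)) ∈ s.asIdeal := by
    rw [Set.mem_preimage, hmem _ hsV]
    exact exists_congr fun j ↦ and_congr_right fun _ ↦ hD _
  rw [h3]
  have h4 : s ∈ (PrimeSpectrum.zeroLocus {∏ i, γ (φ.hom (MvPolynomial.X (enum i)))} : Set _) ↔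
      ∃ i, γ (φ.hom (MvPolynomial.X (enum i))) ∈ s.asIdeal := by
    have := s.isPrime
    refine Set.singleton_subset_iff.trans ((Ideal.IsPrime.prod_mem_iff (p := s.asIdeal)).trans ?_)
    simp
  refine Iff.trans ⟨fun ⟨j, hj, hjs⟩ ↦ ?_, fun ⟨i, hi⟩ ↦
    ⟨enum i, (Finset.mem_filter.mp (henum i)).1, hi⟩⟩ h4.symm
  have hjq : φ.hom (MvPolynomial.X j) ∈ q := by
    by_contra hjq
    exact s.isPrime.ne_top (Ideal.eq_top_of_isUnit_mem _ hjs
      (IsLocalization.map_units (M := q.primeCompl) _ ⟨_, hjq⟩))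
  have hjJ : j ∈ J' := Finset.mem_filter.mpr ⟨hj, hjq⟩
  exact ⟨J'.equivFin ⟨j, hjJ⟩, by simpa [enum] using hjs⟩

theorem isNormalCrossingsDivisor_of_etale_charts (Z : Set Y)
    (h : ∀ y : Y, ∃ (W : Y.Opens) (c : (W : Scheme.{u}) ⟶ affineSpace k n) (J : Finset (Fin n)),
      y ∈ W ∧ Etale c ∧ W.ι ⁻¹' Z = c ⁻¹' ⋃ j ∈ J, coordinateHyperplane k n j) :
    IsNormalCrossingsDivisor Y Z := by
  choose W c J hyW hc hZ using h
  refine ⟨?_, fun y ↦ (isRegularLocalRing_stalk_of_etale (c y) Z (J y) (hZ y) y (hyW y)).1, ?_,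
    fun y ↦ (isRegularLocalRing_stalk_of_etale (c y) Z (J y) (hZ y) y (hyW y)).2⟩
  · have hcover : ⨆ y, W y = ⊤ := top_le_iff.mp fun y _ ↦
      TopologicalSpace.Opens.mem_iSup.mpr ⟨y, hyW y⟩
    refine (isLocallyNoetherian_iff_openCover (Y.openCoverOfIsOpenCover W hcover)).mpr fun y ↦ ?_
    change IsLocallyNoetherian (W y)
    have := hc y
    exact LocallyOfFiniteType.isLocallyNoetherian (c y)
  · rw [← isOpen_compl_iff, isOpen_iff_forall_mem_open]
    intro y hy
    refine ⟨(W y).ι '' ((W y).ι ⁻¹' Zᶜ), ?_, ?_, ⟨⟨y, hyW y⟩, hy, rfl⟩⟩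
    · rintro _ ⟨w, hw, rfl⟩
      exact hw
    · refine (W y).ι.isOpenEmbedding.isOpenMap _ ?_
      rw [Set.preimage_compl, hZ, isOpen_compl_iff]
      refine IsClosed.preimage (c y).continuous ?_
      exact (J y).finite_toSet.isClosed_biUnion fun j _ ↦ PrimeSpectrum.isClosed_zeroLocus _

end NormalCrossings

/-! ### Quotients of affine schemes are determined by global functions. -/

section Localization

variable {G C G' C' : Type*} [CommRing G] [CommRing C] [CommRing G'] [CommRing C'] [Algebra G G']
  [Algebra C C']

theorem injective_of_isLocalization_away (Φ : G →+* C) (Φ' : G' →+* C') (b : G)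
    [IsLocalization.Away b G'] [IsLocalization.Away (Φ b) C']
    (hΦ : ∀ a, Φ' (algebraMap G G' a) = algebraMap C C' (Φ a)) (hinj : Function.Injective Φ) :
    Function.Injective Φ' := by
  rw [injective_iff_map_eq_zero]
  intro s hs
  obtain ⟨N, e, he⟩ := IsLocalization.Away.surj b s
  have h1 : algebraMap C C' (Φ e) = algebraMap C C' 0 := by
    rw [← hΦ, ← he, map_mul, hs, zero_mul, map_zero]
  obtain ⟨M, hM⟩ := IsLocalization.Away.exists_of_eq (Φ b) h1
  rw [mul_zero, ← map_pow, ← map_mul, map_eq_zero_iff Φ hinj] at hM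
  have hu : IsUnit (algebraMap G G' b) := IsLocalization.Away.algebraMap_isUnit b
  have h2 : algebraMap G G' b ^ M * algebraMap G G' e = 0 := by
    rw [← map_pow, ← map_mul, hM, map_zero]
  rw [(hu.pow M).mul_right_eq_zero, ← he] at h2
  exact (hu.pow N).mul_left_eq_zero.mp h2

theorem exists_of_invariant_of_isLocalization_away (Φ : G →+* C) (Φ' : G' →+* C') (b : G)
    [IsLocalization.Away b G'] [IsLocalization.Away (Φ b) C']
    (hΦ : ∀ a, Φ' (algebraMap G G' a) = algebraMap C C' (Φ a))
    {ι : Type*} [Finite ι] (α : ι → (C →+* C))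
    (α' : ι → (C' →+* C')) (hα : ∀ i c, α' i (algebraMap C C' c) = algebraMap C C' (α i c))
    (hαΦ : ∀ i a, α i (Φ a) = Φ a) (hex : ∀ c, (∀ i, α i c = c) → ∃ a, Φ a = c) (c' : C')
    (hc' : ∀ i, α' i c' = c') : ∃ a', Φ' a' = c' := by
  classical
  have := Fintype.ofFinite ι
  obtain ⟨N, c, hc⟩ := IsLocalization.Away.surj (Φ b) c'
  have h1 (i) : ∃ M : ℕ, Φ b ^ M * α i c = Φ b ^ M * c := by
    refine IsLocalization.Away.exists_of_eq (S := C') (Φ b) ?_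
    rw [← hα, ← hc, map_mul, hc', map_pow, hα, hαΦ]
  choose M hM using h1
  -- The numerator is invariant only up to a power of `b` depending on `i`; the sum of the exponents
  -- works for all `i` at once.
  obtain ⟨e, he⟩ := hex (Φ b ^ (∑ i, M i) * c) fun i ↦ by
    rw [map_mul, map_pow, hαΦ, ← Finset.sum_erase_add _ _ (Finset.mem_univ i), pow_add, mul_assoc,
      mul_assoc, hM]
  have hu : IsUnit (algebraMap G G' b) := IsLocalization.Away.algebraMap_isUnit b
  have hv : IsUnit (algebraMap C C' (Φ b)) := IsLocalization.Away.algebraMap_isUnit (Φ b)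
  obtain ⟨v, hv'⟩ := hu.pow ((∑ i, M i) + N)
  refine ⟨algebraMap G G' e * ↑v⁻¹, (hv.pow ((∑ i, M i) + N)).mul_left_cancel ?_⟩
  have h2 : algebraMap C C' (Φ b) ^ ((∑ i, M i) + N) = Φ' v := by
    rw [hv', map_pow, hΦ]
  rw [h2, ← map_mul, mul_left_comm, Units.mul_inv, mul_one, hΦ, he, ← h2, map_mul, map_pow, pow_add,
    mul_assoc, mul_comm _ c', hc]

end Localization

section AffineQuotient

variable {B X P Y : Scheme.{u}} {n : ℕ} {f : X ⟶ B} {p : P ⟶ B} {π : Fin n → (P ⟶ X)} {q : P ⟶ Y}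

theorem app_map (q : P ⟶ Y) {U V : Y.Opens} (h : V ≤ U) (a : Γ(Y, U)) :
    q.app V (Y.presheaf.map (homOfLE h).op a) =
      P.presheaf.map (homOfLE (q.preimage_mono h)).op (q.app U a) :=
  congr($(q.naturality (homOfLE h).op) a)

theorem appLE_map_eq {h : P ⟶ P} {U V : P.Opens} (e : V ≤ U) (hU : U ≤ h ⁻¹ᵁ U) (hV : V ≤ h ⁻¹ᵁ V)
    (a : Γ(P, U)) : h.appLE V V hV (P.presheaf.map (homOfLE e).op a) =
      P.presheaf.map (homOfLE e).op (h.appLE U U hU a) := by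
  rw [← CommRingCat.comp_apply, ← CommRingCat.comp_apply, Scheme.Hom.map_appLE,
    Scheme.Hom.appLE_map]

/-- For affine schemes, the quotient by the symmetric group can be recognized on global
functions. -/
theorem isSymmetricQuotient_of_isAffine [IsAffine P] [IsAffine Y] (hP : IsFibrePower f p π)
    (hinv : ∀ σ, hP.perm σ ≫ q = q) (hinj : Function.Injective q.appTop.hom)
    (hex : ∀ a : Γ(P, ⊤), (∀ σ, (hP.perm σ).appTop a = a) → ∃ b, q.appTop b = a) :
    IsSymmetricQuotient p π q := by
  have hYa := isAffineOpen_top Y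
  have hPa := isAffineOpen_top P
  have hpre (b : Γ(Y, ⊤)) : q ⁻¹ᵁ Y.basicOpen b = P.basicOpen (q.appTop b) :=
    Scheme.preimage_basicOpen_top q b
  have hinjD (b : Γ(Y, ⊤)) : Function.Injective (q.app (Y.basicOpen b)).hom := by
    let := (Y.presheaf.map (homOfLE (le_top : Y.basicOpen b ≤ ⊤)).op).hom.toAlgebra
    let := (P.presheaf.map (homOfLE (le_top : q ⁻¹ᵁ Y.basicOpen b ≤ ⊤)).op).hom.toAlgebra
    have h1 : IsLocalization.Away b Γ(Y, Y.basicOpen b) := hYa.isLocalization_basicOpen b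
    have h2 : IsLocalization.Away (q.appTop.hom b) Γ(P, q ⁻¹ᵁ Y.basicOpen b) :=
      hPa.isLocalization_of_eq_basicOpen _ (homOfLE le_top) (hpre b)
    exact injective_of_isLocalization_away q.appTop.hom _ b (fun a ↦ app_map q le_top a) hinj
  have hinjU (U : Y.Opens) : Function.Injective (q.app U).hom := by
    rw [injective_iff_map_eq_zero]
    intro s hs
    refine TopCat.Presheaf.section_ext Y.sheaf U s 0 fun y hy ↦ ?_
    obtain ⟨b, hbU, hyb⟩ := hYa.exists_basicOpen_le ⟨y, hy⟩ trivial
    have h1 : Y.presheaf.map (homOfLE hbU).op s = 0 := hinjD b <| by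
      rw [map_zero]
      refine (app_map q hbU s).trans ?_
      rw [show q.app U s = 0 from hs, map_zero]
    have h2 := Y.presheaf.germ_res_apply (homOfLE hbU) y hyb s
    rw [h1, map_zero] at h2
    rw [map_zero]
    exact h2.symm
  have hinv' : ∀ (σ : Equiv.Perm (Fin n)) (h : P ⟶ P), PermutesBy p π σ h → h ≫ q = q :=
    fun σ h H ↦ by rw [hP.eq_perm H, hinv]
  refine ⟨inferInstance, hinv', hinjU, fun U a ha ↦ ?_⟩
  have hle (σ) (V : Y.Opens) := le_preimage_of_comp_eq (hinv σ) V
  have haD (b : Γ(Y, ⊤)) (hb : Y.basicOpen b ≤ U) : ∃ s, q.app (Y.basicOpen b) s =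
      P.presheaf.map (homOfLE (q.preimage_mono hb)).op a := by
    let := (Y.presheaf.map (homOfLE (le_top : Y.basicOpen b ≤ ⊤)).op).hom.toAlgebra
    let := (P.presheaf.map (homOfLE (le_top : q ⁻¹ᵁ Y.basicOpen b ≤ ⊤)).op).hom.toAlgebra
    have h1 : IsLocalization.Away b Γ(Y, Y.basicOpen b) := hYa.isLocalization_basicOpen b
    have h2 : IsLocalization.Away (q.appTop.hom b) Γ(P, q ⁻¹ᵁ Y.basicOpen b) :=
      hPa.isLocalization_of_eq_basicOpen _ (homOfLE le_top) (hpre b)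
    refine exists_of_invariant_of_isLocalization_away q.appTop.hom (q.app (Y.basicOpen b)).hom b
      (fun c ↦ app_map q le_top c) (fun σ ↦ (hP.perm σ).appTop.hom)
      (fun σ ↦ ((hP.perm σ).appLE _ _ (hle σ _)).hom) (fun σ c ↦ ?_) (fun σ c ↦ ?_) hex _
      fun σ ↦ ?_
    · have := appLE_map_eq (h := hP.perm σ) (le_top : q ⁻¹ᵁ Y.basicOpen b ≤ ⊤) le_top (hle σ _) c
      have h3 : (hP.perm σ).appLE ⊤ ⊤ le_top = (hP.perm σ).appTop :=
        Scheme.Hom.appLE_eq_app (hP.perm σ)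
      rw [h3] at this
      exact this
    · have := congr(($(hinv σ)).appTop c)
      rw [Scheme.Hom.comp_appTop, CommRingCat.comp_apply] at this
      exact this
    · refine (appLE_map_eq (q.preimage_mono hb) (hle σ U) (hle σ _) a).trans ?_
      congr 1
      exact ha σ _ (hP.permutesBy_perm σ)
  let ι := {b : Γ(Y, ⊤) // Y.basicOpen b ≤ U}
  choose s hs using fun b : ι ↦ haD b.1 b.2
  -- The descended sections on basic open subsets agree on overlaps because pullback along `q` is
  -- injective and their pullbacks are restrictions of `a`.
  obtain ⟨τ, hτ⟩ : ∃ τ : Γ(Y, U), ∀ b : ι, Y.presheaf.map (homOfLE b.2).op τ = s b := by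
    refine (Y.sheaf.existsUnique_gluing' (fun b : ι ↦ Y.basicOpen b.1) U (fun b ↦ homOfLE b.2)
      (fun y hy ↦ ?_) s fun b c ↦ ?_).exists
    · obtain ⟨b, hbU, hyb⟩ := hYa.exists_basicOpen_le ⟨y, hy⟩ trivial
      exact TopologicalSpace.Opens.mem_iSup.mpr ⟨⟨b, hbU⟩, hyb⟩
    · refine hinjU (Y.basicOpen b.1 ⊓ Y.basicOpen c.1) ?_
      refine (app_map q inf_le_left (s b)).trans (Eq.trans ?_ (app_map q inf_le_right (s c)).symm)
      rw [hs, hs, ← CommRingCat.comp_apply, ← CommRingCat.comp_apply, ← Functor.map_comp,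
        ← Functor.map_comp]
      rfl
  refine ⟨τ, TopCat.Presheaf.section_ext P.sheaf (q ⁻¹ᵁ U) _ _ fun x hx ↦ ?_⟩
  obtain ⟨b, hbU, hxb⟩ := hYa.exists_basicOpen_le ⟨q x, hx⟩ trivial
  have h1 : P.presheaf.map (homOfLE (q.preimage_mono hbU)).op (q.app U τ) =
      P.presheaf.map (homOfLE (q.preimage_mono hbU)).op a :=
    (app_map q hbU τ).symm.trans ((congrArg _ (hτ ⟨b, hbU⟩)).trans (hs ⟨b, hbU⟩))
  have h2 := P.presheaf.germ_res_apply (homOfLE (q.preimage_mono hbU)) x hxb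
  exact (h2 _).symm.trans ((congrArg _ h1).trans (h2 _))

end AffineQuotient

/-! ### The affine line and elementary symmetric polynomials. -/

section AffineLine

variable (k : Type u) [Field k] (n : ℕ)

theorem isCoproductPower_aeval_X : IsCoproductPower (k := k) (A := Polynomial k)
    (C := MvPolynomial (Fin n) k) fun i ↦ Polynomial.aeval (MvPolynomial.X i) := by
  intro D _ _ φ
  refine ⟨MvPolynomial.aeval fun i ↦ φ i Polynomial.X, fun i ↦ ?_, fun ψ hψ ↦ ?_⟩
  · refine Polynomial.algHom_ext ?_
    simp
  · refine MvPolynomial.algHom_ext fun i ↦ ?_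
    rw [MvPolynomial.aeval_X, ← hψ i]
    simp

theorem isFibrePower_affineSpace :
    IsFibrePower (affineLineHom k) (affineSpaceHom k n) (coordinate k n) :=
  (isCoproductPower_aeval_X k n).isFibrePower

theorem perm_affineSpace (σ : Equiv.Perm (Fin n)) : (isFibrePower_affineSpace k n).perm σ =
    Spec.map (CommRingCat.ofHom (MvPolynomial.rename (R := k) σ).toRingHom) := by
  refine ((isFibrePower_affineSpace k n).eq_perm ⟨?_, fun i ↦ ?_⟩).symm
  · rw [affineSpaceHom, ← Spec.map_comp]
    congr 1
    exact CommRingCat.hom_ext (RingHom.ext fun c ↦ (MvPolynomial.rename (R := k) σ).commutes c)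
  · rw [coordinate, coordinate, ← Spec.map_comp]
    congr 1
    refine CommRingCat.hom_ext ?_
    have : (MvPolynomial.rename (R := k) σ).comp (Polynomial.aeval (MvPolynomial.X i)) =
        Polynomial.aeval (MvPolynomial.X (σ i)) := Polynomial.algHom_ext (by simp)
    exact congrArg AlgHom.toRingHom this

/-- The elementary symmetric polynomials as a homomorphism of algebras. -/
noncomputable def esymmHom : MvPolynomial (Fin n) k →ₐ[k] MvPolynomial (Fin n) k :=
  MvPolynomial.aeval fun i : Fin n ↦ MvPolynomial.esymm (Fin n) k (i + 1)

theorem esymmHom_injective : Function.Injective (esymmHom k n) := fun a b h ↦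
  MvPolynomial.esymmAlgHom_injective (σ := Fin n) (R := k) (n := n) (by simp) <| Subtype.ext <| by
    rw [MvPolynomial.esymmAlgHom_apply, MvPolynomial.esymmAlgHom_apply]
    exact h

theorem rename_esymmHom (σ : Equiv.Perm (Fin n)) (a : MvPolynomial (Fin n) k) :
    MvPolynomial.rename σ (esymmHom k n a) = esymmHom k n a := by
  have h := (MvPolynomial.esymmAlgHom (Fin n) k n a).2 σ
  rwa [MvPolynomial.esymmAlgHom_apply] at h

theorem exists_esymmHom_eq (a : MvPolynomial (Fin n) k)
    (ha : ∀ σ : Equiv.Perm (Fin n), MvPolynomial.rename σ a = a) : ∃ b, esymmHom k n b = a := by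
  obtain ⟨b, hb⟩ := MvPolynomial.esymmAlgHom_surjective (σ := Fin n) (R := k) (n := n) (by simp)
    ⟨a, ha⟩
  refine ⟨b, ?_⟩
  have := congrArg Subtype.val hb
  rwa [MvPolynomial.esymmAlgHom_apply] at this

theorem isSymmetricPower_affineLine : IsSymmetricPower (affineLineHom k) (affineSpaceHom k n)
    (coordinate k n) (elementarySymmetric k n) (affineSpaceHom k n) := by
  have hP := isFibrePower_affineSpace k n
  have hq : elementarySymmetric k n =
    Spec.map (CommRingCat.ofHom (esymmHom k n).toRingHom) := rfl
  let A := CommRingCat.of (MvPolynomial (Fin n) k)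
  have hnat (φ : MvPolynomial (Fin n) k →ₐ[k] MvPolynomial (Fin n) k) (a : A) :
      (Spec.map (CommRingCat.ofHom φ.toRingHom)).appTop ((Scheme.ΓSpecIso A).inv a) =
        (Scheme.ΓSpecIso A).inv (φ a) :=
    congr($(Scheme.ΓSpecIso_inv_naturality (CommRingCat.ofHom φ.toRingHom)) a).symm
  have hinj : Function.Injective (Scheme.ΓSpecIso A).inv :=
    (ConcreteCategory.bijective_of_isIso (Scheme.ΓSpecIso A).inv).1
  have hsurj : Function.Surjective (Scheme.ΓSpecIso A).inv :=
    (ConcreteCategory.bijective_of_isIso (Scheme.ΓSpecIso A).inv).2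
  refine ⟨hP, isSymmetricQuotient_of_isAffine hP (fun σ ↦ ?_) (fun a b hab ↦ ?_)
    fun a ha ↦ ?_, ?_⟩
  · rw [perm_affineSpace, hq, ← Spec.map_comp]
    congr 1
    refine CommRingCat.hom_ext (RingHom.ext fun a ↦ rename_esymmHom k n σ a)
  · obtain ⟨a, rfl⟩ := hsurj a
    obtain ⟨b, rfl⟩ := hsurj b
    have h1 := (hnat (esymmHom k n) a).symm.trans (hab.trans (hnat (esymmHom k n) b))
    rw [esymmHom_injective k n (hinj h1)]
  · obtain ⟨a, rfl⟩ := hsurj a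
    obtain ⟨b, hb⟩ := exists_esymmHom_eq k n a fun σ ↦ hinj <| by
      have := ha σ
      rw [perm_affineSpace] at this
      exact (hnat _ a).symm.trans this
    exact ⟨(Scheme.ΓSpecIso A).inv b, (hnat (esymmHom k n) b).trans (congrArg _ hb)⟩
  · rw [hq, affineSpaceHom, ← Spec.map_comp]
    congr 1
    exact CommRingCat.hom_ext (RingHom.ext fun c ↦ (esymmHom k n).commutes c)

open Polynomial in
-- Evaluate Vieta's identity for `∏ (T + X_i)` at `T = -s`. The term of `σ_0 = 1` is the constant
-- `(-s)^n`, and the shift by one turns `n - (i + 1)` into `n - 1 - i`.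
theorem esymmHom_hyperplane (s : k) : esymmHom k n (MvPolynomial.C ((-s) ^ n) +
    ∑ i : Fin n, MvPolynomial.C ((-s) ^ (n - 1 - (i : ℕ))) * MvPolynomial.X i) =
      ∏ i, (MvPolynomial.X i - MvPolynomial.C s) := by
  have h := congrArg (Polynomial.eval (MvPolynomial.C (-s)))
    (MvPolynomial.prod_C_add_X_eq_sum_esymm (R := k) (σ := Fin n))
  rw [Polynomial.eval_prod, Polynomial.eval_finsetSum, Finset.sum_range_succ', Fintype.card_fin,
    Finset.sum_range] at h
  simp only [eval_add, eval_X, eval_C, eval_mul, eval_pow, MvPolynomial.esymm_zero, one_mul,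
    Nat.sub_zero] at h
  have h1 : ∏ i : Fin n, (MvPolynomial.X i - MvPolynomial.C s) =
      ∏ i : Fin n, (MvPolynomial.C (-s) + MvPolynomial.X i) := by
    refine Finset.prod_congr rfl fun i _ ↦ ?_
    rw [map_neg]
    ring
  rw [h1, h, map_add, map_sum, add_comm, esymmHom]
  congr 1
  · refine Finset.sum_congr rfl fun i _ ↦ ?_
    rw [map_mul, MvPolynomial.aeval_X, MvPolynomial.algHom_C, MvPolynomial.algebraMap_eq, map_pow,
      mul_comm, Nat.sub_sub, add_comm 1]
  · rw [MvPolynomial.algHom_C, MvPolynomial.algebraMap_eq, map_pow]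

/-- The point of the line is the maximal ideal generated by `X - s`, so a prime containing this
generator is equal to it. -/
theorem coordinate_eq_linePoint_iff (i : Fin n) (s : k) (x : affineSpace k n) :
    coordinate k n i x = linePoint k s ↔
      MvPolynomial.X i - MvPolynomial.C s ∈ (show PrimeSpectrum _ from x).asIdeal := by
  let x' : PrimeSpectrum (MvPolynomial (Fin n) k) := x
  let φ : Polynomial k →ₐ[k] MvPolynomial (Fin n) k := Polynomial.aeval (MvPolynomial.X i)
  have hφ : φ (Polynomial.X - Polynomial.C s) = MvPolynomial.X i - MvPolynomial.C s := by
    simp [φ, MvPolynomial.algebraMap_eq]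
  have h1 : (coordinate k n i x : PrimeSpectrum _).asIdeal = x'.asIdeal.comap φ := rfl
  have h2 : (linePoint k s : PrimeSpectrum _).asIdeal =
      RingHom.ker (Polynomial.evalRingHom s) := rfl
  have h3 : RingHom.ker (Polynomial.evalRingHom s) = Ideal.span {Polynomial.X - Polynomial.C s} :=
    Polynomial.ker_evalRingHom s
  have h4 : (RingHom.ker (Polynomial.evalRingHom s)).IsMaximal :=
    RingHom.ker_isMaximal_of_surjective _ fun c ↦ ⟨Polynomial.C c, by simp⟩
  constructor
  · intro h
    rw [← hφ]
    change _ ∈ x'.asIdeal.comap φ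
    rw [← h1, h, h2, h3]
    exact Ideal.mem_span_singleton_self _
  · intro h
    refine PrimeSpectrum.ext ?_
    rw [h1, h2]
    refine (h4.eq_of_le (x'.isPrime.comap φ).ne_top ?_).symm
    rw [h3, Ideal.span_singleton_le_iff_mem, Ideal.mem_comap, hφ]
    exact h

theorem symmetricLocus_affineLine (S : Set k) :
    symmetricLocus (coordinate k n) (elementarySymmetric k n) (linePoint k '' S) =
      ⋃ s ∈ S, symmetricHyperplane k n s := by
  have h := isSymmetricPower_affineLine k n
  ext y
  obtain ⟨x, rfl⟩ := IsSymmetricQuotient.surjective h.isFibrePower h.isSymmetricQuotient y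
  rw [IsSymmetricQuotient.mem_symmetricLocus_iff h.isFibrePower h.isSymmetricQuotient]
  let x' : PrimeSpectrum (MvPolynomial (Fin n) k) := x
  have h1 (s : k) : elementarySymmetric k n x ∈ symmetricHyperplane k n s ↔
      ∃ i, coordinate k n i x = linePoint k s := by
    have h2 : elementarySymmetric k n x ∈ symmetricHyperplane k n s ↔
        esymmHom k n (MvPolynomial.C ((-s) ^ n) + ∑ i : Fin n,
          MvPolynomial.C ((-s) ^ (n - 1 - (i : ℕ))) * MvPolynomial.X i) ∈ x'.asIdeal :=
      Set.singleton_subset_iff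
    have := x'.isPrime
    rw [h2, esymmHom_hyperplane, Ideal.IsPrime.prod_mem_iff]
    simp only [Finset.mem_univ, true_and]
    exact exists_congr fun i ↦ (coordinate_eq_linePoint_iff k n i s x).symm
  simp only [Set.mem_iUnion, exists_prop, h1, Set.mem_image]
  exact ⟨fun ⟨i, s, hs, h⟩ ↦ ⟨s, hs, i, h.symm⟩, fun ⟨s, hs, i, h⟩ ↦ ⟨i, s, hs, h.symm⟩⟩

end AffineLine

end SymCurve

theorem proposition5 (k : Type u) [Field k] (n : ℕ) :
    (∀ (X : Scheme.{u}) (f : X ⟶ Spec (.of k)) [SmoothOfRelativeDimension 1 f] [IsSeparated f]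
        [QuasiCompact f] (S : Set X), S.Finite → (∀ s ∈ S, SymCurve.IsRationalPoint f s) →
      ∀ (P Y : Scheme.{u}) (p : P ⟶ Spec (.of k)) (π : Fin n → (P ⟶ X)) (q : P ⟶ Y)
        (g : Y ⟶ Spec (.of k)), SymCurve.IsSymmetricPower f p π q g →
      SymCurve.IsNormalCrossingsDivisor Y (SymCurve.symmetricLocus π q S) ∧
      ∀ y : Y, ∃ (W : Y.Opens) (c : (W : Scheme.{u}) ⟶ SymCurve.affineSpace k n)
        (J : Finset (Fin n)), y ∈ W ∧ Etale c ∧ c ≫ SymCurve.affineSpaceHom k n = W.ι ≫ g ∧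
          W.ι ⁻¹' SymCurve.symmetricLocus π q S =
            c ⁻¹' ⋃ j ∈ J, SymCurve.coordinateHyperplane k n j) ∧
    (SymCurve.IsSymmetricPower (SymCurve.affineLineHom k) (SymCurve.affineSpaceHom k n)
        (SymCurve.coordinate k n) (SymCurve.elementarySymmetric k n)
        (SymCurve.affineSpaceHom k n) ∧
      ∀ S : Set k, S.Finite →
        SymCurve.symmetricLocus (SymCurve.coordinate k n) (SymCurve.elementarySymmetric k n)
            (SymCurve.linePoint k '' S) =
          ⋃ s ∈ S, SymCurve.symmetricHyperplane k n s) := by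
  refine ⟨fun X f _ _ _ S hS hSr P Y p π q g h ↦ ?_, SymCurve.isSymmetricPower_affineLine k n,
    fun S _ ↦ SymCurve.symmetricLocus_affineLine k n S⟩
  have hc := fun y ↦ h.exists_etale_chart_of_finite hS hSr y
  refine ⟨SymCurve.isNormalCrossingsDivisor_of_etale_charts (k := k) (n := n) _ fun y ↦ ?_, hc⟩
  obtain ⟨W, c, J, hy, hc, -, hJ⟩ := hc y
  exact ⟨W, c, J, hy, hc, hJ⟩
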